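/- Let $(M,g,J)$ be a compact connected Kähler manifold of real dimension $2n$, $n\ge 2$, with Levi-Civita connection $\nabla$. Let $S$ be a $J$-invariant Killing tensor on $M$, that is, a smooth $g$-symmetric $(1,1)$-tensor with $SJ=JS$ and $$g((\nabla_XS)Y,Z)+g((\nabla_ZS)X,Y)+g((\nabla_YS)Z,X)=0\qquad\text{for all } X,Y,Z\in TM .$$ Suppose that $\mu:M\to\mathbb R$ is a nonconstant function such that at every $x\in M$ every eigenvalue of $S_x$ is $0$ or $\mu(x)$, and such that $\dim\ker S_x=2$ and $\dim\ker(S_x-\mu(x)\,\mathrm{Id})=2n-2$ whenever $\mu(x)\ne0$. Let $V=\{x\in M:\mu(x)\neq0,\ d\mu(x)\ne 0\}$. Then $\mu$ is smooth, the set $V$ is dense in $M$, the field $\xi=J\nabla\mu$ is a holomorphic Killing vector field on the whole of $M$ (that is, $\xi$ is smooth with $L_\xi g=0$ and $L_\xi J=0$), and $\mu$ is a special Kähler potential on the whole of $M$. Here a nonconstant function $\tau\in C^\infty(M)$ is called a special Kähler potential if $X=J\nabla\tau$ is a Killing vector field and, at every point with $d\tau\ne0$, all nonzero tangent vectors orthogonal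 to $X$ and $JX$ are eigenvectors of the Hessian $\nabla d\tau$; if $\dim M=4$, it is additionally required that $\nabla\tau$ be an eigenfield of the Ricci tensor of $(M,g)$. -/

import Mathlib

open Bundle Manifold FiberBundle
open scoped ContDiff

noncomputable section

namespace KaehlerKilling

variable {E : Type*} [NormedAddCommGroup E] [NormedSpace ℝ E]
  {M : Type*} [TopologicalSpace M] [ChartedSpace E M]

/-- Tangent spaces of the (boundaryless) manifold `M` modelled on `E`. -/
abbrev Tan (E : Type*) [NormedAddCommGroup E] [NormedSpace ℝ E]
    {M : Type*} [TopologicalSpace M] [ChartedSpace E M] (x : M) : Type _ :=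
  TangentSpace 𝓘(ℝ, E) x

/-- Vector fields on `M`, with no regularity assumed. -/
abbrev VField (E : Type*) [NormedAddCommGroup E] [NormedSpace ℝ E]
    (M : Type*) [TopologicalSpace M] [ChartedSpace E M] : Type _ :=
  ∀ x : M, Tan E x

/-- Fields of endomorphisms of the tangent spaces, that is (1,1)-tensors, with no regularity
assumed. -/
abbrev EndField (E : Type*) [NormedAddCommGroup E] [NormedSpace ℝ E]
    (M : Type*) [TopologicalSpace M] [ChartedSpace E M] : Type _ :=
  ∀ x : M, Tan E x →L[ℝ] Tan E x

/-- Differentiability of a vector field at a point. -/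
abbrev DiffAt [IsManifold 𝓘(ℝ, E) ∞ M] (X : VField E M) (x : M) : Prop :=
  MDifferentiableAt 𝓘(ℝ, E) (𝓘(ℝ, E).prod 𝓘(ℝ, E))
    (fun y => TotalSpace.mk' E (E := fun y : M => Tan E y) y (X y)) x

/-- Smoothness (`C^∞`) of a vector field. -/
def SmoothField [IsManifold 𝓘(ℝ, E) ∞ M] (X : VField E M) : Prop :=
  ContMDiff 𝓘(ℝ, E) (𝓘(ℝ, E).prod 𝓘(ℝ, E)) ∞
    (fun y => TotalSpace.mk' E (E := fun y : M => Tan E y) y (X y))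

/-- Smoothness (`C^∞`) of a (1,1)-tensor. -/
def SmoothEnd [IsManifold 𝓘(ℝ, E) ∞ M] (A : EndField E M) : Prop :=
  ContMDiff 𝓘(ℝ, E) (𝓘(ℝ, E).prod 𝓘(ℝ, E →L[ℝ] E)) ∞
    (fun y => TotalSpace.mk' (E →L[ℝ] E)
      (E := fun y : M => Tan E y →L[ℝ] Tan E y) y (A y))

/-- Smooth Riemannian metrics on `M`; `g.inner x u v` is `g_x(u, v)`. -/
abbrev RMetric (E : Type*) [NormedAddCommGroup E] [NormedSpace ℝ E]
    (M : Type*) [TopologicalSpace M] [ChartedSpace E M] [IsManifold 𝓘(ℝ, E) ∞ M] : Type _ :=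
  ContMDiffRiemannianMetric 𝓘(ℝ, E) ∞ E (fun x : M => Tan E x)

/-- The differential of a real function, `df(x) v`. -/
abbrev diff (f : M → ℝ) (x : M) : Tan E x →L[ℝ] ℝ := mvfderiv 𝓘(ℝ, E) f x

/-- The Lie bracket `[X, Y]`. -/
abbrev bracket (X Y : VField E M) : VField E M := VectorField.mlieBracket 𝓘(ℝ, E) X Y

variable [IsManifold 𝓘(ℝ, E) ∞ M] (g : RMetric E M)

instance finDimTan [FiniteDimensional ℝ E] (x : M) : FiniteDimensional ℝ (Tan E x) :=
  inferInstanceAs (FiniteDimensional ℝ E)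

instance t2Tan (x : M) : T2Space (Tan E x) := inferInstanceAs (T2Space E)

lemma differentiable_inner {Y Z : VField E M} {x : M} (hY : DiffAt Y x) (hZ : DiffAt Z x) :
    MDifferentiableAt 𝓘(ℝ, E) 𝓘(ℝ) (fun y => g.inner y (Y y) (Z y)) x := by
  have : MDifferentiableAt 𝓘(ℝ, E) (𝓘(ℝ, E).prod 𝓘(ℝ))
      (fun m ↦ TotalSpace.mk' ℝ (E := Bundle.Trivial M ℝ) m (g.inner m (Y m) (Z m))) x := by
    apply MDifferentiableAt.clm_bundle_apply₂ (F₁ := E) (F₂ := E)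
    · exact g.contMDiff.mdifferentiable (by simp) x
    · exact hY
    · exact hZ
  simp only [mdifferentiableAt_totalSpace] at this
  exact this.2

lemma diffAt_extend {x : M} (v : Tan E x) : DiffAt (extend E v) x :=
  mdifferentiableAt_extend 𝓘(ℝ, E) E v

section LeviCivita

variable [FiniteDimensional ℝ E]

/-- The flat isomorphism `v ↦ g(v, ·)`. -/
def flat (x : M) : Tan E x ≃ₗ[ℝ] Module.Dual ℝ (Tan E x) :=
  LinearEquiv.ofInjectiveOfFinrankEq
    (((ContinuousLinearMap.coeLM ℝ).comp (g.inner x).toLinearMap) :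
      Tan E x →ₗ[ℝ] Module.Dual ℝ (Tan E x))
    (by
      intro u v h
      by_contra huv
      have h1 := g.pos x (u - v) (sub_ne_zero.mpr huv)
      have h2 := congrArg (fun φ : Module.Dual ℝ (Tan E x) => φ (u - v)) h
      simp at h2
      simp [h2] at h1)
    (Subspace.dual_finrank_eq).symm

lemma flat_apply (x : M) (u v : Tan E x) : flat g x u v = g.inner x u v := rfl

/-- The sharp isomorphism: `g(sharp φ, v) = φ v`. -/
def sharp (x : M) : (Tan E x →L[ℝ] ℝ) →ₗ[ℝ] Tan E x :=
  (flat g x).symm.toLinearMap.comp (ContinuousLinearMap.coeLM ℝ)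

lemma inner_sharp (x : M) (φ : Tan E x →L[ℝ] ℝ) (v : Tan E x) :
    g.inner x (sharp g x φ) v = φ v := by
  rw [← flat_apply]; simp [sharp]

/-- The right-hand side of the Koszul formula for `g(∇_X Y, Z)`. -/
def koszul (X Y Z : VField E M) (x : M) : ℝ :=
  (diff (fun y => g.inner y (Y y) (Z y)) x (X x)
    + diff (fun y => g.inner y (X y) (Z y)) x (Y x)
    - diff (fun y => g.inner y (X y) (Y y)) x (Z x)
    + g.inner x (bracket X Y x) (Z x)
    - g.inner x (bracket X Z x) (Y x)
    - g.inner x (bracket Y Z x) (X x)) / 2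

lemma koszul_tensorial_left {Y Z : VField E M} {x : M} (hY : DiffAt Y x) (hZ : DiffAt Z x) :
    TensorialAt 𝓘(ℝ, E) E (fun X => koszul g X Y Z x) x where
  smul {f X} hf hX := by
    have e1 := mvfderiv_fun_mul hf (differentiable_inner g hX hZ)
    have e2 := mvfderiv_fun_mul hf (differentiable_inner g hX hY)
    have b1 := VectorField.mlieBracket_smul_left (W := Y) hf hX
    have b2 := VectorField.mlieBracket_smul_left (W := Z) hf hX
    simp [koszul, bracket, diff, b1, b2, e1, e2]
    rw [g.symm x (X x) (Z x), g.symm x (X x) (Y x), g.symm x (bracket Y Z x) (X x)]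
    ring
  add {X X'} hX hX' := by
    have e1 := mvfderiv_fun_add (differentiable_inner g hX hZ) (differentiable_inner g hX' hZ)
    have e2 := mvfderiv_fun_add (differentiable_inner g hX hY) (differentiable_inner g hX' hY)
    have b1 := VectorField.mlieBracket_add_left (W := Y) hX hX'
    have b2 := VectorField.mlieBracket_add_left (W := Z) hX hX'
    simp [koszul, bracket, diff, b1, b2, e1, e2]
    ring

lemma koszul_tensorial_right {X Y : VField E M} {x : M} (hX : DiffAt X x) (hY : DiffAt Y x) :
    TensorialAt 𝓘(ℝ, E) E (fun Z => koszul g X Y Z x) x where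
  smul {f Z} hf hZ := by
    have e1 := mvfderiv_fun_mul hf (differentiable_inner g hX hZ)
    have e2 := mvfderiv_fun_mul hf (differentiable_inner g hY hZ)
    have b1 := VectorField.mlieBracket_smul_right (V := X) hf hZ
    have b2 := VectorField.mlieBracket_smul_right (V := Y) hf hZ
    simp [koszul, bracket, diff, b1, b2, e1, e2]
    rw [g.symm x (X x) (Z x), g.symm x (Y x) (Z x)]
    ring
  add {Z Z'} hZ hZ' := by
    have e1 := mvfderiv_fun_add (differentiable_inner g hX hZ) (differentiable_inner g hX hZ')
    have e2 := mvfderiv_fun_add (differentiable_inner g hY hZ) (differentiable_inner g hY hZ')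
    have b1 := VectorField.mlieBracket_add_right (V := X) hZ hZ'
    have b2 := VectorField.mlieBracket_add_right (V := Y) hZ hZ'
    simp [koszul, bracket, diff, b1, b2, e1, e2]
    ring

lemma koszul_add_middle {X Y Y' Z : VField E M} {x : M} (hX : DiffAt X x) (hY : DiffAt Y x)
    (hY' : DiffAt Y' x) (hZ : DiffAt Z x) :
    koszul g X (Y + Y') Z x = koszul g X Y Z x + koszul g X Y' Z x := by
  have e1 := mvfderiv_fun_add (differentiable_inner g hX hY) (differentiable_inner g hX hY')
  have e2 := mvfderiv_fun_add (differentiable_inner g hY hZ) (differentiable_inner g hY' hZ)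
  have b1 := VectorField.mlieBracket_add_right (V := X) hY hY'
  have b2 := VectorField.mlieBracket_add_left (W := Z) hY hY'
  simp [koszul, bracket, diff, b1, b2, e1, e2]
  ring

lemma koszul_smul_middle {f : M → ℝ} {X Y Z : VField E M} {x : M}
    (hf : MDifferentiableAt 𝓘(ℝ, E) 𝓘(ℝ) f x) (hX : DiffAt X x) (hY : DiffAt Y x)
    (hZ : DiffAt Z x) :
    koszul g X (f • Y) Z x = f x * koszul g X Y Z x + diff f x (X x) * g.inner x (Y x) (Z x) := by
  have e1 := mvfderiv_fun_mul hf (differentiable_inner g hX hY)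
  have e2 := mvfderiv_fun_mul hf (differentiable_inner g hY hZ)
  have b1 := VectorField.mlieBracket_smul_right (V := X) hf hY
  have b2 := VectorField.mlieBracket_smul_left (W := Z) hf hY
  simp [koszul, bracket, diff, b1, b2, e1, e2]
  rw [g.symm x (X x) (Y x)]
  ring

/-- The Koszul formula as a bilinear form in `(X x, Z x)`. -/
def koszulForm {Y : VField E M} {x : M} (hY : DiffAt Y x) :
    Tan E x →L[ℝ] Tan E x →L[ℝ] ℝ :=
  TensorialAt.mkHom₂ (fun X Z => koszul g X Y Z x) x
    (fun _ hZ => koszul_tensorial_left g hY hZ) (fun _ hX => koszul_tensorial_right g hX hY)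

lemma koszulForm_apply {X Y Z : VField E M} {x : M} (hX : DiffAt X x) (hY : DiffAt Y x)
    (hZ : DiffAt Z x) : koszulForm g hY (X x) (Z x) = koszul g X Y Z x :=
  TensorialAt.mkHom₂_apply _ _ hX hZ

open Classical in
/-- The map underlying the Levi-Civita connection: `nabla g Y x u = ∇_u Y`, the vector determined
by the Koszul formula (with the value `0` where `Y` is not differentiable). -/
def nabla (Y : VField E M) (x : M) : Tan E x →L[ℝ] Tan E x :=
  if hY : DiffAt Y x then
    LinearMap.toContinuousLinearMap ((sharp g x).comp (koszulForm g hY).toLinearMap)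
  else 0

lemma inner_nabla {X Y Z : VField E M} {x : M} (hX : DiffAt X x) (hY : DiffAt Y x)
    (hZ : DiffAt Z x) : g.inner x (nabla g Y x (X x)) (Z x) = koszul g X Y Z x := by
  rw [← koszulForm_apply g hX hY hZ]
  simp [nabla, hY, inner_sharp]

lemma ext_inner {x : M} {u v : Tan E x} (h : ∀ w, g.inner x u w = g.inner x v w) : u = v :=
  (flat g x).injective (LinearMap.ext h)

/-- The Levi-Civita connection of `g`. -/
def leviCivita : CovariantDerivative 𝓘(ℝ, E) E (fun x : M => Tan E x) where
  toFun := nabla g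
  isCovariantDerivativeOnUniv :=
    { add := by
        intro Y Y' x hY hY' _
        ext u
        apply ext_inner g
        intro w
        have hu := diffAt_extend u
        have hw := diffAt_extend w
        have h := inner_nabla g hu (mdifferentiableAt_add_section hY hY') hw
        rw [koszul_add_middle g hu hY hY' hw, ← inner_nabla g hu hY hw,
          ← inner_nabla g hu hY' hw] at h
        simpa using h
      leibniz := by
        intro Y f x hY hf _
        ext u
        apply ext_inner g
        intro w
        have hu := diffAt_extend u
        have hw := diffAt_extend w
        have h := inner_nabla g hu (hf.smul_section hY) hw
        rw [koszul_smul_middle g hf hu hY hw, ← inner_nabla g hu hY hw] at h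
        simpa using h }

/-- The Levi-Civita connection is torsion-free. -/
lemma leviCivita_torsion {X Y : VField E M} {x : M} (hX : DiffAt X x) (hY : DiffAt Y x) :
    leviCivita g Y x (X x) - leviCivita g X x (Y x) = bracket X Y x := by
  apply ext_inner g
  intro w
  have hw := diffAt_extend w
  have h1 := inner_nabla g hX hY hw
  have h2 := inner_nabla g hY hX hw
  simp only [extend_apply_self] at h1 h2
  have e : (fun y => g.inner y (X y) (Y y)) = fun y => g.inner y (Y y) (X y) :=
    funext fun y => g.symm y _ _
  have b : bracket Y X x = - bracket X Y x := VectorField.mlieBracket_swap_apply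
  simp only [map_sub, sub_apply]
  change g.inner x (nabla g Y x (X x)) w - g.inner x (nabla g X x (Y x)) w = _
  rw [h1, h2]
  simp only [koszul, e, b, map_neg, neg_apply, extend_apply_self]
  ring

/-- The Levi-Civita connection is compatible with the metric. -/
lemma leviCivita_metric {X Y Z : VField E M} {x : M} (hX : DiffAt X x) (hY : DiffAt Y x)
    (hZ : DiffAt Z x) :
    diff (fun y => g.inner y (Y y) (Z y)) x (X x) =
      g.inner x (leviCivita g Y x (X x)) (Z x) + g.inner x (Y x) (leviCivita g Z x (X x)) := by
  rw [g.symm x (Y x)]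
  change _ = g.inner x (nabla g Y x (X x)) (Z x) + g.inner x (nabla g Z x (X x)) (Y x)
  rw [inner_nabla g hX hY hZ, inner_nabla g hX hZ hY]
  have e : (fun y => g.inner y (Z y) (Y y)) = fun y => g.inner y (Y y) (Z y) :=
    funext fun y => g.symm y _ _
  have b : bracket Z Y x = - bracket Y Z x := VectorField.mlieBracket_swap_apply
  simp only [koszul, e, b, map_neg, neg_apply]
  ring

/-- The gradient `∇f`, defined by `g(∇f, v) = df(v)`. -/
def grad (f : M → ℝ) : VField E M := fun x => sharp g x (diff f x)

/-- The Hessian `∇df` as an endomorphism: `∇df(u, v) = g(∇_u ∇f, v) = g(hess f u, v)`. -/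
def hess (f : M → ℝ) : EndField E M := leviCivita g (grad g f)

/-- The covariant derivative of a (1,1)-tensor: `covEnd g A x u v = (∇_u A) v`, where
`(∇_u A) V = ∇_u (A V) - A (∇_u V)` for any vector field `V` with value `v` at `x`. -/
def covEnd (A : EndField E M) (x : M) (u v : Tan E x) : Tan E x :=
  leviCivita g (fun y => A y (extend E v y)) x u - A x (leviCivita g (extend E v) x u)

/-- The curvature tensor: `curv g x u v w = R(u, v) w`, where
`R(U, V) W = ∇_U ∇_V W - ∇_V ∇_U W - ∇_[U, V] W` for any smooth extensions `U`, `V`, `W` of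
`u`, `v`, `w`. -/
def curv (x : M) (u v w : Tan E x) : Tan E x :=
  leviCivita g (fun y => leviCivita g (extend E w) y (extend E v y)) x u
    - leviCivita g (fun y => leviCivita g (extend E w) y (extend E u y)) x v
    - leviCivita g (extend E w) x (bracket (extend E u) (extend E v) x)

/-- The Ricci tensor: `Ric(v, w)` is the trace of `u ↦ R(u, v) w`, computed in a basis. -/
def ricci (x : M) (v w : Tan E x) : ℝ :=
  ∑ i, (Module.finBasis ℝ (Tan E x)).coord i (curv g x (Module.finBasis ℝ (Tan E x) i) v w)

/-- `(M, g, J)` is a Kähler manifold: `J` is a smooth almost complex structure that is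
`g`-orthogonal and parallel, `∇J = 0` (equivalently, `J` is integrable and the form
`g(J ·, ·)` is closed). -/
structure IsKaehler (J : EndField E M) : Prop where
  smooth : SmoothEnd J
  sq (x : M) (v : Tan E x) : J x (J x v) = -v
  orthogonal (x : M) (u v : Tan E x) : g.inner x (J x u) (J x v) = g.inner x u v
  parallel (x : M) (u v : Tan E x) : covEnd g J x u v = 0

/-- A Killing tensor: a smooth symmetric (1,1)-tensor `S` such that the cyclic sum of
`g((∇_u S) v, w)` vanishes. -/
structure IsKillingTensor (S : EndField E M) : Prop where
  smooth : SmoothEnd S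
  symmetric (x : M) (u v : Tan E x) : g.inner x (S x u) v = g.inner x u (S x v)
  cyclic (x : M) (u v w : Tan E x) :
    g.inner x (covEnd g S x u v) w + g.inner x (covEnd g S x w u) v
      + g.inner x (covEnd g S x v w) u = 0

/-- A Killing vector field: a smooth field `X` with `L_X g = 0`, that is
`X (g(Y, Z)) = g([X, Y], Z) + g(Y, [X, Z])`. -/
structure IsKillingField (X : VField E M) : Prop where
  smooth : SmoothField X
  lie (x : M) (Y Z : VField E M) (hY : DiffAt Y x) (hZ : DiffAt Z x) :
    diff (fun y => g.inner y (Y y) (Z y)) x (X x) =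
      g.inner x (bracket X Y x) (Z x) + g.inner x (Y x) (bracket X Z x)

end LeviCivita

/-- A (real) holomorphic vector field: a smooth field `X` with `L_X J = 0`, that is
`[X, J Y] = J [X, Y]`. -/
structure IsHolomorphicField (J : EndField E M) (X : VField E M) : Prop where
  smooth : SmoothField X
  lie (x : M) (Y : VField E M) (hY : DiffAt Y x) :
    bracket X (fun y => J y (Y y)) x = J x (bracket X Y x)

variable [FiniteDimensional ℝ E]

/-- A special Kähler potential on `(M, g, J)`: a nonconstant smooth function `τ` such that
`X = J ∇τ` is a Killing field and, wherever `dτ ≠ 0`, all nonzero vectors orthogonal to `X` and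
`J X` are eigenvectors of `∇dτ`; in real dimension four, `∇τ` is moreover an eigenfield of the
Ricci tensor. -/
structure IsSpecialKaehlerPotential (J : EndField E M) (τ : M → ℝ) : Prop where
  smooth : ContMDiff 𝓘(ℝ, E) 𝓘(ℝ) ∞ τ
  nonconstant : ∃ x y, τ x ≠ τ y
  killing : IsKillingField g (fun x => J x (grad g τ x))
  eigen (x : M) (hx : diff (E := E) τ x ≠ 0) (v : Tan E x) (hv : v ≠ 0)
    (h1 : g.inner x v (J x (grad g τ x)) = 0)
    (h2 : g.inner x v (J x (J x (grad g τ x))) = 0) :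
    ∃ c : ℝ, Module.End.HasEigenvector (hess g τ x).toLinearMap c v
  ricci_eigen (hdim : Module.finrank ℝ E = 4) (x : M) :
    ∃ c : ℝ, ∀ w, ricci g x (grad g τ x) w = c * g.inner x (grad g τ x) w

end KaehlerKilling

end

/-!
Write `H` for the Hessian of `μ` (an endomorphism), `N = ∇μ`, and `V` for the set where `μ ≠ 0` and
`dμ ≠ 0`. Symmetry of `S` and the hypothesis on its eigenvalues give `S² = μ S`, and
`tr S = (2n - 2) μ` shows that `μ` is smooth.

*The Hessian on `V`.* Differentiating `S² = μ S` and combining the result with the Killing equation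
gives `S N = 0` (`IsKillingJet.S_grad`), so that `N`, `JN` span the kernel of `S`, and then
`H = |N|² / (2μ)` on the other eigenspace of `S` (`IsKillingJet.hess_of_range`). The endomorphism
`F = JH + HJ` is skew and represents the closed two-form `dκ`, `κ = g(JN, ·)`. It is known on the
range of `S`, and closedness, evaluated on `u, z, Jz` with `u` in the kernel and `z` in the range of
`S`, yields `H JN = J H N`; hence `H` commutes with `J` on `V` (`IsKillingJet.hess_comm`).

*From `V` to `M`.* Outside the closure of `V` the function `μ` is locally constant, so `H` vanishes
there and `HJ = JH` on all of `M` by continuity (`IsLocalKilling.hess_comm`). This says that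
`∇(JN) = JH` is skew and commutes with `J`: the field `JN` is Killing and holomorphic. Killing's
equation expresses the second derivatives of `κ` through `κ` and its first derivatives; by
Grönwall's inequality along segments `κ` vanishes on a ball if it does so near one of its points
(`eq_zero_of_killing`). Since `M` is connected and `μ` is not constant, `dμ` vanishes on no nonempty
open set, and `V` is dense. Finally `μ = 0` forces `dμ = 0` (`IsLocalKilling.potential_ne_zero`), so
that the description of `H` on `V` covers all points with `dμ ≠ 0`.

*The Ricci tensor.* For a Killing potential on a Kähler manifold `Ric(N, ·) = -½ d(tr H)`
(`IsLocalKilling.opTrace_curvOp_grad`). On `V`, `H` has the eigenvalues `|N|² / (2μ)` and `α`, where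
`α dμ = ½ d|N|²`; differentiating this relation shows that `dα`, and therefore `d(tr H)`, is
proportional to `dμ`.

The computations are done in the charts of `M`, in terms of the Christoffel symbols. The first part
of the file translates between the two languages.
-/

noncomputable section

namespace KaehlerKilling

/-! ### Reading tensor fields in a chart -/

section Chart

variable {E : Type*} [NormedAddCommGroup E] [NormedSpace ℝ E]
  {M : Type*} [TopologicalSpace M] [ChartedSpace E M] (x₀ : M)

/-- The parametrization of a neighbourhood of `x₀` inverse to the preferred chart at `x₀`. -/
def par (q : E) : M := (extChartAt 𝓘(ℝ, E) x₀).symm q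

variable (E) in
/-- The chart coordinates at `x₀`. -/
def coo (y : M) : E := extChartAt 𝓘(ℝ, E) x₀ y

variable (E) in
/-- The open set of `E` on which `par x₀` is a parametrization. -/
def dom : Set E := (extChartAt 𝓘(ℝ, E) x₀).target

lemma isOpen_dom : IsOpen (dom E x₀) := isOpen_extChartAt_target x₀

lemma par_mem {q : E} (hq : q ∈ dom E x₀) : par x₀ q ∈ (chartAt E x₀).source := by
  have := (extChartAt 𝓘(ℝ, E) x₀).map_target hq
  rwa [extChartAt_source] at this

lemma coo_par {q : E} (hq : q ∈ dom E x₀) : coo E x₀ (par x₀ q) = q :=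
  (extChartAt 𝓘(ℝ, E) x₀).right_inv hq

lemma par_coo {y : M} (hy : y ∈ (chartAt E x₀).source) : par x₀ (coo E x₀ y) = y :=
  (extChartAt 𝓘(ℝ, E) x₀).left_inv (by rwa [extChartAt_source])

lemma coo_mem {y : M} (hy : y ∈ (chartAt E x₀).source) : coo E x₀ y ∈ dom E x₀ :=
  (extChartAt 𝓘(ℝ, E) x₀).map_source (by rwa [extChartAt_source])

variable [IsManifold 𝓘(ℝ, E) ∞ M]

/-- The coordinate frame at `y`, as a map from the model space to the tangent space. -/
def frame (y : M) : E →L[ℝ] Tan E y :=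
  (trivializationAt E (fun y : M => Tan E y) x₀).symmL ℝ y

/-- The components of a tangent vector at `y` with respect to the coordinate frame. -/
def coframe (y : M) : Tan E y →L[ℝ] E :=
  (trivializationAt E (fun y : M => Tan E y) x₀).continuousLinearMapAt ℝ y

lemma coframe_frame {y : M} (hy : y ∈ (chartAt E x₀).source) (v : E) :
    coframe x₀ y (frame x₀ y v) = v :=
  Trivialization.continuousLinearMapAt_symmL _ (by exact hy) v

lemma frame_coframe {y : M} (hy : y ∈ (chartAt E x₀).source) (v : Tan E y) :
    frame x₀ y (coframe x₀ y v) = v :=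
  Trivialization.symmL_continuousLinearMapAt _ (by exact hy) v

lemma contMDiffAt_par {q : E} (hq : q ∈ dom E x₀) :
    ContMDiffAt 𝓘(ℝ, E) 𝓘(ℝ, E) ∞ (par x₀ : E → M) q :=
  (contMDiffOn_extChartAt_symm x₀).contMDiffAt ((isOpen_dom x₀).mem_nhds hq)

lemma contMDiffAt_coo {y : M} (hy : y ∈ (chartAt E x₀).source) :
    ContMDiffAt 𝓘(ℝ, E) 𝓘(ℝ, E) ∞ (coo E x₀ : M → E) y :=
  contMDiffAt_extChartAt' hy

lemma mfderiv_par {q : E} (hq : q ∈ dom E x₀) :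
    mfderiv 𝓘(ℝ, E) 𝓘(ℝ, E) (par x₀ : E → M) q = (frame x₀ (par x₀ q) : E →L[ℝ] _) := by
  have h := TangentBundle.symmL_trivializationAt (I := 𝓘(ℝ, E)) (par_mem x₀ hq)
  have h2 : extChartAt 𝓘(ℝ, E) x₀ (par x₀ q) = q := coo_par x₀ hq
  have h3 : Set.range 𝓘(ℝ, E) = Set.univ := by simp
  rw [h2, h3, mfderivWithin_univ] at h
  exact h.symm

/-- The components of a vector field in the chart. -/
def vecRep (Y : VField E M) (q : E) : E := coframe x₀ (par x₀ q) (Y (par x₀ q))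

lemma vecRep_coo (Y : VField E M) {y : M} (hy : y ∈ (chartAt E x₀).source) :
    vecRep x₀ Y (coo E x₀ y) = coframe x₀ y (Y y) := by
  have : ∀ z, z = y → coframe x₀ z (Y z) = coframe x₀ y (Y y) := by rintro _ rfl; rfl
  exact this _ (par_coo x₀ hy)

lemma contMDiffAt_field_iff (Y : VField E M) {q : E} (hq : q ∈ dom E x₀) :
    ContMDiffAt 𝓘(ℝ, E) (𝓘(ℝ, E).prod 𝓘(ℝ, E)) ∞
      (fun y => TotalSpace.mk' E (E := fun y : M => Tan E y) y (Y y)) (par x₀ q) ↔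
    ContDiffAt ℝ ∞ (vecRep x₀ Y) q := by
  have hmem := par_mem x₀ hq
  have key := Trivialization.contMDiffAt_section_iff (n := ∞) (IB := 𝓘(ℝ, E)) (s := Y)
    (trivializationAt E (fun y : M => Tan E y) x₀) (by exact hmem)
  refine key.trans ?_
  have e1 : (fun x => ((trivializationAt E (fun y : M => Tan E y) x₀) ⟨x, Y x⟩).2)
      =ᶠ[nhds (par x₀ q)] fun y => coframe x₀ y (Y y) := by
    filter_upwards [(chartAt E x₀).open_source.mem_nhds hmem] with y hy
    exact (Trivialization.continuousLinearMapAt_apply_of_mem ℝ _ (by exact hy) _).symm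
  rw [e1.contMDiffAt_iff]
  constructor
  · intro h
    exact contMDiffAt_iff_contDiffAt.1 (h.comp q (contMDiffAt_par x₀ hq))
  · intro h
    have h1 : ContMDiffAt 𝓘(ℝ, E) 𝓘(ℝ, E) ∞ (vecRep x₀ Y ∘ coo E x₀) (par x₀ q) := by
      refine ContMDiffAt.comp _ ?_ (contMDiffAt_coo x₀ hmem)
      rw [coo_par x₀ hq]
      exact contMDiffAt_iff_contDiffAt.2 h
    refine h1.congr_of_eventuallyEq ?_
    filter_upwards [(chartAt E x₀).open_source.mem_nhds hmem] with y hy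
    exact (vecRep_coo x₀ Y hy).symm

lemma diffAt_iff (Y : VField E M) {q : E} (hq : q ∈ dom E x₀) :
    DiffAt Y (par x₀ q) ↔ DifferentiableAt ℝ (vecRep x₀ Y) q := by
  have hmem := par_mem x₀ hq
  have key := Trivialization.mdifferentiableAt_section_iff 𝓘(ℝ, E) 
    (trivializationAt E (fun y : M => Tan E y) x₀) Y (b₀ := par x₀ q) (by exact hmem)
  refine key.trans ?_
  have e1 : (fun x => ((trivializationAt E (fun y : M => Tan E y) x₀) ⟨x, Y x⟩).2)
      =ᶠ[nhds (par x₀ q)] fun y => coframe x₀ y (Y y) := by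
    filter_upwards [(chartAt E x₀).open_source.mem_nhds hmem] with y hy
    exact (Trivialization.continuousLinearMapAt_apply_of_mem ℝ _ (by exact hy) _).symm
  rw [e1.mdifferentiableAt_iff]
  constructor
  · intro h
    exact mdifferentiableAt_iff_differentiableAt.1
      (h.comp q ((contMDiffAt_par x₀ hq).mdifferentiableAt (by simp)))
  · intro h
    have h1 : MDifferentiableAt 𝓘(ℝ, E) 𝓘(ℝ, E) (vecRep x₀ Y ∘ coo E x₀) (par x₀ q) := by
      refine MDifferentiableAt.comp (I' := 𝓘(ℝ, E)) _ ?_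
        ((contMDiffAt_coo x₀ hmem).mdifferentiableAt (by simp))
      rw [coo_par x₀ hq]
      exact mdifferentiableAt_iff_differentiableAt.2 h
    refine h1.congr_of_eventuallyEq ?_
    filter_upwards [(chartAt E x₀).open_source.mem_nhds hmem] with y hy
    exact (vecRep_coo x₀ Y hy).symm

lemma diff_frame {f : M → ℝ} {q : E} (hq : q ∈ dom E x₀)
    (hf : MDifferentiableAt 𝓘(ℝ, E) 𝓘(ℝ) f (par x₀ q)) (v : E) :
    diff f (par x₀ q) (frame x₀ (par x₀ q) v) = fderiv ℝ (fun p => f (par x₀ p)) q v := by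
  have hp := (contMDiffAt_par x₀ hq).mdifferentiableAt (by simp)
  have h := mfderiv_comp q hf hp
  rw [mfderiv_par x₀ hq] at h
  have h2 : fderiv ℝ (fun p => f (par x₀ p)) q = mfderiv 𝓘(ℝ, E) 𝓘(ℝ) (f ∘ par x₀) q :=
    mfderiv_eq_fderiv.symm
  rw [h2, h]
  rfl

/-- The vector field with constant components `v` in the chart. -/
def coordField (v : E) : VField E M := fun y => frame x₀ y v

lemma vecRep_coordField (v : E) {q : E} (hq : q ∈ dom E x₀) :
    vecRep x₀ (coordField x₀ v) q = v :=
  coframe_frame x₀ (par_mem x₀ hq) v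

lemma vecRep_coordField_eventuallyEq (v : E) {q : E} (hq : q ∈ dom E x₀) :
    vecRep x₀ (coordField x₀ v) =ᶠ[nhds q] fun _ => v := by
  filter_upwards [(isOpen_dom x₀).mem_nhds hq] with p hp using vecRep_coordField x₀ v hp

lemma contMDiffAt_coordField (v : E) {q : E} (hq : q ∈ dom E x₀) :
    ContMDiffAt 𝓘(ℝ, E) (𝓘(ℝ, E).prod 𝓘(ℝ, E)) ∞
      (fun y => TotalSpace.mk' E (E := fun y : M => Tan E y) y (coordField x₀ v y))
      (par x₀ q) :=
  (contMDiffAt_field_iff x₀ _ hq).2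
    (contDiffAt_const.congr_of_eventuallyEq (vecRep_coordField_eventuallyEq x₀ v hq))

lemma diffAt_coordField (v : E) {q : E} (hq : q ∈ dom E x₀) :
    DiffAt (coordField x₀ v) (par x₀ q) :=
  (contMDiffAt_coordField x₀ v hq).mdifferentiableAt (by simp)

lemma extend_eq_coordField (v : Tan E x₀) {y : M} (hy : y ∈ (chartAt E x₀).source) :
    extend E v y = coordField x₀ (coframe x₀ x₀ v) y := by
  have h : coframe x₀ x₀ v = (trivializationAt E (fun y : M => Tan E y) x₀ ⟨x₀, v⟩).2 :=
    Trivialization.continuousLinearMapAt_apply_of_mem ℝ _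
      (mem_baseSet_trivializationAt' (F := E) (E := fun y : M => Tan E y) x₀) v
  rw [h]
  exact (Trivialization.symmL_apply (R := ℝ) _ (by exact hy) _).symm

lemma two_le_infty : (2 : ℕ∞ω) ≤ ∞ := by
  have : ((2 : ℕ∞) : ℕ∞ω) ≤ ((⊤ : ℕ∞) : ℕ∞ω) := WithTop.coe_le_coe.2 le_top
  exact this

lemma mpullback_par (X : VField E M) {q : E} (hq : q ∈ dom E x₀) :
    VectorField.mpullback 𝓘(ℝ, E) 𝓘(ℝ, E) (par x₀) X q = vecRep x₀ X q := by
  have h : (mfderiv 𝓘(ℝ, E) 𝓘(ℝ, E) (par x₀ : E → M) q).inverse =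
      (coframe x₀ (par x₀ q) : Tan E (par x₀ q) →L[ℝ] E) := by
    apply ContinuousLinearMap.inverse_eq
    · refine ContinuousLinearMap.ext fun w => ?_
      refine Eq.trans ?_ (frame_coframe x₀ (par_mem x₀ hq) w)
      exact congrArg (fun L : E →L[ℝ] Tan E (par x₀ q) => L (coframe x₀ (par x₀ q) w))
        (mfderiv_par x₀ hq)
    · refine ContinuousLinearMap.ext fun w => ?_
      refine Eq.trans ?_ (coframe_frame x₀ (par_mem x₀ hq) w)
      exact congrArg (fun L : E →L[ℝ] Tan E (par x₀ q) => coframe x₀ (par x₀ q) (L w))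
        (mfderiv_par x₀ hq)
  exact congrArg (fun L : Tan E (par x₀ q) →L[ℝ] E => L (X (par x₀ q))) h

lemma bracket_coordField [CompleteSpace E] (u v : E) {q : E} (hq : q ∈ dom E x₀) :
    bracket (coordField x₀ u) (coordField x₀ v) (par x₀ q) = 0 := by
  have : IsManifold 𝓘(ℝ, E) (minSmoothness ℝ 2) M :=
    IsManifold.of_le (n := ∞) (by simpa using two_le_infty)
  have h := VectorField.mpullback_mlieBracket (I := 𝓘(ℝ, E)) (n := ∞)
    (diffAt_coordField x₀ u hq) (diffAt_coordField x₀ v hq) (contMDiffAt_par x₀ hq)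
    (by simpa using two_le_infty)
  have hc : ∀ w : E, VectorField.mpullback 𝓘(ℝ, E) 𝓘(ℝ, E) (par x₀) (coordField x₀ w)
      =ᶠ[nhds q] (fun _ => w : E → E) := by
    intro w
    filter_upwards [(isOpen_dom x₀).mem_nhds hq] with p hp
    exact (mpullback_par x₀ _ hp).trans (vecRep_coordField x₀ w hp)
  have h0 : VectorField.mlieBracket 𝓘(ℝ, E) (fun _ => u : E → E) (fun _ => v : E → E) q
      = (0 : E) := by
    have h1 := congrFun (VectorField.mlieBracketWithin_eq_lieBracketWithin (𝕜 := ℝ)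
      (V := (fun _ => u : E → E)) (W := (fun _ => v : E → E)) (s := Set.univ)) q
    refine h1.trans ?_
    rw [VectorField.lieBracketWithin_univ, VectorField.lieBracket]
    simp
    rfl
  have h2 : vecRep x₀ (bracket (coordField x₀ u) (coordField x₀ v)) q = 0 :=
    ((mpullback_par x₀ _ hq).symm.trans h).trans
    (((hc u).mlieBracket_vectorField_eq (hc v)).trans h0)
  have h3 := frame_coframe x₀ (par_mem x₀ hq)
    (bracket (coordField x₀ u) (coordField x₀ v) (par x₀ q))
  rw [← h3]
  exact (congrArg (frame x₀ (par x₀ q)) h2).trans (map_zero _)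

/-- The components of a `(1,1)`-tensor in the chart. -/
def endRep (A : EndField E M) (q : E) : E →L[ℝ] E :=
  (coframe x₀ (par x₀ q)).comp ((A (par x₀ q)).comp (frame x₀ (par x₀ q)))

lemma endRep_apply (A : EndField E M) (q v : E) :
    endRep x₀ A q v = coframe x₀ (par x₀ q) (A (par x₀ q) (frame x₀ (par x₀ q) v)) := rfl

lemma frame_endRep (A : EndField E M) {q : E} (hq : q ∈ dom E x₀) (v : E) :
    frame x₀ (par x₀ q) (endRep x₀ A q v) = A (par x₀ q) (frame x₀ (par x₀ q) v) := by
  rw [endRep_apply, frame_coframe x₀ (par_mem x₀ hq)]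

lemma frame_vecRep (Y : VField E M) {q : E} (hq : q ∈ dom E x₀) :
    frame x₀ (par x₀ q) (vecRep x₀ Y q) = Y (par x₀ q) :=
  frame_coframe x₀ (par_mem x₀ hq) _

lemma frame_injective {q : E} (hq : q ∈ dom E x₀) :
    Function.Injective (frame x₀ (par x₀ q) : E → Tan E (par x₀ q)) := fun u v h => by
  rw [← coframe_frame x₀ (par_mem x₀ hq) u, h, coframe_frame x₀ (par_mem x₀ hq)]

lemma contMDiffAt_end_apply {A : EndField E M} (hA : SmoothEnd A) {Y : VField E M} {x : M}
    (hY : ContMDiffAt 𝓘(ℝ, E) (𝓘(ℝ, E).prod 𝓘(ℝ, E)) ∞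
      (fun y => TotalSpace.mk' E (E := fun y : M => Tan E y) y (Y y)) x) :
    ContMDiffAt 𝓘(ℝ, E) (𝓘(ℝ, E).prod 𝓘(ℝ, E)) ∞
      (fun y => TotalSpace.mk' E (E := fun y : M => Tan E y) y (A y (Y y))) x :=
  ContMDiffAt.clm_bundle_apply (F₁ := E) (F₂ := E) (E₁ := fun y : M => Tan E y)
    (E₂ := fun y : M => Tan E y) (hA x) hY

lemma diffAt_end_apply {A : EndField E M} (hA : SmoothEnd A) {Y : VField E M} {x : M}
    (hY : DiffAt Y x) : DiffAt (fun y => A y (Y y)) x :=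
  MDifferentiableAt.clm_bundle_apply (F₁ := E) (F₂ := E) (E₁ := fun y : M => Tan E y)
    (E₂ := fun y : M => Tan E y) (hA.mdifferentiable (by simp) x) hY

section
variable [FiniteDimensional ℝ E]

lemma contDiffOn_endRep {A : EndField E M} (hA : SmoothEnd A) :
    ContDiffOn ℝ ∞ (endRep x₀ A) (dom E x₀) := by
  rw [contDiffOn_clm_apply]
  intro v q hq
  have h := contMDiffAt_end_apply hA (contMDiffAt_coordField x₀ v hq)
  exact ((contMDiffAt_field_iff x₀ _ hq).1 h).contDiffWithinAt

end

variable (g : RMetric E M)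

/-- The components of the metric in the chart. -/
def metRep (q : E) : E →L[ℝ] E →L[ℝ] ℝ :=
  (ContinuousLinearMap.precomp ℝ (frame x₀ (par x₀ q))).comp
    ((g.inner (par x₀ q)).comp (frame x₀ (par x₀ q)))

lemma metRep_apply (q u v : E) : metRep x₀ g q u v =
    g.inner (par x₀ q) (frame x₀ (par x₀ q) u) (frame x₀ (par x₀ q) v) := rfl

lemma metRep_vecRep (X Y : VField E M) {q : E} (hq : q ∈ dom E x₀) :
    metRep x₀ g q (vecRep x₀ X q) (vecRep x₀ Y q) =
      g.inner (par x₀ q) (X (par x₀ q)) (Y (par x₀ q)) := by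
  rw [metRep_apply, frame_vecRep x₀ X hq, frame_vecRep x₀ Y hq]

lemma contMDiffAt_inner {X Y : VField E M} {x : M}
    (hX : ContMDiffAt 𝓘(ℝ, E) (𝓘(ℝ, E).prod 𝓘(ℝ, E)) ∞
      (fun y => TotalSpace.mk' E (E := fun y : M => Tan E y) y (X y)) x)
    (hY : ContMDiffAt 𝓘(ℝ, E) (𝓘(ℝ, E).prod 𝓘(ℝ, E)) ∞
      (fun y => TotalSpace.mk' E (E := fun y : M => Tan E y) y (Y y)) x) :
    ContMDiffAt 𝓘(ℝ, E) 𝓘(ℝ) ∞ (fun y => g.inner y (X y) (Y y)) x := by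
  have : ContMDiffAt 𝓘(ℝ, E) (𝓘(ℝ, E).prod 𝓘(ℝ)) ∞
      (fun m ↦ TotalSpace.mk' ℝ (E := Bundle.Trivial M ℝ) m (g.inner m (X m) (Y m))) x := by
    apply ContMDiffAt.clm_bundle_apply₂ (F₁ := E) (F₂ := E)
    · exact g.contMDiff x
    · exact hX
    · exact hY
  simp only [contMDiffAt_totalSpace] at this
  exact this.2

variable [FiniteDimensional ℝ E]

lemma contDiffOn_metRep : ContDiffOn ℝ ∞ (metRep x₀ g) (dom E x₀) := by
  rw [contDiffOn_clm_apply]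
  intro u
  rw [contDiffOn_clm_apply]
  intro v q hq
  have h := contMDiffAt_inner g (contMDiffAt_coordField x₀ u hq) (contMDiffAt_coordField x₀ v hq)
  exact (contMDiffAt_iff_contDiffAt.1 (h.comp q (contMDiffAt_par x₀ hq))).contDiffWithinAt

open Classical in
/-- The Christoffel symbols of the Levi-Civita connection in the chart: `chris x₀ g q u v` has the
components of the derivative of the coordinate field `v` in the direction `u` (and is `0` outside
the domain of the chart). -/
def chris (q : E) : E →L[ℝ] E →L[ℝ] E :=
  if hq : q ∈ dom E x₀ then
    LinearMap.toContinuousBilinearMap (LinearMap.mk₂ ℝ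
      (fun u v => coframe x₀ (par x₀ q)
        (leviCivita g (coordField x₀ v) (par x₀ q) (frame x₀ (par x₀ q) u)))
      (by intro u u' v; simp only [map_add])
      (by intro c u v; simp only [map_smul])
      (by
        intro u v v'
        have h : coordField x₀ (v + v') = coordField x₀ v + coordField (M := M) x₀ v' := by
          funext y; exact map_add _ _ _
        rw [h, (leviCivita g).isCovariantDerivativeOnUniv.add (diffAt_coordField x₀ v hq)
          (diffAt_coordField x₀ v' hq) trivial]
        exact map_add _ _ _)
      (by
        intro c u v
        have h : coordField x₀ (c • v) = c • coordField (M := M) x₀ v := by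
          funext y; exact map_smul _ _ _
        rw [h, (leviCivita g).isCovariantDerivativeOnUniv.smul_const c
          (diffAt_coordField x₀ v hq) trivial]
        exact map_smul _ _ _))
  else 0

lemma frame_chris {q : E} (hq : q ∈ dom E x₀) (u v : E) :
    frame x₀ (par x₀ q) (chris x₀ g q u v) =
      leviCivita g (coordField x₀ v) (par x₀ q) (frame x₀ (par x₀ q) u) := by
  have : chris x₀ g q u v = coframe x₀ (par x₀ q)
        (leviCivita g (coordField x₀ v) (par x₀ q) (frame x₀ (par x₀ q) u)) := by
    rw [chris, dif_pos hq]; rfl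
  rw [this, frame_coframe x₀ (par_mem x₀ hq)]

lemma chris_symm {q : E} (hq : q ∈ dom E x₀) (u v : E) :
    chris x₀ g q u v = chris x₀ g q v u := by
  apply frame_injective x₀ hq
  rw [frame_chris x₀ g hq, frame_chris x₀ g hq]
  have h := leviCivita_torsion g (diffAt_coordField x₀ u hq) (diffAt_coordField x₀ v hq)
  rw [bracket_coordField x₀ u v hq] at h
  exact sub_eq_zero.1 h

lemma fderiv_metRep {q : E} (hq : q ∈ dom E x₀) (u v w : E) :
    fderiv ℝ (metRep x₀ g) q u v w =
      metRep x₀ g q (chris x₀ g q u v) w + metRep x₀ g q v (chris x₀ g q u w) := by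
  have hv := diffAt_coordField (M := M) x₀ v hq
  have hw := diffAt_coordField (M := M) x₀ w hq
  have h := leviCivita_metric g (diffAt_coordField x₀ u hq) hv hw
  have e : coordField x₀ u (par x₀ q) = frame x₀ (par x₀ q) u := rfl
  rw [e, diff_frame x₀ hq (differentiable_inner g hv hw), ← frame_chris x₀ g hq,
    ← frame_chris x₀ g hq] at h
  have hd : DifferentiableAt ℝ (metRep x₀ g) q :=
    ((contDiffOn_metRep x₀ g).contDiffAt ((isOpen_dom x₀).mem_nhds hq)).differentiableAt (by simp)
  have h2 : fderiv ℝ (fun p => metRep x₀ g p v w) q u = fderiv ℝ (metRep x₀ g) q u v w := by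
    rw [fderiv_clm_apply (by fun_prop) (by fun_prop), fderiv_clm_apply (by fun_prop) (by fun_prop)]
    simp
  rw [← h2]
  exact h

lemma differentiableAt_metRep {q : E} (hq : q ∈ dom E x₀) :
    DifferentiableAt ℝ (metRep x₀ g) q :=
  ((contDiffOn_metRep x₀ g).contDiffAt ((isOpen_dom x₀).mem_nhds hq)).differentiableAt (by simp)

omit [FiniteDimensional ℝ E] in
lemma metRep_pos {q : E} (hq : q ∈ dom E x₀) {v : E} (hv : v ≠ 0) : 0 < metRep x₀ g q v v := by
  rw [metRep_apply]
  refine g.pos _ _ fun h => hv ?_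
  exact frame_injective x₀ hq (h.trans (map_zero _).symm)

omit [FiniteDimensional ℝ E] in
lemma metRep_ext {q : E} (hq : q ∈ dom E x₀) {u v : E}
    (h : ∀ w, metRep x₀ g q u w = metRep x₀ g q v w) : u = v := by
  by_contra huv
  have h1 := metRep_pos x₀ g hq (sub_ne_zero.mpr huv)
  have h2 := h (u - v)
  simp only [map_sub, sub_apply] at h1 h2
  linarith

/-- The Levi-Civita connection in a chart, in terms of the Christoffel symbols. -/
lemma leviCivita_frame {Y : VField E M} {q : E} (hq : q ∈ dom E x₀) (hY : DiffAt Y (par x₀ q))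
    (u : E) :
    leviCivita g Y (par x₀ q) (frame x₀ (par x₀ q) u) = frame x₀ (par x₀ q)
      (fderiv ℝ (vecRep x₀ Y) q u + chris x₀ g q u (vecRep x₀ Y q)) := by
  have hYd := (diffAt_iff x₀ Y hq).1 hY
  have hmem := par_mem x₀ hq
  have hGd := differentiableAt_metRep x₀ g hq
  rw [← frame_coframe x₀ hmem (leviCivita g Y (par x₀ q) (frame x₀ (par x₀ q) u))]
  congr 1
  apply metRep_ext x₀ g hq
  intro w
  have hw := diffAt_coordField (M := M) x₀ w hq
  have h := leviCivita_metric g (diffAt_coordField x₀ u hq) hY hw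
  have e : coordField x₀ u (par x₀ q) = frame x₀ (par x₀ q) u := rfl
  have ew : coordField x₀ w (par x₀ q) = frame x₀ (par x₀ q) w := rfl
  rw [e, diff_frame x₀ hq (differentiable_inner g hY hw), ← frame_chris x₀ g hq, ew,
    ← frame_vecRep x₀ Y hq, ← metRep_apply] at h
  have h2 : (fun p => g.inner (par x₀ p) (Y (par x₀ p)) (coordField x₀ w (par x₀ p)))
      =ᶠ[nhds q] fun p => metRep x₀ g p (vecRep x₀ Y p) w := by
    filter_upwards [(isOpen_dom x₀).mem_nhds hq] with p hp
    rw [metRep_apply, frame_vecRep x₀ Y hp]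
    rfl
  rw [h2.fderiv_eq] at h
  have h3 : fderiv ℝ (fun p => metRep x₀ g p (vecRep x₀ Y p) w) q u
      = fderiv ℝ (metRep x₀ g) q u (vecRep x₀ Y q) w
        + metRep x₀ g q (fderiv ℝ (vecRep x₀ Y) q u) w := by
    rw [fderiv_clm_apply (by fun_prop) (by fun_prop), fderiv_clm_apply (by fun_prop) (by fun_prop)]
    simp [add_comm]
  rw [h3, fderiv_metRep x₀ g hq] at h
  rw [metRep_apply, frame_coframe x₀ hmem]
  simp only [map_add, add_apply]
  linarith

lemma vecRep_leviCivita {Y : VField E M} {q : E} (hq : q ∈ dom E x₀) (hY : DiffAt Y (par x₀ q))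
    (u : E) :
    coframe x₀ (par x₀ q) (leviCivita g Y (par x₀ q) (frame x₀ (par x₀ q) u)) =
      fderiv ℝ (vecRep x₀ Y) q u + chris x₀ g q u (vecRep x₀ Y q) := by
  rw [leviCivita_frame x₀ g hq hY, coframe_frame x₀ (par_mem x₀ hq)]

/-- The covariant derivative of a `(1,1)`-tensor may be computed with any differentiable
extension of the vector it is applied to. -/
lemma covEnd_apply {A : EndField E M} (hA : SmoothEnd A) {V : VField E M} {x : M}
    (hV : DiffAt V x) (u : Tan E x) :
    covEnd g A x u (V x) = leviCivita g (fun y => A y (V y)) x u - A x (leviCivita g V x u) := by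
  have key : TensorialAt 𝓘(ℝ, E) E
      (fun V : VField E M => leviCivita g (fun y => A y (V y)) x u - A x (leviCivita g V x u)) x :=
    { smul := by
        intro f V hf hV
        have h1 := (leviCivita g).isCovariantDerivativeOnUniv.leibniz hV hf trivial
        have h2 := (leviCivita g).isCovariantDerivativeOnUniv.leibniz
          (diffAt_end_apply hA hV) hf trivial
        have e : (fun y => A y ((f • V) y)) = f • fun y => A y (V y) := by
          funext y; exact map_smul _ _ _
        simp only [e, h1, h2]
        simp only [add_apply, smul_apply, ContinuousLinearMap.smulRight_apply, map_add, map_smul,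
          smul_sub]
        abel
      add := by
        intro V V' hV hV'
        have h1 := (leviCivita g).isCovariantDerivativeOnUniv.add hV hV' trivial
        have h2 := (leviCivita g).isCovariantDerivativeOnUniv.add
          (diffAt_end_apply hA hV) (diffAt_end_apply hA hV') trivial
        have e : (fun y => A y ((V + V') y)) = (fun y => A y (V y)) + fun y => A y (V' y) := by
          funext y; exact map_add _ _ _
        simp only [e, h1, h2, add_apply, map_add]
        abel }
  exact key.pointwise (diffAt_extend (V x)) hV (extend_apply_self _ _)

lemma coframe_covEnd {A : EndField E M} (hA : SmoothEnd A) {q : E} (hq : q ∈ dom E x₀)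
    (u v : E) :
    coframe x₀ (par x₀ q) (covEnd g A (par x₀ q) (frame x₀ (par x₀ q) u)
      (frame x₀ (par x₀ q) v)) =
      fderiv ℝ (endRep x₀ A) q u v + chris x₀ g q u (endRep x₀ A q v)
        - endRep x₀ A q (chris x₀ g q u v) := by
  have hv := diffAt_coordField (M := M) x₀ v hq
  have h := covEnd_apply g hA hv (frame x₀ (par x₀ q) u)
  have ev : coordField x₀ v (par x₀ q) = frame x₀ (par x₀ q) v := rfl
  rw [ev] at h
  have hAd : DifferentiableAt ℝ (endRep x₀ A) q :=
    ((contDiffOn_endRep x₀ hA).contDiffAt ((isOpen_dom x₀).mem_nhds hq)).differentiableAt (by simp)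
  have e : vecRep x₀ (fun y => A y (coordField x₀ v y)) = fun p => endRep x₀ A p v := rfl
  rw [h, map_sub, vecRep_leviCivita x₀ g hq (diffAt_end_apply hA hv), ← frame_chris x₀ g hq,
    ← endRep_apply, e, fderiv_clm_apply (by fun_prop) (by fun_prop)]
  simp

end Chart

/-! ### Kähler geometry in coordinates -/

section Local

variable {E : Type*} [NormedAddCommGroup E] [NormedSpace ℝ E]

/-- The components of a Kähler structure on an open subset `U` of `E`: a metric `G`, its
Levi-Civita connection given by Christoffel symbols `Γ`, and a parallel orthogonal almost complex
structure `J`. -/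
structure IsLocalKaehler (U : Set E) (G : E → E →L[ℝ] E →L[ℝ] ℝ) (Γ : E → E →L[ℝ] E →L[ℝ] E)
    (J : E → E →L[ℝ] E) : Prop where
  isOpen : IsOpen U
  smooth_metric : ContDiffOn ℝ ∞ G U
  smooth_chris : ContDiffOn ℝ ∞ Γ U
  smooth_complex : ContDiffOn ℝ ∞ J U
  symm {q : E} (hq : q ∈ U) (u v : E) : G q u v = G q v u
  pos {q : E} (hq : q ∈ U) {v : E} (hv : v ≠ 0) : 0 < G q v v
  chris_symm {q : E} (hq : q ∈ U) (u v : E) : Γ q u v = Γ q v u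
  fderiv_metric {q : E} (hq : q ∈ U) (u v w : E) :
    fderiv ℝ G q u v w = G q (Γ q u v) w + G q v (Γ q u w)
  sq {q : E} (hq : q ∈ U) (v : E) : J q (J q v) = -v
  orthogonal {q : E} (hq : q ∈ U) (u v : E) : G q (J q u) (J q v) = G q u v
  parallel {q : E} (hq : q ∈ U) (u v : E) :
    fderiv ℝ J q u v + Γ q u (J q v) - J q (Γ q u v) = 0

/-- The covariant derivative `∇_u A` of a field of endomorphisms, for a connection with
Christoffel symbols `Γ`. -/
def covOp (Γ : E → E →L[ℝ] E →L[ℝ] E) (A : E → E →L[ℝ] E) (q u : E) : E →L[ℝ] E :=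
  fderiv ℝ A q u + (Γ q u).comp (A q) - (A q).comp (Γ q u)

/-- The covariant derivative `u ↦ ∇_u Y` of a vector field, for a connection with Christoffel
symbols `Γ`. -/
def covVec (Γ : E → E →L[ℝ] E →L[ℝ] E) (Y : E → E) (q : E) : E →L[ℝ] E :=
  fderiv ℝ Y q + (Γ q).flip (Y q)

variable {Γ : E → E →L[ℝ] E →L[ℝ] E} {A B : E → E →L[ℝ] E} {Y : E → E} {q : E}

lemma covOp_apply (u v : E) :
    covOp Γ A q u v = fderiv ℝ A q u v + Γ q u (A q v) - A q (Γ q u v) := rfl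

lemma covVec_apply (u : E) : covVec Γ Y q u = fderiv ℝ Y q u + Γ q u (Y q) := rfl

lemma covOp_congr (h : A =ᶠ[nhds q] B) (u : E) : covOp Γ A q u = covOp Γ B q u := by
  rw [covOp, covOp, h.fderiv_eq, h.self_of_nhds]

lemma covOp_comp (hA : DifferentiableAt ℝ A q) (hB : DifferentiableAt ℝ B q) (u v : E) :
    covOp Γ (fun p => (A p).comp (B p)) q u v
      = covOp Γ A q u (B q v) + A q (covOp Γ B q u v) := by
  simp only [covOp_apply]
  rw [fderiv_clm_comp hA hB]
  simp
  abel

lemma covOp_smul {f : E → ℝ} (hf : DifferentiableAt ℝ f q) (hA : DifferentiableAt ℝ A q) (u : E) :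
    covOp Γ (fun p => f p • A p) q u = f q • covOp Γ A q u + fderiv ℝ f q u • A q := by
  ext v
  rw [add_apply, smul_apply, smul_apply, covOp_apply, covOp_apply, fderiv_fun_smul hf hA]
  simp [smul_sub, smul_add]
  abel

lemma covVec_clm_apply (hA : DifferentiableAt ℝ A q) (hY : DifferentiableAt ℝ Y q) (u : E) :
    covVec Γ (fun p => A p (Y p)) q u = covOp Γ A q u (Y q) + A q (covVec Γ Y q u) := by
  simp only [covVec_apply, covOp_apply]
  rw [fderiv_clm_apply hA hY]
  simp
  abel

namespace IsLocalKaehler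

variable {U : Set E} {G : E → E →L[ℝ] E →L[ℝ] ℝ} {J : E → E →L[ℝ] E}
  (h : IsLocalKaehler U G Γ J)
include h

lemma contDiffAt_metric (hq : q ∈ U) : ContDiffAt ℝ ∞ G q :=
  h.smooth_metric.contDiffAt (h.isOpen.mem_nhds hq)

lemma contDiffAt_chris (hq : q ∈ U) : ContDiffAt ℝ ∞ Γ q :=
  h.smooth_chris.contDiffAt (h.isOpen.mem_nhds hq)

lemma contDiffAt_complex (hq : q ∈ U) : ContDiffAt ℝ ∞ J q :=
  h.smooth_complex.contDiffAt (h.isOpen.mem_nhds hq)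

lemma ext_metric (hq : q ∈ U) {u v : E} (huv : ∀ w, G q u w = G q v w) : u = v := by
  by_contra hne
  have h1 := h.pos hq (sub_ne_zero.mpr hne)
  have h2 := huv (u - v)
  simp only [map_sub, sub_apply] at h1 h2
  linarith

lemma complex_skew (hq : q ∈ U) (u v : E) : G q (J q u) v = -G q u (J q v) := by
  have h1 := h.orthogonal hq u (J q v)
  rw [h.sq hq, map_neg] at h1
  linarith

lemma covOp_complex (hq : q ∈ U) (u : E) : covOp Γ J q u = 0 := by
  ext v; exact h.parallel hq u v

lemma fderiv_metric_apply_aux {X Y : E → E} (hq : q ∈ U) (hX : DifferentiableAt ℝ X q)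
    (hY : DifferentiableAt ℝ Y q) (u : E) :
    fderiv ℝ (fun p => G p (X p) (Y p)) q u =
      fderiv ℝ G q u (X q) (Y q) + G q (fderiv ℝ X q u) (Y q) + G q (X q) (fderiv ℝ Y q u) := by
  have hG : DifferentiableAt ℝ G q := (h.contDiffAt_metric hq).differentiableAt (by simp)
  have h1 := (hG.hasFDerivAt.clm_apply hX.hasFDerivAt).clm_apply hY.hasFDerivAt
  rw [h1.fderiv]
  simp
  ring

/-- Compatibility of the connection with the metric. -/
lemma fderiv_metric_apply {X Y : E → E} (hq : q ∈ U) (hX : DifferentiableAt ℝ X q)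
    (hY : DifferentiableAt ℝ Y q) (u : E) :
    fderiv ℝ (fun p => G p (X p) (Y p)) q u =
      G q (covVec Γ X q u) (Y q) + G q (X q) (covVec Γ Y q u) := by
  rw [h.fderiv_metric_apply_aux hq hX hY, h.fderiv_metric hq]
  simp only [covVec_apply, map_add, add_apply]
  ring

/-- The covariant derivatives of adjoint fields of endomorphisms are adjoint. -/
lemma covOp_adjoint (hq : q ∈ U) (hA : DifferentiableAt ℝ A q) (hB : DifferentiableAt ℝ B q)
    (hAB : ∀ᶠ p in nhds q, ∀ v w, G p (A p v) w = G p v (B p w)) (u v w : E) :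
    G q (covOp Γ A q u v) w = G q v (covOp Γ B q u w) := by
  have e : (fun p => G p (A p v) w) =ᶠ[nhds q] fun p => G p v (B p w) := by
    filter_upwards [hAB] with p hp using hp v w
  have h1 := congrArg (fun L : E →L[ℝ] ℝ => L u) e.fderiv_eq
  have hAv : DifferentiableAt ℝ (fun p => A p v) q := hA.clm_apply (differentiableAt_const v)
  have hBw : DifferentiableAt ℝ (fun p => B p w) q := hB.clm_apply (differentiableAt_const w)
  change fderiv ℝ (fun p => G p (A p v) w) q u = fderiv ℝ (fun p => G p v (B p w)) q u at h1
  rw [h.fderiv_metric_apply hq hAv (differentiableAt_const w),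
    h.fderiv_metric_apply hq (differentiableAt_const v) hBw] at h1
  have h2 : ∀ v w, G q (A q v) w = G q v (B q w) := hAB.self_of_nhds
  rw [covVec_clm_apply hA (differentiableAt_const v),
    covVec_clm_apply hB (differentiableAt_const w)] at h1
  simp only [map_add, add_apply, h2] at h1
  linarith

end IsLocalKaehler

end Local

/-! ### Gradients and their covariant derivatives -/

section Gradient

variable {E : Type*} [NormedAddCommGroup E] [NormedSpace ℝ E]

/-- `N` represents, on `U`, the gradient of the smooth function `m` with respect to `G`. -/
structure IsLocalGrad (U : Set E) (G : E → E →L[ℝ] E →L[ℝ] ℝ) (m : E → ℝ) (N : E → E) :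
    Prop where
  smooth_fun : ContDiffOn ℝ ∞ m U
  smooth_field : ContDiffOn ℝ ∞ N U
  grad {q : E} (hq : q ∈ U) (v : E) : G q (N q) v = fderiv ℝ m q v

/-- The skew field of endomorphisms `JH + HJ` associated with the covariant derivative `H` of a
vector field `N`. When `N` is a gradient, it represents the exterior derivative of the one-form
`G(JN, ·)`. -/
def anticomm (Γ : E → E →L[ℝ] E →L[ℝ] E) (J : E → E →L[ℝ] E) (N : E → E) (q : E) : E →L[ℝ] E :=
  (J q).comp (covVec Γ N q) + (covVec Γ N q).comp (J q)

variable {Γ : E → E →L[ℝ] E →L[ℝ] E} {q : E}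
  {U : Set E} {G : E → E →L[ℝ] E →L[ℝ] ℝ} {J : E → E →L[ℝ] E} {m : E → ℝ} {N : E → E}

namespace IsLocalKaehler

variable (h : IsLocalKaehler U G Γ J) (hN : IsLocalGrad U G m N)
include h

lemma contDiffAt_covVec {Y : E → E} (hY : ContDiffOn ℝ ∞ Y U) (hq : q ∈ U) :
    ContDiffAt ℝ ∞ (covVec Γ Y) q := by
  have h1 : ContDiffAt ℝ ∞ Y q := hY.contDiffAt (h.isOpen.mem_nhds hq)
  have h2 := h.contDiffAt_chris hq
  have h3 : ContDiffAt ℝ ∞ (fderiv ℝ Y) q := h1.fderiv_right (by simp)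
  have h4 : ContDiffAt ℝ ∞ (fun p => (Γ p).flip) q :=
    (ContinuousLinearMap.flipₗᵢ ℝ E E E).contDiff.contDiffAt.comp q h2
  exact h3.add (h4.clm_apply h1)

lemma contDiffAt_anticomm {Y : E → E} (hY : ContDiffOn ℝ ∞ Y U) (hq : q ∈ U) :
    ContDiffAt ℝ ∞ (anticomm Γ J Y) q :=
  ((h.contDiffAt_complex hq).clm_comp (h.contDiffAt_covVec hY hq)).add
    ((h.contDiffAt_covVec hY hq).clm_comp (h.contDiffAt_complex hq))

include hN

lemma contDiffAt_grad (hq : q ∈ U) : ContDiffAt ℝ ∞ N q :=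
  hN.smooth_field.contDiffAt (h.isOpen.mem_nhds hq)

lemma contDiffAt_potential (hq : q ∈ U) : ContDiffAt ℝ ∞ m q :=
  hN.smooth_fun.contDiffAt (h.isOpen.mem_nhds hq)

/-- The Hessian of a function is symmetric. -/
lemma hess_symm (hq : q ∈ U) (v w : E) :
    G q (covVec Γ N q v) w = G q v (covVec Γ N q w) := by
  have hm := h.contDiffAt_potential hN hq
  have hm2 : DifferentiableAt ℝ (fderiv ℝ m) q :=
    (hm.fderiv_right (m := ∞) (by simp)).differentiableAt (by simp)
  have hs : IsSymmSndFDerivAt ℝ m q := hm.isSymmSndFDerivAt (by simpa using two_le_infty)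
  have hNd : DifferentiableAt ℝ N q := (h.contDiffAt_grad hN hq).differentiableAt (by simp)
  have key : ∀ v w, G q (covVec Γ N q v) w + G q (N q) (Γ q v w)
      = fderiv ℝ (fderiv ℝ m) q v w := by
    intro v w
    have e : (fun p => G p (N p) w) =ᶠ[nhds q] fun p => fderiv ℝ m p w := by
      filter_upwards [h.isOpen.mem_nhds hq] with p hp using hN.grad hp w
    have h1 := congrArg (fun L : E →L[ℝ] ℝ => L v) e.fderiv_eq
    change fderiv ℝ (fun p => G p (N p) w) q v = fderiv ℝ (fun p => fderiv ℝ m p w) q v at h1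
    rw [h.fderiv_metric_apply hq hNd (differentiableAt_const w),
      fderiv_clm_apply hm2 (differentiableAt_const w)] at h1
    simpa [covVec_apply] using h1
  have h1 := key v w
  have h2 := key w v
  rw [hs.eq v w, h.chris_symm hq] at h1
  rw [h.symm hq v]
  linarith

lemma contDiffAt_kappa (hq : q ∈ U) : ContDiffAt ℝ ∞ (fun p => G p (J p (N p))) q :=
  (h.contDiffAt_metric hq).clm_apply ((h.contDiffAt_complex hq).clm_apply (h.contDiffAt_grad hN hq))

/-- The derivative of the one-form `κ = G(JN, ·)`. -/
lemma fderiv_kappa (hq : q ∈ U) (v w : E) :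
    fderiv ℝ (fun p => G p (J p (N p))) q v w =
      G q (J q (covVec Γ N q v)) w + G q (J q (N q)) (Γ q v w) := by
  have hκ : DifferentiableAt ℝ (fun p => G p (J p (N p))) q :=
    (h.contDiffAt_kappa hN hq).differentiableAt (by simp)
  have hJ : DifferentiableAt ℝ J q := (h.contDiffAt_complex hq).differentiableAt (by simp)
  have hNd : DifferentiableAt ℝ N q := (h.contDiffAt_grad hN hq).differentiableAt (by simp)
  have h1 : fderiv ℝ (fun p => G p (J p (N p)) w) q v =
      fderiv ℝ (fun p => G p (J p (N p))) q v w := by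
    rw [fderiv_clm_apply hκ (differentiableAt_const w)]
    simp
  rw [← h1, h.fderiv_metric_apply (X := fun p => J p (N p)) hq (hJ.clm_apply hNd)
    (differentiableAt_const w), covVec_clm_apply hJ hNd, h.covOp_complex hq]
  simp [covVec_apply]

lemma metric_anticomm (hq : q ∈ U) (v w : E) :
    G q (anticomm Γ J N q v) w = fderiv ℝ (fun p => G p (J p (N p))) q v w
      - fderiv ℝ (fun p => G p (J p (N p))) q w v := by
  rw [h.fderiv_kappa hN hq, h.fderiv_kappa hN hq, h.chris_symm hq v w,
    h.complex_skew hq (covVec Γ N q w) v, h.hess_symm hN hq w, h.symm hq w]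
  simp [anticomm]

lemma anticomm_skew (hq : q ∈ U) (v w : E) :
    G q (anticomm Γ J N q v) w = -G q v (anticomm Γ J N q w) := by
  rw [h.symm hq v, h.metric_anticomm hN hq, h.metric_anticomm hN hq]
  ring

/-- The two-form `G((JH + HJ) ·, ·)` is closed, being the exterior derivative of `G(JN, ·)`. -/
lemma cyclic_covOp_anticomm (hq : q ∈ U) (u v w : E) :
    G q (covOp Γ (anticomm Γ J N) q u v) w + G q (covOp Γ (anticomm Γ J N) q v w) u
      + G q (covOp Γ (anticomm Γ J N) q w u) v = 0 := by
  set κ : E → E →L[ℝ] ℝ := fun p => G p (J p (N p)) with hκdef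
  have hκ := h.contDiffAt_kappa hN hq
  have hκ2 : DifferentiableAt ℝ (fderiv ℝ κ) q :=
    (hκ.fderiv_right (m := ∞) (by simp)).differentiableAt (by simp)
  have hs : IsSymmSndFDerivAt ℝ κ q := hκ.isSymmSndFDerivAt (by simpa using two_le_infty)
  have hF : DifferentiableAt ℝ (anticomm Γ J N) q :=
    (h.contDiffAt_anticomm hN.smooth_field hq).differentiableAt (by simp)
  have key : ∀ u v w, G q (covOp Γ (anticomm Γ J N) q u v) w
      + G q (anticomm Γ J N q (Γ q u v)) w + G q (anticomm Γ J N q v) (Γ q u w)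
      = fderiv ℝ (fderiv ℝ κ) q u v w - fderiv ℝ (fderiv ℝ κ) q u w v := by
    intro u v w
    have e : (fun p => G p (anticomm Γ J N p v) w) =ᶠ[nhds q]
        fun p => fderiv ℝ κ p v w - fderiv ℝ κ p w v := by
      filter_upwards [h.isOpen.mem_nhds hq] with p hp using h.metric_anticomm hN hp v w
    have h1 := congrArg (fun L : E →L[ℝ] ℝ => L u) e.fderiv_eq
    change fderiv ℝ (fun p => G p (anticomm Γ J N p v) w) q u = _ at h1
    have h2 : ∀ v w, HasFDerivAt (fun p => fderiv ℝ κ p v w)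
        (((fderiv ℝ (fderiv ℝ κ) q).flip v).flip w) q := by
      intro v w
      have := (hκ2.hasFDerivAt.clm_apply (hasFDerivAt_const v q)).clm_apply (hasFDerivAt_const w q)
      refine this.congr_fderiv ?_
      ext x
      simp
    rw [h.fderiv_metric_apply hq (hF.clm_apply (differentiableAt_const v))
      (differentiableAt_const w), covVec_clm_apply hF (differentiableAt_const v),
      ((h2 v w).fun_sub (h2 w v)).fderiv] at h1
    simpa [covVec_apply, add_assoc] using h1
  have k1 := key u v w
  have k2 := key v w u
  have k3 := key w u v
  have s1 : fderiv ℝ (fderiv ℝ κ) q u v = fderiv ℝ (fderiv ℝ κ) q v u := hs.eq u v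
  have s2 : fderiv ℝ (fderiv ℝ κ) q u w = fderiv ℝ (fderiv ℝ κ) q w u := hs.eq u w
  have s3 : fderiv ℝ (fderiv ℝ κ) q w v = fderiv ℝ (fderiv ℝ κ) q v w := hs.eq w v
  rw [s1, s2] at k1
  rw [s3] at k3
  have sk := fun a b => h.anticomm_skew hN hq a b
  have e1 := sk u (Γ q v w)
  have e2 := sk v (Γ q w u)
  have e3 := sk w (Γ q u v)
  have c1 := h.chris_symm hq u v
  have c2 := h.chris_symm hq v w
  have c3 := h.chris_symm hq w u
  have y1 := h.symm hq u (anticomm Γ J N q (Γ q v w))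
  have y2 := h.symm hq v (anticomm Γ J N q (Γ q w u))
  have y3 := h.symm hq w (anticomm Γ J N q (Γ q u v))
  rw [← c3] at k1
  rw [← c1] at k2
  rw [← c2] at k3
  linarith

end IsLocalKaehler

end Gradient

/-! ### The Killing equation at a point -/

section Pointwise

variable {E : Type*} [NormedAddCommGroup E] [NormedSpace ℝ E]

/-- The value `S` at a point, and the covariant derivative `A u = ∇_u S` there, of a `J`-invariant
Killing tensor whose square is `m S`, where `N` is the gradient of the function `m ≠ 0`. -/
structure IsKillingJet (B : E →L[ℝ] E →L[ℝ] ℝ) (J S : E →L[ℝ] E) (A : E → E →L[ℝ] E) (N : E)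
    (m : ℝ) : Prop where
  symm (u v : E) : B u v = B v u
  pos {v : E} (hv : v ≠ 0) : 0 < B v v
  complex_sq (v : E) : J (J v) = -v
  complex_skew (u v : E) : B (J u) v = -B u (J v)
  ne_zero : m ≠ 0
  S_symm (u v : E) : B (S u) v = B u (S v)
  S_comm (v : E) : S (J v) = J (S v)
  S_sq (v : E) : S (S v) = m • S v
  ker_span {a : E} (ha : a ≠ 0) (hSa : S a = 0) {v : E} (hv : S v = 0) :
    ∃ s t : ℝ, v = s • a + t • J a
  A_symm (u v w : E) : B (A u v) w = B v (A u w)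
  A_comm (u v : E) : A u (J v) = J (A u v)
  A_sq (u v : E) : A u (S v) + S (A u v) = B N u • S v + m • A u v
  cyclic (u v w : E) : B (A u v) w + B (A w u) v + B (A v w) u = 0

namespace IsKillingJet

variable {B : E →L[ℝ] E →L[ℝ] ℝ} {J S H : E →L[ℝ] E} {A : E → E →L[ℝ] E} {N : E} {m : ℝ}
  (h : IsKillingJet B J S A N m)
include h

lemma eq_zero_of_self {v : E} (hv : B v v = 0) : v = 0 := by
  by_contra hne
  exact (h.pos hne).ne' hv

/-- The differential of `m` vanishes on the range of `S`: for `w` in the range, the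
Killing equation on `(w, w, w)` says `B (A w w) w = 0`, and `A_sq` expresses this through `B N w`. -/
lemma S_grad : S N = 0 := by
  have key : ∀ v, B N (S v) = 0 := by
    intro v
    by_cases hw : S v = 0
    · rw [hw, map_zero]
    have h1 := congrArg (fun x => B x (S v)) (h.A_sq (S v) (S v))
    rw [map_add, add_apply, h.S_symm (A (S v) (S v))] at h1
    simp only [h.S_sq, map_add, map_smul, add_apply, smul_apply, smul_eq_mul] at h1
    have h2 := h.cyclic (S v) (S v) (S v)
    have h3 : B (A (S v) (S v)) (S v) = 0 := by linarith
    rw [h3] at h1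
    have h4 : B N (S v) * (m * B (S v) (S v)) = 0 := by linarith
    rcases mul_eq_zero.1 h4 with h5 | h5
    · exact h5
    · exact absurd h5 (mul_ne_zero h.ne_zero (h.pos hw).ne')
  apply h.eq_zero_of_self
  rw [h.S_symm]
  exact key _

lemma S_complex_grad : S (J N) = 0 := by rw [h.S_comm, h.S_grad, map_zero]

lemma complex_self (v : E) : B v (J v) = 0 := by
  have h1 := h.complex_skew v v
  rw [h.symm] at h1
  linarith

lemma complex_isometry (u v : E) : B (J u) (J v) = B u v := by
  rw [h.complex_skew, h.complex_sq, map_neg, neg_neg]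

lemma S_A_of_ker (x : E) {u : E} (hu : S u = 0) : S (A x u) = m • A x u := by
  have := h.A_sq x u
  rwa [hu, map_zero, smul_zero, zero_add, zero_add] at this

/-- Derivatives of `S` map the kernel of `S` to its range. -/
lemma A_ker_ker (x : E) {u v : E} (hu : S u = 0) (hv : S v = 0) : B (A x u) v = 0 := by
  have h1 := h.S_symm (A x u) v
  rw [h.S_A_of_ker x hu, hv, map_zero, map_smul, smul_apply, smul_eq_mul] at h1
  exact (mul_eq_zero.1 h1).resolve_left h.ne_zero

lemma A_self_of_ker {u : E} (hu : S u = 0) : A u u = 0 := by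
  apply h.eq_zero_of_self
  have h1 := h.cyclic u u (A u u)
  have h2 := h.A_ker_ker (A u u) hu hu
  rw [h.A_symm u u, h.symm u (A u (A u u)), h2, add_zero] at h1
  rw [h.A_symm u u, h.symm u]
  linarith

lemma A_grad_grad : A N N = 0 := h.A_self_of_ker h.S_grad

lemma A_grad_complex : A N (J N) = 0 := by rw [h.A_comm, h.A_grad_grad, map_zero]

lemma A_complex_complex : A (J N) (J N) = 0 := h.A_self_of_ker h.S_complex_grad

lemma A_complex_grad : A (J N) N = 0 := by
  have h1 := congrArg J h.A_complex_complex
  rw [h.A_comm, h.complex_sq, map_zero] at h1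
  exact neg_eq_zero.1 h1

lemma ext_ker (hN : N ≠ 0) {z : E} (hz : S z = 0) (h1 : B z N = 0) (h2 : B z (J N) = 0) :
    z = 0 := by
  obtain ⟨s, t, hst⟩ := h.ker_span hN h.S_grad hz
  apply h.eq_zero_of_self
  conv_lhs => rw [hst]
  rw [h.symm, hst.symm, hst]
  rw [hst] at h1 h2
  simp only [map_add, map_smul, smul_eq_mul] at h1 h2 ⊢
  rw [h1, h2]
  ring

lemma ext_grad (hN : N ≠ 0) {z : E} (h0 : ∀ w, B z (S w) = 0) (h1 : B z N = 0)
    (h2 : B z (J N) = 0) : z = 0 := by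
  refine h.ext_ker hN (h.eq_zero_of_self ?_) h1 h2
  rw [h.S_symm, h.S_sq, map_smul, h0, smul_zero]

lemma range_grad {v : E} (hv : S v = m • v) : B v N = 0 := by
  have h1 := h.S_symm v N
  rw [hv, h.S_grad, map_zero, map_smul, smul_apply, smul_eq_mul] at h1
  exact (mul_eq_zero.1 h1).resolve_left h.ne_zero

lemma range_complex_grad {v : E} (hv : S v = m • v) : B v (J N) = 0 := by
  have h1 := h.S_symm v (J N)
  rw [hv, h.S_complex_grad, map_zero, map_smul, smul_apply, smul_eq_mul] at h1
  exact (mul_eq_zero.1 h1).resolve_left h.ne_zero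

lemma range_complex {v : E} (hv : S v = m • v) : S (J v) = m • J v := by
  rw [h.S_comm, hv, map_smul]

lemma S_A_of_range (x : E) {v : E} (hv : S v = m • v) : S (A x v) = (B N x * m) • v := by
  have := h.A_sq x v
  rw [hv, map_smul, add_comm] at this
  rw [mul_smul]
  exact add_right_cancel this

lemma A_grad_of_range (hN : N ≠ 0) {v : E} (hv : S v = m • v) : A N v = B N N • v := by
  apply sub_eq_zero.1
  apply h.ext_ker hN
  · rw [map_sub, h.S_A_of_range N hv, map_smul, hv, mul_smul, sub_self]
  · rw [map_sub, sub_apply, h.A_symm, h.A_grad_grad, map_zero, map_smul, smul_apply,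
      h.range_grad hv, smul_zero, sub_zero]
  · rw [map_sub, sub_apply, h.A_symm, h.A_grad_complex, map_zero, map_smul, smul_apply,
      h.range_complex_grad hv, smul_zero, sub_zero]

lemma A_complex_grad_of_range (hN : N ≠ 0) {v : E} (hv : S v = m • v) : A (J N) v = 0 := by
  apply h.ext_ker hN
  · rw [h.S_A_of_range _ hv, h.complex_self, zero_mul, zero_smul]
  · rw [h.A_symm, h.A_complex_grad, map_zero]
  · rw [h.A_symm, h.A_complex_complex, map_zero]

/-- Vectors orthogonal to `N` and `JN` are eigenvectors of `S`. -/
lemma range_of_orthogonal (hN : N ≠ 0) {v : E} (h1 : B v N = 0) (h2 : B v (J N) = 0) :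
    S v = m • v := by
  apply sub_eq_zero.1
  apply h.ext_ker hN
  · rw [map_sub, map_smul, h.S_sq, sub_self]
  · rw [map_sub, sub_apply, h.S_symm, h.S_grad, map_zero, map_smul, smul_apply, h1, smul_zero,
      sub_zero]
  · rw [map_sub, sub_apply, h.S_symm, h.S_complex_grad, map_zero, map_smul, smul_apply, h2,
      smul_zero, sub_zero]

section Hessian

variable (hAN : ∀ u, A u N + S (H u) = 0)
include hAN

lemma S_hess_grad : S (H N) = 0 := by
  have := hAN N
  rwa [h.A_grad_grad, zero_add] at this

lemma S_hess_complex_grad : S (H (J N)) = 0 := by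
  have := hAN (J N)
  rwa [h.A_complex_grad, zero_add] at this

variable (hN : N ≠ 0) (hH : ∀ u v, B (H u) v = B u (H v))
include hN hH

/-- On the eigenspace of `S` for `m`, the Hessian of `m` is multiplication by `|N|² / 2m`. -/
lemma hess_of_range {v : E} (hv : S v = m • v) : (2 * m) • H v = B N N • v := by
  have aux : ∀ v w, S v = m • v → S w = m • w → B (A v w) N = -(m * B (H v) w) := by
    intro v w hv hw
    have h1 := congrArg (fun x => B x w) (hAN v)
    simp only [map_add, add_apply, map_zero, zero_apply, h.A_symm v N, h.S_symm, hw, map_smul,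
      smul_eq_mul] at h1
    rw [h.symm (A v w)]
    linarith
  apply sub_eq_zero.1
  apply h.ext_grad hN
  · intro w
    have hw := h.S_sq w
    set w' := S w
    have c := h.cyclic N v w'
    have e1 := aux v w' hv hw
    have e2 := aux w' v hw hv
    rw [h.A_grad_of_range hN hv, h.A_symm w' N, h.symm N (A w' v), e1, e2, hH w' v, h.symm w'] at c
    simp only [map_sub, sub_apply, map_smul, smul_apply, smul_eq_mul] at c ⊢
    linarith
  · have e1 := h.S_symm v (H N)
    rw [hv, h.S_hess_grad hAN, map_zero, map_smul, smul_apply, smul_eq_mul] at e1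
    have e2 := (mul_eq_zero.1 e1).resolve_left h.ne_zero
    simp only [map_sub, sub_apply, map_smul, smul_apply, smul_eq_mul, hH, e2, h.range_grad hv]
    ring
  · have e1 := h.S_symm v (H (J N))
    rw [hv, h.S_hess_complex_grad hAN, map_zero, map_smul, smul_apply, smul_eq_mul] at e1
    have e2 := (mul_eq_zero.1 e1).resolve_left h.ne_zero
    simp only [map_sub, sub_apply, map_smul, smul_apply, smul_eq_mul, hH, e2,
      h.range_complex_grad hv]
    ring

/-- For `v` in the range of `S`, the component of `A v v` along `N` is read off from the Hessian,
and that along `J N` vanishes since `A v` commutes with `J`. -/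
lemma A_self_of_range {v : E} (hv : S v = m • v) : A v v = (-(B v v / 2)) • N := by
  have aux : ∀ w, S w = m • w → B (A v w) N = -(m * B (H v) w) := by
    intro w hw
    have h1 := congrArg (fun x => B x w) (hAN v)
    simp only [map_add, add_apply, map_zero, zero_apply, h.A_symm v N, h.S_symm, hw, map_smul,
      smul_eq_mul] at h1
    rw [h.symm (A v w)]
    linarith
  have hHv := h.hess_of_range hAN hN hH hv
  have hB : ∀ w, 2 * (m * B (H v) w) = B N N * B v w := by
    intro w
    have := congrArg (fun x => B x w) hHv
    simp only [map_smul, smul_apply, smul_eq_mul] at this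
    linarith
  apply sub_eq_zero.1
  apply h.ext_ker hN
  · rw [map_sub, h.S_A_of_range _ hv, h.symm, h.range_grad hv, zero_mul, zero_smul, map_smul,
      h.S_grad, smul_zero, sub_zero]
  · rw [map_sub, sub_apply, aux v hv, map_smul, smul_apply, smul_eq_mul]
    have := hB v
    linarith
  · rw [map_sub, sub_apply, map_smul, smul_apply, smul_eq_mul, h.complex_self, mul_zero, sub_zero]
    have e1 := h.complex_skew (A v v) N
    rw [← h.A_comm, aux _ (h.range_complex hv)] at e1
    have e2 := hB (J v)
    rw [h.complex_self] at e2
    linarith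

/-- If the two-form `F = JH + HJ` is closed, then the Hessian of `m` commutes with `J`. Here `W u`
stands for `∇_u F`, the assumption `hcyc` for closedness, and the assumption `hFS` is the derivative of the identity `m F S = |N|² J S`. -/
lemma hess_comm {F : E →L[ℝ] E} {W : E → E →L[ℝ] E} (hF : ∀ v, F v = J (H v) + H (J v))
    (hFS : ∀ u v, B N u • F (S v) + m • W u (S v) + m • F (A u v) =
      (2 * B (H u) N) • J (S v) + B N N • J (A u v))
    (hW : ∀ u v w, B (W u v) w = -B v (W u w))
    (hcyc : ∀ u v w, B (W u v) w + B (W v w) u + B (W w u) v = 0)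
    (hS : ∃ v, S v ≠ 0) (v : E) : H (J v) = J (H v) := by
  obtain ⟨v₀, hv₀⟩ := hS
  have hz := h.S_sq v₀
  set z := S v₀
  have hzz := h.pos hv₀
  have hJz := h.range_complex hz
  have hFz : m • F z = B N N • J z := by
    have e1 := h.hess_of_range hAN hN hH hz
    have e2 := h.hess_of_range hAN hN hH hJz
    have e3 := congrArg J e1
    simp only [map_smul] at e3
    have e4 : (2 : ℝ) • (m • F z) = (2 : ℝ) • (B N N • J z) := by
      rw [hF, smul_smul, smul_add, e3, e2, two_smul]
    exact smul_right_injective E two_ne_zero e4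
  have hz0 : B N z = 0 := by rw [h.symm]; exact h.range_grad hz
  have hJz0 : B N (J z) = 0 := by rw [h.symm]; exact h.range_grad hJz
  have hHz : ∀ x, S x = m • x → B (H x) N = 0 := by
    intro x hx
    have e1 := congrArg (fun y => B y N) (h.hess_of_range hAN hN hH hx)
    simp only [map_smul, smul_apply, smul_eq_mul, h.range_grad hx, mul_zero] at e1
    exact (mul_eq_zero.1 e1).resolve_left (mul_ne_zero two_ne_zero h.ne_zero)
  have hAzz := h.A_self_of_range hAN hN hH hz
  have hAJJ := h.A_self_of_range hAN hN hH hJz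
  have hAzJ : A z (J z) = (-(B z z / 2)) • J N := by rw [h.A_comm, hAzz, map_smul]
  have hAJz : A (J z) z = (B z z / 2) • J N := by
    have e1 := congrArg J hAJJ
    rw [h.A_comm, h.complex_sq, h.complex_isometry, map_smul] at e1
    rw [← neg_neg (A (J z) z), e1, neg_smul, neg_neg]
  have hJJ : J (J N) = -N := h.complex_sq N
  -- the components of the closedness relation on `(u, z, J z)` for `u` in the kernel of `S`
  have key : ∀ u, A u z = B N u • z → 2 * B (H u) N + B (F (J N)) u = 0 := by
    intro u hAu
    have t1 := congrArg (fun x => B x (J z)) (hFS u z)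
    have t2 := congrArg (fun x => B x u) (hFS z (J z))
    have t3 := congrArg (fun x => B x u) (hFS (J z) z)
    have hFz' : m * B (F z) (J z) = B N N * B (J z) (J z) := by
      have := congrArg (fun x => B x (J z)) hFz
      simpa only [map_smul, smul_apply, smul_eq_mul] using this
    have c := hcyc u z (J z)
    rw [hW (J z) u z, h.symm u] at c
    simp only [hz, hJz, hAu, hAzJ, hAJz, hz0, hJz0, hHz _ hz, hHz _ hJz, hJJ, map_add, map_smul,
      map_neg, smul_neg, add_apply, smul_apply, neg_apply, smul_eq_mul, h.complex_isometry,
      zero_smul, mul_zero, zero_add] at t1 t2 t3 hFz'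
    set X := B (W u z) (J z)
    set Y := B (W z (J z)) u
    set Z := B (W (J z) z) u
    have hm := h.ne_zero
    have hFz2 : m * (B N u * (B (F z) (J z))) = B N u * (B N N * B z z) := by
      rw [← hFz']; ring
    have hXYZ : m * (m * X) + m * (m * Y) - m * (m * Z) = 0 := by
      have : X + Y - Z = 0 := by linarith
      calc _ = m * m * (X + Y - Z) := by ring
        _ = 0 := by rw [this, mul_zero]
    have e : m * B z z * (2 * B (H u) N + B (F (J N)) u) = 0 := by
      have t1' : m * (m * X) = 2 * m * B (H u) N * B z z - B N u * (B N N * B z z) := by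
        linarith
      linarith
    exact (mul_eq_zero.1 e).resolve_left (mul_ne_zero hm hzz.ne')
  have kN := key N (h.A_grad_of_range hN hz)
  have kJ := key (J N) (by rw [h.A_complex_grad_of_range hN hz, h.complex_self, zero_smul])
  have hy : H N + J (H (J N)) = 0 := by
    apply h.ext_ker hN
    · rw [map_add, h.S_comm, h.S_hess_grad hAN, h.S_hess_complex_grad hAN, map_zero,
        add_zero]
    · rw [hF, hJJ, hH] at kN
      rw [h.symm N] at kN
      simp only [map_add, map_neg, add_apply, neg_apply] at kN ⊢
      linarith
    · rw [hF, hJJ, hH] at kJ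
      rw [h.symm (J N)] at kJ
      simp only [map_add, map_neg, add_apply, neg_apply] at kJ ⊢
      linarith
  have hJN : H (J N) = J (H N) := by
    have e1 := congrArg J hy
    rw [map_add, h.complex_sq, map_zero, ← sub_eq_add_neg] at e1
    exact (sub_eq_zero.1 e1).symm
  have swap : ∀ w, H (J w) = J (H w) → B (H (J v) - J (H v)) w = 0 := by
    intro w hw
    rw [map_sub, sub_apply, hH, h.complex_skew, h.complex_skew, hH, hw]
    ring
  apply sub_eq_zero.1
  apply h.ext_grad hN
  · intro w
    apply swap
    have hw := h.S_sq w
    have e1 := h.hess_of_range hAN hN hH hw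
    have e2 := congrArg J e1
    rw [map_smul, map_smul, ← h.hess_of_range hAN hN hH (h.range_complex hw)] at e2
    exact (smul_right_injective E (mul_ne_zero two_ne_zero h.ne_zero) e2).symm
  · exact swap _ hJN
  · apply swap
    rw [hJN, hJJ, h.complex_sq, map_neg]

end Hessian

end IsKillingJet

end Pointwise

/-! ### The Hessian of the eigenvalue function -/

section LocalKilling

variable {E : Type*} [NormedAddCommGroup E] [NormedSpace ℝ E]

/-- The components, on an open set `U`, of a Kähler structure with a `J`-invariant Killing tensor
`S` that is `m` times a projection with two-dimensional kernel; `N` is the gradient of `m`. -/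
structure IsLocalKilling (U : Set E) (G : E → E →L[ℝ] E →L[ℝ] ℝ) (Γ : E → E →L[ℝ] E →L[ℝ] E)
    (J S : E → E →L[ℝ] E) (m : E → ℝ) (N : E → E) : Prop where
  kaehler : IsLocalKaehler U G Γ J
  isGrad : IsLocalGrad U G m N
  smooth_S : ContDiffOn ℝ ∞ S U
  S_symm {q : E} (hq : q ∈ U) (u v : E) : G q (S q u) v = G q u (S q v)
  S_comm {q : E} (hq : q ∈ U) (v : E) : S q (J q v) = J q (S q v)
  S_sq {q : E} (hq : q ∈ U) (v : E) : S q (S q v) = m q • S q v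
  S_ne_zero {q : E} (hq : q ∈ U) (hm : m q ≠ 0) : ∃ v, S q v ≠ 0
  ker_span {q : E} (hq : q ∈ U) (hm : m q ≠ 0) {a : E} (ha : a ≠ 0) (hSa : S q a = 0) {v : E}
    (hv : S q v = 0) : ∃ s t : ℝ, v = s • a + t • J q a
  cyclic {q : E} (hq : q ∈ U) (u v w : E) :
    G q (covOp Γ S q u v) w + G q (covOp Γ S q w u) v + G q (covOp Γ S q v w) u = 0

namespace IsLocalKilling

variable {Γ : E → E →L[ℝ] E →L[ℝ] E} {q : E} {U : Set E} {G : E → E →L[ℝ] E →L[ℝ] ℝ}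
  {J S : E → E →L[ℝ] E} {m : E → ℝ} {N : E → E} (h : IsLocalKilling U G Γ J S m N)
include h

lemma eventually_mem (hq : q ∈ U) : ∀ᶠ p in nhds q, p ∈ U := h.kaehler.isOpen.mem_nhds hq

lemma differentiableAt_S (hq : q ∈ U) : DifferentiableAt ℝ S q :=
  (h.smooth_S.contDiffAt (h.kaehler.isOpen.mem_nhds hq)).differentiableAt (by simp)

lemma differentiableAt_complex (hq : q ∈ U) : DifferentiableAt ℝ J q :=
  (h.kaehler.contDiffAt_complex hq).differentiableAt (by simp)

lemma differentiableAt_grad (hq : q ∈ U) : DifferentiableAt ℝ N q :=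
  (h.kaehler.contDiffAt_grad h.isGrad hq).differentiableAt (by simp)

lemma differentiableAt_potential (hq : q ∈ U) : DifferentiableAt ℝ m q :=
  (h.kaehler.contDiffAt_potential h.isGrad hq).differentiableAt (by simp)

lemma isKillingJet (hq : q ∈ U) (hm : m q ≠ 0) :
    IsKillingJet (G q) (J q) (S q) (covOp Γ S q) (N q) (m q) where
  symm := h.kaehler.symm hq
  pos := h.kaehler.pos hq
  complex_sq := h.kaehler.sq hq
  complex_skew := h.kaehler.complex_skew hq
  ne_zero := hm
  S_symm := h.S_symm hq
  S_comm := h.S_comm hq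
  S_sq := h.S_sq hq
  ker_span := h.ker_span hq hm
  A_symm := h.kaehler.covOp_adjoint hq (h.differentiableAt_S hq) (h.differentiableAt_S hq)
    (by filter_upwards [h.eventually_mem hq] with p hp using h.S_symm hp)
  A_comm u v := by
    have hS := h.differentiableAt_S hq
    have hJ := h.differentiableAt_complex hq
    have e : (fun p => (S p).comp (J p)) =ᶠ[nhds q] fun p => (J p).comp (S p) := by
      filter_upwards [h.eventually_mem hq] with p hp
      ext v
      exact h.S_comm hp v
    have h1 := congrArg (fun L : E →L[ℝ] E => L v) (covOp_congr (Γ := Γ) e u)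
    simpa [covOp_comp hS hJ, covOp_comp hJ hS, h.kaehler.covOp_complex hq] using h1
  A_sq u v := by
    have hS := h.differentiableAt_S hq
    have hmd := h.differentiableAt_potential hq
    have e : (fun p => (S p).comp (S p)) =ᶠ[nhds q] fun p => m p • S p := by
      filter_upwards [h.eventually_mem hq] with p hp
      ext v
      exact h.S_sq hp v
    have h1 := congrArg (fun L : E →L[ℝ] E => L v) (covOp_congr (Γ := Γ) e u)
    rw [covOp_comp hS hS, covOp_smul hmd hS, ← h.isGrad.grad hq] at h1
    rw [h1, add_comm]
    rfl
  cyclic := h.cyclic hq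

lemma eventually_ne_zero (hq : q ∈ U) (hm : m q ≠ 0) : ∀ᶠ p in nhds q, p ∈ U ∧ m p ≠ 0 :=
  (h.eventually_mem hq).and
    ((h.differentiableAt_potential hq).continuousAt.eventually_ne hm)

lemma eventually_regular (hq : q ∈ U) (hm : m q ≠ 0) (hN : N q ≠ 0) :
    ∀ᶠ p in nhds q, p ∈ U ∧ m p ≠ 0 ∧ N p ≠ 0 := by
  filter_upwards [h.eventually_ne_zero hq hm,
    (h.differentiableAt_grad hq).continuousAt.eventually_ne hN] with p hp hp2
  exact ⟨hp.1, hp.2, hp2⟩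

/-- The derivative of the identity `S N = 0`. -/
lemma covOp_grad (hq : q ∈ U) (hm : m q ≠ 0) (u : E) :
    covOp Γ S q u (N q) + S q (covVec Γ N q u) = 0 := by
  have e : (fun p => S p (N p)) =ᶠ[nhds q] fun _ => 0 := by
    filter_upwards [h.eventually_ne_zero hq hm] with p hp using (h.isKillingJet hp.1 hp.2).S_grad
  rw [← covVec_clm_apply (h.differentiableAt_S hq) (h.differentiableAt_grad hq), covVec_apply,
    e.fderiv_eq, (h.isKillingJet hq hm).S_grad]
  simp

lemma hess_of_range (hq : q ∈ U) (hm : m q ≠ 0) (hN : N q ≠ 0) (v : E) :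
    (2 * m q) • covVec Γ N q (S q v) = G q (N q) (N q) • S q v :=
  (h.isKillingJet hq hm).hess_of_range (h.covOp_grad hq hm) hN
    (h.kaehler.hess_symm h.isGrad hq) (h.S_sq hq v)

lemma fderiv_norm_grad (hq : q ∈ U) (u : E) :
    fderiv ℝ (fun p => G p (N p) (N p)) q u = 2 * G q (covVec Γ N q u) (N q) := by
  have hN := h.differentiableAt_grad hq
  rw [h.kaehler.fderiv_metric_apply hq hN hN, h.kaehler.symm hq (N q)]
  ring

lemma contDiffAt_norm_grad (hq : q ∈ U) : ContDiffAt ℝ ∞ (fun p => G p (N p) (N p)) q :=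
  ((h.kaehler.contDiffAt_metric hq).clm_apply (h.kaehler.contDiffAt_grad h.isGrad hq)).clm_apply
    (h.kaehler.contDiffAt_grad h.isGrad hq)

lemma anticomm_of_range (hq : q ∈ U) (hm : m q ≠ 0) (hN : N q ≠ 0) (v : E) :
    m q • anticomm Γ J N q (S q v) = G q (N q) (N q) • J q (S q v) := by
  have e1 := congrArg (J q) (h.hess_of_range hq hm hN v)
  have e2 := h.hess_of_range hq hm hN (J q v)
  rw [h.S_comm hq] at e2
  simp only [map_smul] at e1
  have e4 : (2 : ℝ) • (m q • anticomm Γ J N q (S q v))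
      = (2 : ℝ) • (G q (N q) (N q) • J q (S q v)) := by
    have : anticomm Γ J N q (S q v) = J q (covVec Γ N q (S q v)) + covVec Γ N q (J q (S q v)) := rfl
    rw [this, smul_smul, smul_add, e1, e2, two_smul]
  exact smul_right_injective E two_ne_zero e4

/-- Where `m` and `dm` do not vanish, the Hessian of `m` commutes with `J`. -/
lemma hess_comm_of_regular (hq : q ∈ U) (hm : m q ≠ 0) (hN : N q ≠ 0) (v : E) :
    covVec Γ N q (J q v) = J q (covVec Γ N q v) := by
  have hF : DifferentiableAt ℝ (anticomm Γ J N) q :=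
    (h.kaehler.contDiffAt_anticomm h.isGrad.smooth_field hq).differentiableAt (by simp)
  have hS := h.differentiableAt_S hq
  have hJ := h.differentiableAt_complex hq
  have hmd := h.differentiableAt_potential hq
  have hn : DifferentiableAt ℝ (fun p => G p (N p) (N p)) q :=
    (h.contDiffAt_norm_grad hq).differentiableAt (by simp)
  refine (h.isKillingJet hq hm).hess_comm (h.covOp_grad hq hm) hN
    (h.kaehler.hess_symm h.isGrad hq) (F := anticomm Γ J N q) (W := covOp Γ (anticomm Γ J N) q)
    (fun v => rfl) ?_ ?_ (h.kaehler.cyclic_covOp_anticomm h.isGrad hq) (h.S_ne_zero hq hm) v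
  · intro u v
    have e : (fun p => m p • (anticomm Γ J N p).comp (S p)) =ᶠ[nhds q]
        fun p => G p (N p) (N p) • (J p).comp (S p) := by
      filter_upwards [h.eventually_regular hq hm hN] with p hp
      ext v
      exact h.anticomm_of_range hp.1 hp.2.1 hp.2.2 v
    have h1 := congrArg (fun L : E →L[ℝ] E => L v) (covOp_congr (Γ := Γ) e u)
    rw [covOp_smul hmd (hF.clm_comp hS), covOp_smul hn (hJ.clm_comp hS), h.fderiv_norm_grad hq,
      ← h.isGrad.grad hq] at h1
    simp only [add_apply, smul_apply, covOp_comp hF hS, covOp_comp hJ hS,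
      h.kaehler.covOp_complex hq, ContinuousLinearMap.comp_apply, zero_apply, zero_add,
      smul_add] at h1
    rw [add_assoc, add_comm, h1, add_comm]
  · intro u v w
    have := h.kaehler.covOp_adjoint (A := anticomm Γ J N) (B := fun p => (-1 : ℝ) • anticomm Γ J N p)
      hq hF (hF.const_smul (-1 : ℝ)) (by
        filter_upwards [h.eventually_mem hq] with p hp v w
        rw [h.kaehler.anticomm_skew h.isGrad hp]
        simp) u v w
    rw [this, covOp_smul (f := fun _ => (-1 : ℝ)) (differentiableAt_const _) hF]
    simp

/-- Away from the closure of the set where `m` and `dm` do not vanish, `m` is locally constant. -/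
lemma eventually_grad_eq_zero (hq : q ∈ U) (hV : ∀ᶠ p in nhds q, m p = 0 ∨ N p = 0) :
    ∀ᶠ p in nhds q, N p = 0 := by
  obtain ⟨r, hr, hball⟩ := Metric.eventually_nhds_iff_ball.1 (hV.and (h.eventually_mem hq))
  have hd : ∀ p ∈ Metric.ball q r, fderiv ℝ (fun x => m x ^ 2) p = 0 := by
    intro p hp
    have hp' := hball p hp
    have hmd := h.differentiableAt_potential hp'.2
    rw [fderiv_fun_pow 2 hmd]
    rcases hp'.1 with h0 | h0
    · simp [h0]
    · have : fderiv ℝ m p = 0 := by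
        ext v
        rw [← h.isGrad.grad hp'.2, h0]
        simp
      simp [this]
  have hconst : ∀ x ∈ Metric.ball q r, ∀ y ∈ Metric.ball q r, m x ^ 2 = m y ^ 2 := by
    intro x hx y hy
    refine Metric.isOpen_ball.is_const_of_fderiv_eq_zero
      (convex_ball q r).isPreconnected (f := fun x => m x ^ 2) ?_ hd hx hy
    intro p hp
    exact ((h.differentiableAt_potential (hball p hp).2).pow 2).differentiableWithinAt
  filter_upwards [Metric.ball_mem_nhds q hr] with p hp
  rcases (hball p hp).1 with h0 | h0
  · have hz : ∀ x ∈ Metric.ball q r, m x = 0 := by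
      intro x hx
      have := hconst x hx p hp
      rw [h0] at this
      simpa using this
    have e : m =ᶠ[nhds p] fun _ => 0 := by
      filter_upwards [Metric.isOpen_ball.mem_nhds hp] with x hx using hz x hx
    apply h.kaehler.ext_metric (hball p hp).2
    intro w
    rw [h.isGrad.grad (hball p hp).2, e.fderiv_eq]
    simp
  · exact h0

/-- The Hessian of `m` commutes with `J`. -/
lemma hess_comm (hq : q ∈ U) (v : E) : covVec Γ N q (J q v) = J q (covVec Γ N q v) := by
  by_cases hV : ∀ᶠ p in nhds q, m p = 0 ∨ N p = 0
  · have e : N =ᶠ[nhds q] fun _ => 0 := h.eventually_grad_eq_zero hq hV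
    have : covVec Γ N q = 0 := by
      ext u
      rw [covVec_apply, e.fderiv_eq, e.self_of_nhds]
      simp
    simp [this]
  · have hf : ∃ᶠ p in nhds q, p ∈ U ∧ m p ≠ 0 ∧ N p ≠ 0 := by
      have h1 : ∃ᶠ p in nhds q, ¬ (m p = 0 ∨ N p = 0) :=
      Filter.not_eventually.1 hV
      refine (h1.and_eventually (h.eventually_mem hq)).mono fun p hp => ?_
      rw [not_or] at hp
      exact ⟨hp.2, hp.1.1, hp.1.2⟩
    have hc : ContinuousAt (fun p => covVec Γ N p (J p v) - J p (covVec Γ N p v)) q := by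
      have h1 := (h.kaehler.contDiffAt_covVec h.isGrad.smooth_field hq).continuousAt
      have h2 := (h.kaehler.contDiffAt_complex hq).continuousAt
      exact (h1.clm_apply (h2.clm_apply continuousAt_const)).sub
        (h2.clm_apply (h1.clm_apply continuousAt_const))
    have h0 := (isClosed_singleton (x := (0 : E))).mem_of_frequently_of_tendsto
      (f := fun p => covVec Γ N p (J p v) - J p (covVec Γ N p v)) (b := nhds q)
      (hf.mono fun p hp => sub_eq_zero.2 (h.hess_comm_of_regular hp.1 hp.2.1 hp.2.2 v)) hc
    exact sub_eq_zero.1 h0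

/-- On the orthogonal complement of `N` and `J N`, the Hessian is multiplication by
`|N|² / (2 m)`. -/
lemma hess_of_orthogonal (hq : q ∈ U) (hm : m q ≠ 0) (hN : N q ≠ 0) {v : E}
    (h1 : G q v (N q) = 0) (h2 : G q v (J q (N q)) = 0) :
    (2 * m q) • covVec Γ N q v = G q (N q) (N q) • v :=
  (h.isKillingJet hq hm).hess_of_range (h.covOp_grad hq hm) hN (h.kaehler.hess_symm h.isGrad hq)
    ((h.isKillingJet hq hm).range_of_orthogonal hN h1 h2)

end IsLocalKilling

end LocalKilling

/-! ### Unique continuation for the Killing equation -/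

/-- Over an abstract normed group, where the instances are found quickly; it serves for spaces of
bilinear maps. -/
lemma continuousOn_norm {T Y : Type*} [TopologicalSpace T] [NormedAddCommGroup Y] {f : T → Y}
    {U : Set T} (hf : ContinuousOn f U) :
    ContinuousOn (fun p => ‖f p‖) U := hf.norm

section UniqueContinuation

variable {E : Type*} [NormedAddCommGroup E] [NormedSpace ℝ E]
  {Γ : E → E →L[ℝ] E →L[ℝ] E} {κ : E → E →L[ℝ] ℝ} {U : Set E}

set_option synthInstance.maxHeartbeats 400000 in
set_option maxHeartbeats 1000000 in
/-- The second derivatives of a solution of the Killing equation are controlled by the solution and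
its first derivatives: with `e(i,j) = ∂ᵢκⱼ + ∂ⱼκᵢ = 2 κ(Γᵢⱼ)`, one has
`2 ∂ₖ∂ᵢκⱼ = ∂ₖ e(i,j) + ∂ᵢ e(j,k) - ∂ⱼ e(k,i)`. -/
lemma norm_fderiv_fderiv_le_of_killing (hU : IsOpen U) (hκ : ContDiffOn ℝ ∞ κ U)
    (hΓ : ContDiffOn ℝ ∞ Γ U)
    (hkill : ∀ q ∈ U, ∀ u v, fderiv ℝ κ q u v + fderiv ℝ κ q v u = 2 * κ q (Γ q u v))
    {q : E} (hq : q ∈ U) {L : ℝ} (hL0 : 0 ≤ L) (hL : ∀ k, ‖fderiv ℝ Γ q k‖ ≤ L * ‖k‖) (k : E) :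
    ‖fderiv ℝ (fderiv ℝ κ) q k‖ ≤ 3 * (‖fderiv ℝ κ q‖ * ‖Γ q‖ + ‖κ q‖ * L) * ‖k‖ := by
  have hκq : ContDiffAt ℝ ∞ κ q := hκ.contDiffAt (hU.mem_nhds hq)
  have hΓd : DifferentiableAt ℝ Γ q :=
    (hΓ.contDiffAt (hU.mem_nhds hq)).differentiableAt (by simp)
  have hκd : DifferentiableAt ℝ κ q := hκq.differentiableAt (by simp)
  have hκ2 : DifferentiableAt ℝ (fderiv ℝ κ) q :=
    (hκq.fderiv_right (m := ∞) (by simp)).differentiableAt (by simp)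
  have hs : IsSymmSndFDerivAt ℝ κ q := hκq.isSymmSndFDerivAt (by simpa using two_le_infty)
  have h2 : ∀ v w, HasFDerivAt (fun p => fderiv ℝ κ p v w)
      (((fderiv ℝ (fderiv ℝ κ) q).flip v).flip w) q := by
    intro v w
    have := (hκ2.hasFDerivAt.clm_apply (hasFDerivAt_const v q)).clm_apply (hasFDerivAt_const w q)
    refine this.congr_fderiv ?_
    ext x
    simp
  have key : ∀ k i j, fderiv ℝ (fderiv ℝ κ) q k i j + fderiv ℝ (fderiv ℝ κ) q k j i =
      2 * (fderiv ℝ κ q k (Γ q i j) + κ q (fderiv ℝ Γ q k i j)) := by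
    intro k i j
    have e : (fun p => fderiv ℝ κ p i j + fderiv ℝ κ p j i) =ᶠ[nhds q]
        fun p => 2 * κ p (Γ p i j) := by
      filter_upwards [hU.mem_nhds hq] with p hp using hkill p hp i j
    have h1 := congrArg (fun L : E →L[ℝ] ℝ => L k) e.fderiv_eq
    have h3 : HasFDerivAt (fun p => Γ p i j) (((fderiv ℝ Γ q).flip i).flip j) q := by
      have := (hΓd.hasFDerivAt.clm_apply (hasFDerivAt_const i q)).clm_apply
        (hasFDerivAt_const j q)
      refine this.congr_fderiv ?_
      ext x
      simp
    rw [((h2 i j).fun_add (h2 j i)).fderiv,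
      ((hκd.hasFDerivAt.clm_apply h3).const_mul 2).fderiv] at h1
    simp at h1
    rw [h1]
    ring
  have bound : ∀ k i j, |fderiv ℝ κ q k (Γ q i j) + κ q (fderiv ℝ Γ q k i j)| ≤
      (‖fderiv ℝ κ q‖ * ‖Γ q‖ + ‖κ q‖ * L) * ‖k‖ * ‖i‖ * ‖j‖ := by
    intro k i j
    have b1 : ‖fderiv ℝ κ q k (Γ q i j)‖ ≤ ‖fderiv ℝ κ q‖ * ‖k‖ * (‖Γ q‖ * ‖i‖ * ‖j‖) :=
      ((fderiv ℝ κ q).le_opNorm₂ k _).trans (by gcongr; exact (Γ q).le_opNorm₂ i j)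
    have b2 : ‖κ q (fderiv ℝ Γ q k i j)‖ ≤ ‖κ q‖ * (L * ‖k‖ * ‖i‖ * ‖j‖) := by
      refine ((κ q).le_opNorm _).trans ?_
      gcongr
      refine ((fderiv ℝ Γ q k).le_opNorm₂ i j).trans ?_
      gcongr
      exact hL k
    calc _ ≤ ‖fderiv ℝ κ q k (Γ q i j)‖ + ‖κ q (fderiv ℝ Γ q k i j)‖ := norm_add_le _ _
      _ ≤ ‖fderiv ℝ κ q‖ * ‖k‖ * (‖Γ q‖ * ‖i‖ * ‖j‖)
          + ‖κ q‖ * (L * ‖k‖ * ‖i‖ * ‖j‖) := add_le_add b1 b2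
      _ = _ := by ring
  set C := ‖fderiv ℝ κ q‖ * ‖Γ q‖ + ‖κ q‖ * L with hC
  have hC0 : 0 ≤ C := by positivity
  refine ContinuousLinearMap.opNorm_le_bound₂ _ (by positivity) fun i j => ?_
  have s1 : fderiv ℝ (fderiv ℝ κ) q i j = fderiv ℝ (fderiv ℝ κ) q j i := hs.eq i j
  have s2 : fderiv ℝ (fderiv ℝ κ) q k i = fderiv ℝ (fderiv ℝ κ) q i k := hs.eq k i
  have s3 : fderiv ℝ (fderiv ℝ κ) q j k = fderiv ℝ (fderiv ℝ κ) q k j := hs.eq j k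
  have k1 := key k i j
  have k2 := key i j k
  have k3 := key j k i
  rw [s1] at k2
  rw [← s2] at k2
  rw [s3] at k3
  have b1 := abs_le.1 (bound k i j)
  have b2 := abs_le.1 (bound i j k)
  have b3 := abs_le.1 (bound j k i)
  have r2 : C * ‖i‖ * ‖j‖ * ‖k‖ = C * ‖k‖ * ‖i‖ * ‖j‖ := by ring
  have r3 : C * ‖j‖ * ‖k‖ * ‖i‖ = C * ‖k‖ * ‖i‖ * ‖j‖ := by ring
  rw [r2] at b2
  rw [r3] at b3
  rw [Real.norm_eq_abs, abs_le]
  constructor <;> linarith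

/-- Grönwall's inequality along segments: a map on a ball whose derivative is bounded by a locally
bounded multiple of the map vanishes if it vanishes at one point. -/
lemma eq_zero_of_norm_fderiv_le {X : Type*} [NormedAddCommGroup X] [NormedSpace ℝ X] {f : E → X}
    {K : E → ℝ} {c : E} {r : ℝ} (hf : ∀ p ∈ Metric.ball c r, DifferentiableAt ℝ f p)
    (hK : ContinuousOn K (Metric.ball c r))
    (hfK : ∀ p ∈ Metric.ball c r, ∀ v, ‖fderiv ℝ f p v‖ ≤ K p * ‖f p‖ * ‖v‖)
    {a b : E} (ha : a ∈ Metric.ball c r) (hb : b ∈ Metric.ball c r) (h0 : f a = 0) : f b = 0 := by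
  set γ : ℝ → E := fun t => a + t • (b - a) with hγ
  have hmem : ∀ t ∈ Set.Icc (0 : ℝ) 1, γ t ∈ Metric.ball c r := by
    intro t ht
    exact (convex_ball c r).add_smul_sub_mem ha hb ht
  have hγd : ∀ t, HasDerivAt γ (b - a) t := by
    intro t
    have := ((hasDerivAt_id t).smul_const (b - a)).const_add a
    rwa [one_smul] at this
  have hγc : Continuous γ := by fun_prop
  obtain ⟨C, hC⟩ := isCompact_Icc.exists_bound_of_continuousOn
    (hK.comp hγc.continuousOn hmem)
  have hfd : ∀ t ∈ Set.Icc (0 : ℝ) 1,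
      HasDerivAt (fun t => f (γ t)) (fderiv ℝ f (γ t) (b - a)) t := fun t ht =>
    (hf _ (hmem t ht)).hasFDerivAt.comp_hasDerivAt t (hγd t)
  have hend := eq_zero_of_abs_deriv_le_mul_abs_self_of_eq_zero_right (K := C * ‖b - a‖)
    (fun t ht => (hfd t ht).continuousAt.continuousWithinAt)
    (fun t ht => (hfd t ⟨ht.1, ht.2.le⟩).hasDerivWithinAt) (by simpa [hγ] using h0) (by
      intro t ht
      have ht' : t ∈ Set.Icc (0 : ℝ) 1 := ⟨ht.1, ht.2.le⟩
      calc ‖fderiv ℝ f (γ t) (b - a)‖ ≤ (K (γ t) * ‖f (γ t)‖) * ‖b - a‖ := hfK _ (hmem t ht') _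
        _ ≤ (C * ‖f (γ t)‖) * ‖b - a‖ := by
          gcongr
          exact (le_abs_self _).trans (hC t ht')
        _ = _ := by ring) 1 (by simp)
  simpa [hγ] using hend

/-- The derivative of a `C¹` map is locally bounded. -/
lemma exists_fderiv_bound {Y : Type*} [NormedAddCommGroup Y] [NormedSpace ℝ Y] {f : E → Y}
    (hU : IsOpen U) (hf : ContDiffOn ℝ ∞ f U) :
    ∃ L : E → ℝ, ContinuousOn L U ∧ (∀ p, 0 ≤ L p) ∧ ∀ p v, ‖fderiv ℝ f p v‖ ≤ L p * ‖v‖ :=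
  ⟨fun p => ‖fderiv ℝ f p‖, (hf.continuousOn_fderiv_of_isOpen hU (by simp)).norm,
    fun _ => norm_nonneg _, fun p => (fderiv ℝ f p).le_opNorm⟩

set_option synthInstance.maxHeartbeats 400000 in
set_option maxHeartbeats 1000000 in
/-- A solution of the Killing equation on a ball that vanishes near one point vanishes. -/
lemma eq_zero_of_killing {c : E} {r : ℝ} (hκ : ContDiffOn ℝ ∞ κ (Metric.ball c r))
    (hΓ : ContDiffOn ℝ ∞ Γ (Metric.ball c r))
    (hkill : ∀ q ∈ Metric.ball c r, ∀ u v,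
      fderiv ℝ κ q u v + fderiv ℝ κ q v u = 2 * κ q (Γ q u v))
    {a b : E} (ha : a ∈ Metric.ball c r) (hb : b ∈ Metric.ball c r)
    (h0 : ∀ᶠ p in nhds a, κ p = 0) : κ b = 0 := by
  have hU : IsOpen (Metric.ball c r) := Metric.isOpen_ball
  have hκd : ContDiffOn ℝ ∞ (fderiv ℝ κ) (Metric.ball c r) := hκ.fderiv_of_isOpen hU (by simp)
  obtain ⟨L, hLc, hL0, hL⟩ := exists_fderiv_bound hU hΓ
  have d1 : ∀ p ∈ Metric.ball c r, DifferentiableAt ℝ κ p := fun p hp =>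
    (hκ.contDiffAt (hU.mem_nhds hp)).differentiableAt (by simp)
  have d2 : ∀ p ∈ Metric.ball c r, DifferentiableAt ℝ (fderiv ℝ κ) p := fun p hp =>
    (hκd.contDiffAt (hU.mem_nhds hp)).differentiableAt (by simp)
  have hn : ContinuousOn (fun p => ‖Γ p‖) (Metric.ball c r) := continuousOn_norm hΓ.continuousOn
  have hcont : ContinuousOn (fun p => 1 + 3 * (‖Γ p‖ + L p)) (Metric.ball c r) :=
    continuousOn_const.add (continuousOn_const.mul
      (hn.fun_add hLc))
  have hend := eq_zero_of_norm_fderiv_le (f := fun p => (κ p, fderiv ℝ κ p))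
    (fun p hp => (d1 p hp).prodMk (d2 p hp)) hcont (by
      intro p hp v
      have h1 := norm_fderiv_fderiv_le_of_killing hU hκ hΓ hkill hp (hL0 p) (hL p) v
      rw [(d1 p hp).fderiv_prodMk (d2 p hp)]
      set n := ‖(κ p, fderiv ℝ κ p)‖ with hn
      have n1 : ‖κ p‖ ≤ n := norm_fst_le (κ p, fderiv ℝ κ p)
      have n2 : ‖fderiv ℝ κ p‖ ≤ n := norm_snd_le (κ p, fderiv ℝ κ p)
      have n0 : 0 ≤ n := (norm_nonneg (κ p)).trans n1
      have l0 := hL0 p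
      refine norm_prod_le_iff.2 ⟨?_, ?_⟩
      · calc ‖fderiv ℝ κ p v‖ ≤ 1 * n * ‖v‖ := by
              rw [one_mul]
              exact ((fderiv ℝ κ p).le_opNorm v).trans (by gcongr)
          _ ≤ _ := by
              gcongr
              have : 0 ≤ 3 * (‖Γ p‖ + L p) := by positivity
              linarith
      · calc ‖fderiv ℝ (fderiv ℝ κ) p v‖ ≤ 3 * (n * ‖Γ p‖ + n * L p) * ‖v‖ :=
              h1.trans (by gcongr)
          _ = 3 * (‖Γ p‖ + L p) * n * ‖v‖ := by ring
          _ ≤ _ := by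
              gcongr
              linarith) ha hb (by
      have e : κ =ᶠ[nhds a] fun _ => 0 := h0
      rw [e.fderiv_eq, h0.self_of_nhds, fderiv_const_apply]
      rfl)
  exact congrArg Prod.fst hend

namespace IsLocalKilling

variable {q : E} {G : E → E →L[ℝ] E →L[ℝ] ℝ}
  {J S : E → E →L[ℝ] E} {m : E → ℝ} {N : E → E} (h : IsLocalKilling U G Γ J S m N)
include h

/-- A gradient that vanishes near one point of a ball vanishes on the ball. -/
lemma grad_eq_zero_of_ball {c : E} {r : ℝ} (hball : Metric.ball c r ⊆ U) {a b : E}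
    (ha : a ∈ Metric.ball c r) (hb : b ∈ Metric.ball c r) (h0 : ∀ᶠ p in nhds a, N p = 0) :
    N b = 0 := by
  have hz := eq_zero_of_killing (κ := fun p => G p (J p (N p))) (Γ := Γ) (c := c) (r := r)
    (fun p hp => (h.kaehler.contDiffAt_kappa h.isGrad (hball hp)).contDiffWithinAt)
    (h.kaehler.smooth_chris.mono hball) (by
      intro q hq u v
      have hq := hball hq
      rw [h.kaehler.fderiv_kappa h.isGrad hq, h.kaehler.fderiv_kappa h.isGrad hq,
        h.kaehler.chris_symm hq v u, h.kaehler.complex_skew hq (covVec Γ N q v),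
        h.kaehler.hess_symm h.isGrad hq, h.hess_comm hq, h.kaehler.symm hq v]
      ring) ha hb (by
      filter_upwards [h0] with p hp
      simp [hp])
  apply h.kaehler.ext_metric (hball hb)
  intro w
  have h1 : G b (J b (N b)) (J b w) = 0 := by
    rw [show G b (J b (N b)) = 0 from hz]; rfl
  rw [h.kaehler.orthogonal (hball hb)] at h1
  rw [h1, map_zero]
  rfl

end IsLocalKilling

end UniqueContinuation

/-! ### Curvature in coordinates -/

section Curvature

variable {E : Type*} [NormedAddCommGroup E] [NormedSpace ℝ E]

/-- The endomorphism `u ↦ R(u, v) w`, where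
`R(u, v) w = ∇_u (Γ(v, w)) - ∇_v (Γ(u, w))` is the curvature of the connection with Christoffel
symbols `Γ`, evaluated on constant fields `u`, `v`, `w`. -/
def curvOp (Γ : E → E →L[ℝ] E →L[ℝ] E) (q v w : E) : E →L[ℝ] E :=
  covVec Γ (fun p => Γ p v w) q - ((fderiv ℝ Γ q v).flip w + (Γ q v).comp ((Γ q).flip w))

variable {Γ : E → E →L[ℝ] E →L[ℝ] E} {q : E} {U : Set E} {G : E → E →L[ℝ] E →L[ℝ] ℝ}
  {J : E → E →L[ℝ] E} {Y m : E → ℝ} {N : E → E}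

lemma hasFDerivAt_clm_const {X : Type*} [NormedAddCommGroup X] [NormedSpace ℝ X]
    {F : E → E →L[ℝ] X} (hF : DifferentiableAt ℝ F q) (v : E) :
    HasFDerivAt (fun p => F p v) ((fderiv ℝ F q).flip v) q := by
  refine (hF.hasFDerivAt.clm_apply (hasFDerivAt_const v q)).congr_fderiv ?_
  ext x
  simp

lemma hasFDerivAt_clm_const₂ {X : Type*} [NormedAddCommGroup X] [NormedSpace ℝ X]
    {F : E → E →L[ℝ] E →L[ℝ] X} (hF : DifferentiableAt ℝ F q) (v w : E) :
    HasFDerivAt (fun p => F p v w) (((fderiv ℝ F q).flip v).flip w) q := by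
  have h1 := hasFDerivAt_clm_const hF v
  rw [← h1.fderiv]
  exact hasFDerivAt_clm_const h1.differentiableAt w

lemma curvOp_apply (hΓ : DifferentiableAt ℝ Γ q) (u v w : E) :
    curvOp Γ q v w u = covVec Γ (fun p => Γ p v w) q u - covVec Γ (fun p => Γ p u w) q v := by
  rw [covVec_apply (u := v), (hasFDerivAt_clm_const₂ hΓ u w).fderiv]
  rfl

namespace IsLocalKaehler

variable (h : IsLocalKaehler U G Γ J)
include h

lemma differentiableAt_chris (hq : q ∈ U) : DifferentiableAt ℝ Γ q :=
  (h.contDiffAt_chris hq).differentiableAt (by simp)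

lemma differentiableAt_chris_apply (hq : q ∈ U) (v w : E) :
    DifferentiableAt ℝ (fun p => Γ p v w) q :=
  (hasFDerivAt_clm_const₂ (h.differentiableAt_chris hq) v w).differentiableAt

lemma curvOp_swap (hq : q ∈ U) (u v w : E) : curvOp Γ q v w u = -curvOp Γ q u w v := by
  rw [curvOp_apply (h.differentiableAt_chris hq), curvOp_apply (h.differentiableAt_chris hq),
    neg_sub]

/-- The Ricci identity: the curvature is the antisymmetrization of the second covariant
derivative. -/
lemma curvOp_field {Y : E → E} (hY : ContDiffOn ℝ ∞ Y U) (hq : q ∈ U) (u v : E) :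
    curvOp Γ q v (Y q) u = covOp Γ (covVec Γ Y) q u v - covOp Γ (covVec Γ Y) q v u := by
  have hYq : ContDiffAt ℝ ∞ Y q := hY.contDiffAt (h.isOpen.mem_nhds hq)
  have hYd : DifferentiableAt ℝ Y q := hYq.differentiableAt (by simp)
  have hs : IsSymmSndFDerivAt ℝ Y q := hYq.isSymmSndFDerivAt (by simpa using two_le_infty)
  have hY2 : DifferentiableAt ℝ (fderiv ℝ Y) q :=
    (hYq.fderiv_right (m := ∞) (by simp)).differentiableAt (by simp)
  have hH : DifferentiableAt ℝ (covVec Γ Y) q :=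
    (h.contDiffAt_covVec hY hq).differentiableAt (by simp)
  have hΓ := h.differentiableAt_chris hq
  have key : ∀ u v, fderiv ℝ (covVec Γ Y) q u v = fderiv ℝ (fderiv ℝ Y) q u v
      + (fderiv ℝ Γ q u v (Y q) + Γ q v (fderiv ℝ Y q u)) := by
    intro u v
    have e1 : fderiv ℝ (fun p => covVec Γ Y p v) q u = fderiv ℝ (covVec Γ Y) q u v := by
      rw [(hasFDerivAt_clm_const hH v).fderiv]
      rfl
    have e2 : HasFDerivAt (fun p => Γ p v) ((fderiv ℝ Γ q).flip v) q :=
      hasFDerivAt_clm_const hΓ v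
    rw [← e1]
    simp only [covVec_apply]
    rw [((hasFDerivAt_clm_const hY2 v).fun_add (e2.clm_apply hYd.hasFDerivAt)).fderiv]
    simp
    abel
  have s : fderiv ℝ (fderiv ℝ Y) q u v = fderiv ℝ (fderiv ℝ Y) q v u := hs.eq u v
  rw [curvOp_apply hΓ, covOp_apply, covOp_apply, key, key, s, h.chris_symm hq v u]
  simp only [covVec_apply, (hasFDerivAt_clm_const₂ hΓ _ _).fderiv, map_add,
    ContinuousLinearMap.flip_apply]
  abel

/-- The first Bianchi identity. -/
lemma curvOp_bianchi (hq : q ∈ U) (u v w : E) :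
    curvOp Γ q v w u + curvOp Γ q w u v + curvOp Γ q u v w = 0 := by
  have hΓ := h.differentiableAt_chris hq
  have e : ∀ u v, covVec Γ (fun p => Γ p u v) q = covVec Γ (fun p => Γ p v u) q := by
    intro u v
    have e1 : (fun p => Γ p u v) =ᶠ[nhds q] fun p => Γ p v u := by
      filter_upwards [h.isOpen.mem_nhds hq] with p hp using h.chris_symm hp u v
    rw [covVec, covVec, e1.fderiv_eq, h.chris_symm hq u v]
  rw [curvOp_apply hΓ, curvOp_apply hΓ, curvOp_apply hΓ, e v w, e w u, e u v]
  abel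

/-- The curvature endomorphisms `R(u, v)` are skew. -/
lemma metric_curvOp_skew (hq : q ∈ U) (u v w z : E) :
    G q (curvOp Γ q v w u) z = -G q w (curvOp Γ q v z u) := by
  have hG := h.contDiffAt_metric hq
  have hf : ContDiffAt ℝ ∞ (fun p => G p w z) q :=
    (hG.clm_apply (contDiffAt_const (c := w))).clm_apply (contDiffAt_const (c := z))
  have hf2 : DifferentiableAt ℝ (fderiv ℝ fun p => G p w z) q :=
    (hf.fderiv_right (m := ∞) (by simp)).differentiableAt (by simp)
  have hs : IsSymmSndFDerivAt ℝ (fun p => G p w z) q :=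
    hf.isSymmSndFDerivAt (by simpa using two_le_infty)
  have c : ∀ v : E, DifferentiableAt ℝ (fun _ : E => v) q := fun v => differentiableAt_const v
  have key : ∀ u v, fderiv ℝ (fderiv ℝ fun p => G p w z) q u v =
      G q (covVec Γ (fun p => Γ p v w) q u) z + G q (Γ q v w) (Γ q u z)
        + (G q (Γ q u w) (Γ q v z) + G q w (covVec Γ (fun p => Γ p v z) q u)) := by
    intro u v
    have e : (fun p => fderiv ℝ (fun p => G p w z) p v) =ᶠ[nhds q]
        fun p => G p (Γ p v w) z + G p w (Γ p v z) := by
      filter_upwards [h.isOpen.mem_nhds hq] with p hp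
      rw [h.fderiv_metric_apply hp (differentiableAt_const w) (differentiableAt_const z)]
      simp [covVec_apply]
    have h1 := congrArg (fun L : E →L[ℝ] ℝ => L u) e.fderiv_eq
    have d1 := h.differentiableAt_chris_apply hq v w
    have d2 := h.differentiableAt_chris_apply hq v z
    have hGd : DifferentiableAt ℝ G q := hG.differentiableAt (by simp)
    rw [fderiv_fun_add ((hGd.clm_apply d1).clm_apply (c z)) ((hGd.clm_apply (c w)).clm_apply d2),
      add_apply, h.fderiv_metric_apply hq d1 (c z), h.fderiv_metric_apply hq (c w) d2,
      fderiv_clm_apply hf2 (c v)] at h1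
    simpa [covVec_apply] using h1
  have k1 := key u v
  have k2 := key v u
  rw [show fderiv ℝ (fderiv ℝ fun p => G p w z) q u v
    = fderiv ℝ (fderiv ℝ fun p => G p w z) q v u from hs.eq u v] at k1
  rw [curvOp_apply (h.differentiableAt_chris hq), curvOp_apply (h.differentiableAt_chris hq)]
  simp only [map_sub, sub_apply]
  linarith

/-- The pair symmetry of the curvature tensor. -/
lemma metric_curvOp_pair (hq : q ∈ U) (u v w z : E) :
    G q (curvOp Γ q v w u) z = G q (curvOp Γ q z u w) v := by
  have b : ∀ u v w z, G q (curvOp Γ q v w u) z + G q (curvOp Γ q w u v) z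
      + G q (curvOp Γ q u v w) z = 0 := by
    intro u v w z
    rw [← add_apply, ← map_add, ← add_apply, ← map_add, h.curvOp_bianchi hq]
    simp
  have s : ∀ u v w z, G q (curvOp Γ q v w u) z = -G q (curvOp Γ q v z u) w := by
    intro u v w z
    rw [h.metric_curvOp_skew hq, h.symm hq w]
  have a : ∀ u v w z, G q (curvOp Γ q v w u) z = -G q (curvOp Γ q u w v) z := by
    intro u v w z
    rw [h.curvOp_swap hq u v, map_neg, neg_apply]
  linarith [b u v w z, b v w z u, b w z u v, b z u v w, s u v w z, s v w z u, s w z u v, s z u v w,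
    s v w u z, s w u v z, s u v w z, s w z v u, s z v w u, s v w z u, s z u w v, s u w z v,
    s w z u v, s u v z w, s v z u w, s z u v w, a u v w z, a v w u z, a w u v z, a v w z u,
    a w z v u, a z v w u, a w z u v, a z u w v, a u w z v, a z u v w, a u v z w, a v z u w]

lemma curvOp_add (hq : q ∈ U) (v w w' : E) :
    curvOp Γ q v (w + w') = curvOp Γ q v w + curvOp Γ q v w' := by
  ext u
  refine h.ext_metric hq fun z => ?_
  rw [add_apply, map_add, add_apply, h.metric_curvOp_pair hq u v (w + w'), map_add, map_add,
    add_apply, h.metric_curvOp_pair hq u v w, h.metric_curvOp_pair hq u v w']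

lemma curvOp_smul (hq : q ∈ U) (c : ℝ) (v w : E) :
    curvOp Γ q v (c • w) = c • curvOp Γ q v w := by
  ext u
  refine h.ext_metric hq fun z => ?_
  rw [smul_apply, map_smul, smul_apply, h.metric_curvOp_pair hq, map_smul, map_smul, smul_apply,
    ← h.metric_curvOp_pair hq]

/-- The curvature of a Kähler metric commutes with the complex structure. -/
lemma curvOp_complex (hq : q ∈ U) (u v w : E) :
    curvOp Γ q v (J q w) u = J q (curvOp Γ q v w u) := by
  have hJ : DifferentiableAt ℝ J q := (h.contDiffAt_complex hq).differentiableAt (by simp)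
  have hK : DifferentiableAt ℝ (covVec Γ fun _ => w) q :=
    (h.contDiffAt_covVec contDiffOn_const hq).differentiableAt (by simp)
  have e : covVec Γ (fun p => J p w) =ᶠ[nhds q] fun p => (J p).comp (covVec Γ (fun _ => w) p) := by
    filter_upwards [h.isOpen.mem_nhds hq] with p hp
    ext x
    rw [covVec_clm_apply ((h.contDiffAt_complex hp).differentiableAt (by simp))
      (differentiableAt_const w), h.covOp_complex hp]
    simp
  rw [h.curvOp_field (Y := fun p => J p w) (h.smooth_complex.clm_apply contDiffOn_const) hq,
    h.curvOp_field (Y := fun _ => w) contDiffOn_const hq, covOp_congr e, covOp_congr e,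
    covOp_comp hJ hK, covOp_comp hJ hK, h.covOp_complex hq, h.covOp_complex hq]
  simp

/-- The curvature form of a Kähler metric is of type `(1, 1)`. -/
lemma curvOp_complex_complex (hq : q ∈ U) (u v w : E) :
    curvOp Γ q (J q v) w (J q u) = curvOp Γ q v w u := by
  apply h.ext_metric hq
  intro z
  rw [h.metric_curvOp_pair hq, h.curvOp_complex hq, h.orthogonal hq, ← h.metric_curvOp_pair hq]

end IsLocalKaehler

end Curvature

/-! ### The Ricci tensor of a Kähler metric with a Killing potential -/

section Ricci

variable {E : Type*} [NormedAddCommGroup E] [NormedSpace ℝ E]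

variable {Γ : E → E →L[ℝ] E →L[ℝ] E} {q : E} {U : Set E} {G : E → E →L[ℝ] E →L[ℝ] ℝ}
  {J S : E → E →L[ℝ] E} {m : E → ℝ} {N : E → E}

namespace IsLocalKilling

variable (h : IsLocalKilling U G Γ J S m N)
include h

lemma differentiableAt_hess (hq : q ∈ U) : DifferentiableAt ℝ (covVec Γ N) q :=
  (h.kaehler.contDiffAt_covVec h.isGrad.smooth_field hq).differentiableAt (by simp)

/-- The covariant derivatives of the Hessian commute with `J`. -/
lemma covOp_hess_comm (hq : q ∈ U) (u v : E) :
    covOp Γ (covVec Γ N) q u (J q v) = J q (covOp Γ (covVec Γ N) q u v) := by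
  have hH := h.differentiableAt_hess hq
  have hJ := h.differentiableAt_complex hq
  have e : (fun p => (covVec Γ N p).comp (J p)) =ᶠ[nhds q]
      fun p => (J p).comp (covVec Γ N p) := by
    filter_upwards [h.eventually_mem hq] with p hp
    ext x
    exact h.hess_comm hp x
  have h1 := congrArg (fun L : E →L[ℝ] E => L v) (covOp_congr (Γ := Γ) e u)
  simpa [covOp_comp hH hJ, covOp_comp hJ hH, h.kaehler.covOp_complex hq] using h1

lemma covOp_hess_symm (hq : q ∈ U) (u v w : E) :
    G q (covOp Γ (covVec Γ N) q u v) w = G q v (covOp Γ (covVec Γ N) q u w) :=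
  h.kaehler.covOp_adjoint hq (h.differentiableAt_hess hq) (h.differentiableAt_hess hq)
    (by filter_upwards [h.eventually_mem hq] with p hp using h.kaehler.hess_symm h.isGrad hp) u v w

/-- The gradient is an eigenvector of the Hessian `H`: the vector `H N` lies in the kernel of `S`,
spanned by `N` and `J N`, and is orthogonal to `J N`. -/
lemma hess_grad (hq : q ∈ U) (hm : m q ≠ 0) (hN : N q ≠ 0) :
    G q (N q) (N q) • covVec Γ N q (N q) = G q (covVec Γ N q (N q)) (N q) • N q := by
  have hK := h.isKillingJet hq hm
  have h0 : G q (covVec Γ N q (N q)) (J q (N q)) = 0 := by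
    have h1 := h.kaehler.hess_symm h.isGrad hq (N q) (J q (N q))
    rw [h.hess_comm hq, h.kaehler.symm hq, h.kaehler.complex_skew hq] at h1
    have h2 := h.kaehler.symm hq (N q) (J q (covVec Γ N q (N q)))
    rw [h.kaehler.complex_skew hq, h.kaehler.symm hq _ (J q (N q)),
      h.kaehler.complex_skew hq] at h2
    have h3 := h.kaehler.symm hq (covVec Γ N q (N q)) (J q (N q))
    rw [h.kaehler.complex_skew hq] at h3
    linarith
  rw [← sub_eq_zero]
  refine hK.ext_ker hN ?_ ?_ ?_
  · rw [map_sub, map_smul, map_smul, hK.S_grad,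
      hK.S_hess_grad (h.covOp_grad hq hm)]
    simp
  · simp
    ring
  · simp [h0, hK.complex_self]

/-- The differential of `|∇m|²` is proportional to `dm`, with factor `2α`; since `α dm` is closed,
`dα` is proportional to `dm`. -/
lemma fderiv_hess_grad (hq : q ∈ U) (hm : m q ≠ 0) (hN : N q ≠ 0) {u : E} (hu : G q (N q) u = 0) :
    fderiv ℝ (fun p => G p (covVec Γ N p (N p)) (N p) / G p (N p) (N p)) q u = 0 := by
  set α : E → ℝ := fun p => G p (covVec Γ N p (N p)) (N p) / G p (N p) (N p) with hα
  set f : E → ℝ := fun p => G p (N p) (N p) with hf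
  have hpos : 0 < f q := h.kaehler.pos hq hN
  have hNs := h.kaehler.contDiffAt_grad h.isGrad hq
  have hαs : ContDiffAt ℝ ∞ α q := by
    refine ContDiffAt.div ?_ (h.contDiffAt_norm_grad hq) hpos.ne'
    exact ((h.kaehler.contDiffAt_metric hq).clm_apply
      ((h.kaehler.contDiffAt_covVec h.isGrad.smooth_field hq).clm_apply hNs)).clm_apply hNs
  have hαd : DifferentiableAt ℝ α q := hαs.differentiableAt (by simp)
  have hms := h.kaehler.contDiffAt_potential h.isGrad hq
  have hfs : ContDiffAt ℝ ∞ f q := h.contDiffAt_norm_grad hq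
  have dm2 : DifferentiableAt ℝ (fderiv ℝ m) q :=
    (hms.fderiv_right (m := ∞) (by simp)).differentiableAt (by simp)
  have df2 : DifferentiableAt ℝ (fderiv ℝ f) q :=
    (hfs.fderiv_right (m := ∞) (by simp)).differentiableAt (by simp)
  have sm : IsSymmSndFDerivAt ℝ m q := hms.isSymmSndFDerivAt (by simpa using two_le_infty)
  have sf : IsSymmSndFDerivAt ℝ f q := hfs.isSymmSndFDerivAt (by simpa using two_le_infty)
  have key : ∀ u v, fderiv ℝ (fderiv ℝ f) q u v =
      2 * (α q * fderiv ℝ (fderiv ℝ m) q u v + fderiv ℝ α q u * fderiv ℝ m q v) := by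
    intro u v
    have e : (fun p => fderiv ℝ f p v) =ᶠ[nhds q] fun p => 2 * (α p * fderiv ℝ m p v) := by
      filter_upwards [h.eventually_regular hq hm hN] with p hp
      have hp0 := h.kaehler.pos hp.1 hp.2.2
      have h1 : covVec Γ N p (N p) = α p • N p := by
        rw [hα]
        simp only
        rw [div_eq_inv_mul, mul_smul, ← h.hess_grad hp.1 hp.2.1 hp.2.2, smul_smul,
          inv_mul_cancel₀ hp0.ne', one_smul]
      rw [hf, h.fderiv_norm_grad hp.1, h.kaehler.hess_symm h.isGrad hp.1, h1, map_smul,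
        h.kaehler.symm hp.1, h.isGrad.grad hp.1]
      rfl
    have h1 := congrArg (fun L : E →L[ℝ] ℝ => L u) e.fderiv_eq
    have h2 : HasFDerivAt (fun p => α p * fderiv ℝ m p v) _ q :=
      hαd.hasFDerivAt.mul (hasFDerivAt_clm_const dm2 v)
    rw [(hasFDerivAt_clm_const df2 v).fderiv, (h2.const_mul 2).fderiv] at h1
    simp only [ContinuousLinearMap.flip_apply, smul_apply, add_apply, smul_eq_mul] at h1
    rw [h1]
    ring
  have k1 := key u (N q)
  have k2 := key (N q) u
  rw [sf.eq u (N q), sm.eq u (N q)] at k1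
  rw [← h.isGrad.grad hq] at k1 k2
  rw [hu] at k2
  have : fderiv ℝ α q u * f q = 0 := by
    change fderiv ℝ α q u * G q (N q) (N q) = 0
    linarith
  exact (mul_eq_zero.1 this).resolve_right hpos.ne'

end IsLocalKilling

variable [FiniteDimensional ℝ E]

/-- The trace of a continuous endomorphism, as a continuous linear form. -/
def opTrace (E : Type*) [NormedAddCommGroup E] [NormedSpace ℝ E] [FiniteDimensional ℝ E] :
    (E →L[ℝ] E) →L[ℝ] ℝ :=
  LinearMap.toContinuousLinearMap ((LinearMap.trace ℝ E).comp (ContinuousLinearMap.coeLM ℝ))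

lemma opTrace_eq (A : E →L[ℝ] E) : opTrace E A = LinearMap.trace ℝ E A.toLinearMap := rfl

lemma opTrace_comp_comm (A B : E →L[ℝ] E) : opTrace E (A.comp B) = opTrace E (B.comp A) := by
  rw [opTrace_eq, opTrace_eq]
  exact LinearMap.trace_comp_comm' _ _

lemma opTrace_id : opTrace E (ContinuousLinearMap.id ℝ E) = Module.finrank ℝ E := by
  rw [opTrace_eq]
  exact LinearMap.trace_id ℝ E

/-- Adjoint endomorphisms have the same trace. -/
lemma opTrace_eq_of_adjoint {B : E →L[ℝ] E →L[ℝ] ℝ} (hB : ∀ v, v ≠ 0 → 0 < B v v)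
    {A A' : E →L[ℝ] E} (h : ∀ u v, B (A u) v = B u (A' v)) : opTrace E A = opTrace E A' := by
  have hinj : Function.Injective
      ((ContinuousLinearMap.coeLM ℝ).comp B.toLinearMap : E →ₗ[ℝ] Module.Dual ℝ E) := by
    rw [← LinearMap.ker_eq_bot, LinearMap.ker_eq_bot']
    intro v hv
    by_contra hne
    have h1 : B v v = 0 := congrArg (fun φ : Module.Dual ℝ E => φ v) hv
    exact (hB v hne).ne' h1
  set e : E ≃ₗ[ℝ] Module.Dual ℝ E := LinearEquiv.ofInjectiveOfFinrankEq _ hinj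
    Subspace.dual_finrank_eq.symm with he
  have hconj : e.conj A.toLinearMap = Module.Dual.transpose (R := ℝ) A'.toLinearMap := by
    ext φ v
    obtain ⟨u, rfl⟩ := e.surjective φ
    rw [LinearEquiv.conj_apply_apply, e.symm_apply_apply]
    exact h u v
  rw [opTrace_eq, opTrace_eq, ← LinearMap.trace_conj' A.toLinearMap e, hconj,
    LinearMap.trace_transpose']

lemma opTrace_covOp {A : E → E →L[ℝ] E} (hA : DifferentiableAt ℝ A q) (v : E) :
    opTrace E (covOp Γ A q v) = fderiv ℝ (fun p => opTrace E (A p)) q v := by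
  have h1 : fderiv ℝ (fun p => opTrace E (A p)) q v = opTrace E (fderiv ℝ A q v) := by
    have h2 : HasFDerivAt (fun p => opTrace E (A p)) ((opTrace E).comp (fderiv ℝ A q)) q :=
      (opTrace E).hasFDerivAt.comp q hA.hasFDerivAt
    rw [h2.fderiv]
    rfl
  rw [h1, covOp, map_sub, map_add, opTrace_comp_comm (Γ q v)]
  ring

/-- The symmetry of the Ricci tensor. -/
lemma IsLocalKaehler.opTrace_curvOp_symm (h : IsLocalKaehler U G Γ J) (hq : q ∈ U) (v w : E) :
    opTrace E (curvOp Γ q v w) = opTrace E (curvOp Γ q w v) := by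
  refine opTrace_eq_of_adjoint (B := G q) (fun v hv => h.pos hq hv) fun u z => ?_
  rw [h.metric_curvOp_pair hq, h.metric_curvOp_skew hq, h.curvOp_swap hq w z v, map_neg, neg_neg]

namespace IsLocalKilling

variable (h : IsLocalKilling U G Γ J S m N)
include h

/-- The Ricci tensor applied to the gradient is `-½ d(tr H)`. With `P u = (∇_u H) v` one has
`R(u, v) N = P u - (∇_v H) u`. Replacing `u`, `v` by `J u`, `J v` leaves the left-hand side
unchanged, replaces `P` by `J P J`, whose trace is `-tr P`, and replaces `∇_v H` by the trace-free
endomorphism `(∇_{J v} H) J`. Hence `tr P = ½ tr (∇_v H)`. -/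
lemma opTrace_curvOp_grad (hq : q ∈ U) (v : E) :
    2 * opTrace E (curvOp Γ q v (N q)) = -fderiv ℝ (fun p => opTrace E (covVec Γ N p)) q v := by
  have hH := h.differentiableAt_hess hq
  set P : E →L[ℝ] E := curvOp Γ q v (N q) + covOp Γ (covVec Γ N) q v with hP
  have hPu : ∀ u, P u = covOp Γ (covVec Γ N) q u v := by
    intro u
    rw [hP, add_apply, h.kaehler.curvOp_field h.isGrad.smooth_field hq]
    abel
  have e : curvOp Γ q v (N q) = (J q).comp (P.comp (J q))
      - (covOp Γ (covVec Γ N) q (J q v)).comp (J q) := by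
    ext u
    rw [← h.kaehler.curvOp_complex_complex hq,
      h.kaehler.curvOp_field h.isGrad.smooth_field hq, h.covOp_hess_comm hq, ← hPu]
    rfl
  have t1 : opTrace E ((J q).comp (P.comp (J q))) = -opTrace E P := by
    have : (P.comp (J q)).comp (J q) = -P := by
      ext u
      simp [h.kaehler.sq hq]
    rw [opTrace_comp_comm, this, map_neg]
  have t2 : opTrace E ((covOp Γ (covVec Γ N) q (J q v)).comp (J q)) = 0 := by
    have := opTrace_eq_of_adjoint (B := G q) (fun v hv => h.kaehler.pos hq hv)
      (A := (covOp Γ (covVec Γ N) q (J q v)).comp (J q))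
      (A' := -(covOp Γ (covVec Γ N) q (J q v)).comp (J q)) (by
        intro u w
        change G q (covOp Γ (covVec Γ N) q (J q v) (J q u)) w
          = G q u (-covOp Γ (covVec Γ N) q (J q v) (J q w))
        rw [h.covOp_hess_symm hq, h.kaehler.complex_skew hq, h.covOp_hess_comm hq]
        exact ((G q u).map_neg _).symm)
    rw [map_neg] at this
    linarith
  have t3 : opTrace E P = opTrace E (curvOp Γ q v (N q)) + opTrace E (covOp Γ (covVec Γ N) q v) :=
    map_add (opTrace E) _ _
  have t4 := congrArg (opTrace E) e
  rw [opTrace_covOp hH] at t3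
  rw [map_sub, t1, t2] at t4
  linarith

/-- Where `m` and `dm` do not vanish, the Hessian is a combination of the projections `m⁻¹ S` and
`1 - m⁻¹ S`. -/
lemma opTrace_hess (hq : q ∈ U) (hm : m q ≠ 0) (hN : N q ≠ 0) :
    opTrace E (covVec Γ N q) =
      G q (N q) (N q) / (2 * m q) * (opTrace E (S q) / m q)
      + G q (covVec Γ N q (N q)) (N q) / G q (N q) (N q)
        * (Module.finrank ℝ E - opTrace E (S q) / m q) := by
  have hp := h.kaehler.pos hq hN
  set φ := G q (N q) (N q) / (2 * m q) with hφ
  set α := G q (covVec Γ N q (N q)) (N q) / G q (N q) (N q) with hα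
  have h1 : covVec Γ N q (N q) = α • N q := by
    rw [hα, div_eq_inv_mul, mul_smul, ← h.hess_grad hq hm hN, smul_smul,
      inv_mul_cancel₀ hp.ne', one_smul]
  have h2 : ∀ v, covVec Γ N q (S q v) = φ • S q v := by
    intro v
    rw [hφ, div_eq_inv_mul, mul_smul, ← h.hess_of_range hq hm hN, smul_smul,
      inv_mul_cancel₀ (by simpa using hm), one_smul]
  have h3 : covVec Γ N q = φ • ((m q)⁻¹ • S q)
      + α • (ContinuousLinearMap.id ℝ E - (m q)⁻¹ • S q) := by
    ext v
    have hz : S q (v - (m q)⁻¹ • S q v) = 0 := by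
      rw [map_sub, map_smul, h.S_sq hq, smul_smul, inv_mul_cancel₀ hm, one_smul, sub_self]
    obtain ⟨s, t, hst⟩ := h.ker_span hq hm hN (h.isKillingJet hq hm).S_grad hz
    have h4 : covVec Γ N q (v - (m q)⁻¹ • S q v) = α • (v - (m q)⁻¹ • S q v) := by
      rw [hst, map_add, map_smul, map_smul, h.hess_comm hq, h1, map_smul, smul_add,
        smul_comm α s, smul_comm α t]
    rw [map_sub, sub_eq_iff_eq_add, map_smul, h2] at h4
    rw [h4, add_comm, smul_comm (m q)⁻¹ φ]
    rfl
  rw [h3]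
  simp only [map_add, map_sub, map_smul, opTrace_id, smul_eq_mul]
  ring

/-- Where `m` and `dm` do not vanish, the gradient is an eigenvector of the Ricci tensor: the
derivatives of both eigenvalues of the Hessian, and hence of its trace, vanish on the orthogonal
complement of the gradient. -/
lemma opTrace_curvOp_eq_zero {k : ℝ} (htr : ∀ p ∈ U, opTrace E (S p) = k * m p) (hq : q ∈ U)
    (hm : m q ≠ 0) (hN : N q ≠ 0) {u : E} (hu : G q (N q) u = 0) :
    opTrace E (curvOp Γ q (N q) u) = 0 := by
  rw [h.kaehler.opTrace_curvOp_symm hq]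
  set α : E → ℝ := fun p => G p (covVec Γ N p (N p)) (N p) / G p (N p) (N p) with hα
  have hpos := h.kaehler.pos hq hN
  have e : (fun p => opTrace E (covVec Γ N p)) =ᶠ[nhds q]
      fun p => G p (N p) (N p) * (2 * m p)⁻¹ * k + α p * (Module.finrank ℝ E - k) := by
    filter_upwards [h.eventually_regular hq hm hN] with p hp
    rw [h.opTrace_hess hp.1 hp.2.1 hp.2.2, htr p hp.1, mul_div_cancel_right₀ _ hp.2.1,
      div_eq_mul_inv]
  have hNs := h.kaehler.contDiffAt_grad h.isGrad hq
  have hαd : DifferentiableAt ℝ α q := by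
    have hαs : ContDiffAt ℝ ∞ α q := by
      refine ContDiffAt.div ?_ (h.contDiffAt_norm_grad hq) hpos.ne'
      exact ((h.kaehler.contDiffAt_metric hq).clm_apply
        ((h.kaehler.contDiffAt_covVec h.isGrad.smooth_field hq).clm_apply hNs)).clm_apply hNs
    exact hαs.differentiableAt (by simp)
  have hfd : DifferentiableAt ℝ (fun p => G p (N p) (N p)) q :=
    (h.contDiffAt_norm_grad hq).differentiableAt (by simp)
  have hmd := h.differentiableAt_potential hq
  have h0 : fderiv ℝ m q u = 0 := by rw [← h.isGrad.grad hq, hu]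
  have h1 : fderiv ℝ (fun p => G p (N p) (N p)) q u = 0 := by
    rw [h.fderiv_norm_grad hq, h.kaehler.hess_symm h.isGrad hq, h.kaehler.symm hq]
    have := congrArg (fun x => G q x u) (h.hess_grad hq hm hN)
    simp only [map_smul, smul_apply, hu, smul_eq_mul, mul_zero] at this
    rw [(mul_eq_zero.1 this).resolve_left hpos.ne', mul_zero]
  have hinv : DifferentiableAt ℝ (fun p => (2 * m p)⁻¹) q :=
    (hmd.const_mul 2).inv (by simpa using hm)
  have h2 : fderiv ℝ (fun p => (2 * m p)⁻¹) q u = 0 := by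
    have := (((hasDerivAt_inv (x := 2 * m q) (by simpa using hm)).comp_hasFDerivAt q
      (hmd.hasFDerivAt.const_mul 2)).fderiv)
    have h3 := congrArg (fun L : E →L[ℝ] ℝ => L u) this
    simp only [smul_apply, h0, smul_zero] at h3
    exact h3
  have h3 := h.opTrace_curvOp_grad hq u
  have hfi : DifferentiableAt ℝ (fun p => G p (N p) (N p) * (2 * m p)⁻¹) q := hfd.mul hinv
  rw [e.fderiv_eq, fderiv_fun_add (hfi.mul_const k) (hαd.mul_const _),
    fderiv_mul_const hfi, fderiv_mul_const hαd, fderiv_fun_mul hfd hinv] at h3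
  simp only [add_apply, smul_apply, h1, h2, h.fderiv_hess_grad hq hm hN hu, hα,
    smul_zero, add_zero, neg_zero] at h3
  linarith

/-- The differential of `m` vanishes at the zeros of `m`: near a point with `dm ≠ 0` the
identity `2 m H v = |∇m|² v` holds for `v` orthogonal to `∇m` and `J∇m`, first on a dense set and
then everywhere. -/
lemma potential_ne_zero (hd : 2 < Module.finrank ℝ E) (hq : q ∈ U) (hN : N q ≠ 0) : m q ≠ 0 := by
  intro hm
  have hf : ∃ᶠ p in nhds q, p ∈ U ∧ m p ≠ 0 ∧ N p ≠ 0 := by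
    have h1 : ∃ᶠ p in nhds q, ¬ (m p = 0 ∨ N p = 0) := by
      intro hV
      simp only [not_not] at hV
      exact hN (h.eventually_grad_eq_zero hq hV).self_of_nhds
    refine (h1.and_eventually (h.eventually_mem hq)).mono fun p hp => ?_
    rw [not_or] at hp
    exact ⟨hp.2, hp.1.1, hp.1.2⟩
  have hpos := h.kaehler.pos hq hN
  obtain ⟨v, hv, hv0⟩ : ∃ v ∈ LinearMap.ker
      ((G q (N q)).toLinearMap.prod (G q (J q (N q))).toLinearMap), v ≠ 0 := by
    refine Submodule.exists_mem_ne_zero_of_ne_bot ?_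
    refine LinearMap.ker_ne_bot_of_finrank_lt ?_
    simpa using hd
  have hv1 : G q v (N q) = 0 := by rw [h.kaehler.symm hq]; exact congrArg Prod.fst (LinearMap.mem_ker.1 hv)
  have hv2 : G q v (J q (N q)) = 0 := by rw [h.kaehler.symm hq]; exact congrArg Prod.snd (LinearMap.mem_ker.1 hv)
  -- `T p` is `|N|²` times the orthogonal projection of `v` to the complement of `N` and `J N`
  set T : E → E := fun p => G p (N p) (N p) • v - G p v (N p) • N p
    - G p v (J p (N p)) • J p (N p) with hT
  set Φ : E → E := fun p => (2 * m p) • covVec Γ N p (T p) - G p (N p) (N p) • T p with hΦ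
  have hTq : T q = G q (N q) (N q) • v := by simp [hT, hv1, hv2]
  have h0 : Φ q = 0 := by
    have hc : ContinuousAt Φ q := by
      have c1 := (h.kaehler.contDiffAt_covVec h.isGrad.smooth_field hq).continuousAt
      have c2 := (h.kaehler.contDiffAt_complex hq).continuousAt
      have c3 := (h.kaehler.contDiffAt_grad h.isGrad hq).continuousAt
      have c4 := (h.kaehler.contDiffAt_metric hq).continuousAt
      have c5 := (h.kaehler.contDiffAt_potential h.isGrad hq).continuousAt
      have c6 : ContinuousAt (fun p => J p (N p)) q := c2.clm_apply c3
      have c7 : ContinuousAt (fun p => G p v) q := c4.clm_apply continuousAt_const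
      have c8 : ContinuousAt (fun p => G p (N p) (N p)) q := (c4.clm_apply c3).clm_apply c3
      have cT : ContinuousAt T q :=
        ((c8.smul continuousAt_const).sub ((c7.clm_apply c3).smul c3)).sub
          ((c7.clm_apply c6).smul c6)
      exact ((continuousAt_const.mul c5).smul (c1.clm_apply cT)).sub (c8.smul cT)
    refine (isClosed_singleton (x := (0 : E))).mem_of_frequently_of_tendsto (hf.mono ?_) hc
    rintro p ⟨hp, hmp, hNp⟩
    have hs : G p (N p) (J p (N p)) = 0 := (h.isKillingJet hp hmp).complex_self (N p)
    have hs' : G p (J p (N p)) (N p) = 0 := by rw [h.kaehler.symm hp, hs]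
    refine sub_eq_zero.2 (h.hess_of_orthogonal hp hmp hNp ?_ ?_)
    · simp only [hT, map_sub, map_smul, sub_apply, smul_apply, smul_eq_mul, hs']
      ring
    · simp only [hT, map_sub, map_smul, sub_apply, smul_apply, smul_eq_mul, hs,
        h.kaehler.orthogonal hp]
      ring
  simp only [hΦ, hm, hTq, mul_zero, zero_smul, zero_sub, neg_eq_zero, smul_smul] at h0
  exact (smul_ne_zero (mul_pos hpos hpos).ne' hv0) h0

end IsLocalKilling

end Ricci

/-! ### Smoothness of fields defined by duality -/

section Duality

variable {E : Type*} [NormedAddCommGroup E] [NormedSpace ℝ E] [FiniteDimensional ℝ E]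

/-- A vector field is smooth if its inner products with constant fields are. -/
lemma contDiffOn_of_metric {U : Set E} {G : E → E →L[ℝ] E →L[ℝ] ℝ}
    (hG : ContDiffOn ℝ ∞ G U) (hpos : ∀ p ∈ U, ∀ v, v ≠ 0 → 0 < G p v v) {Y : E → E}
    (hY : ∀ w, ContDiffOn ℝ ∞ (fun p => G p (Y p) w) U) : ContDiffOn ℝ ∞ Y U := by
  have : CompleteSpace E := FiniteDimensional.complete ℝ E
  have hinv : ∀ p ∈ U, ∃ e : E ≃L[ℝ] (E →L[ℝ] ℝ), (e : E →L[ℝ] E →L[ℝ] ℝ) = G p := by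
    intro p hp
    have hinj : Function.Injective (G p).toLinearMap := by
      rw [← LinearMap.ker_eq_bot, LinearMap.ker_eq_bot']
      intro v hv
      by_contra hne
      have h1 : G p v v = 0 := congrArg (fun φ : E →L[ℝ] ℝ => φ v) hv
      exact (hpos p hp v hne).ne' h1
    have hdim : Module.finrank ℝ E = Module.finrank ℝ (E →L[ℝ] ℝ) := by
      rw [← LinearMap.toContinuousLinearMap.finrank_eq]
      exact Subspace.dual_finrank_eq.symm
    exact ⟨(LinearEquiv.ofInjectiveOfFinrankEq _ hinj hdim).toContinuousLinearEquiv, by ext; rfl⟩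
  have hGY : ContDiffOn ℝ ∞ (fun p => G p (Y p)) U := contDiffOn_clm_apply.2 hY
  have h1 : ContDiffOn ℝ ∞ (fun p => (G p).inverse (G p (Y p))) U := by
    refine ContDiffOn.clm_apply ?_ hGY
    intro p hp
    obtain ⟨e, he⟩ := hinv p hp
    have h2 := contDiffAt_map_inverse (n := ∞) e
    rw [he] at h2
    exact h2.comp_contDiffWithinAt p (hG p hp)
  refine h1.congr fun p hp => ?_
  obtain ⟨e, he⟩ := hinv p hp
  rw [← he, ContinuousLinearMap.inverse_equiv]
  exact (e.symm_apply_apply _).symm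

end Duality

/-! ### Kähler manifolds in charts -/

section KaehlerChart

variable {E : Type*} [NormedAddCommGroup E] [NormedSpace ℝ E] [FiniteDimensional ℝ E]
  {M : Type*} [TopologicalSpace M] [ChartedSpace E M] [IsManifold 𝓘(ℝ, E) ∞ M] (x₀ : M)
  {g : RMetric E M} {J S : EndField E M} {μ : M → ℝ}

lemma contDiffOn_chris (g : RMetric E M) : ContDiffOn ℝ ∞ (chris x₀ g) (dom E x₀) := by
  have hG := contDiffOn_metRep x₀ g
  have hd : ∀ u v w, ContDiffOn ℝ ∞ (fun p => fderiv ℝ (metRep x₀ g) p u v w) (dom E x₀) := by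
    intro u v w
    have h1 : ContDiffOn ℝ ∞ (fun p => metRep x₀ g p v w) (dom E x₀) :=
      (hG.clm_apply contDiffOn_const).clm_apply contDiffOn_const
    have h2 := (h1.fderiv_of_isOpen (m := ∞) (isOpen_dom x₀) (by simp)).clm_apply
      (contDiffOn_const (c := u))
    refine h2.congr fun p hp => ?_
    rw [(hasFDerivAt_clm_const₂ (differentiableAt_metRep x₀ g hp) v w).fderiv]
    rfl
  rw [contDiffOn_clm_apply]
  intro u
  rw [contDiffOn_clm_apply]
  intro v
  refine contDiffOn_of_metric hG (fun p hp w hw => metRep_pos x₀ g hp hw) ?_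
  intro w
  refine ((((hd u v w).add (hd v u w)).sub (hd w u v)).const_smul (2⁻¹ : ℝ)).congr ?_
  intro p hp
  have hs : ∀ u v, metRep x₀ g p u v = metRep x₀ g p v u := fun u v => g.symm _ _ _
  have e : ∀ u v w, fderiv ℝ (metRep x₀ g) p u v w = _ := fderiv_metRep x₀ g hp
  simp only [e, smul_eq_mul, hs u, hs v, chris_symm x₀ g hp v u,
    chris_symm x₀ g hp w u, chris_symm x₀ g hp w v]
  ring

/-- A Kähler structure, read in a chart. -/
lemma IsKaehler.isLocalKaehler (hJ : IsKaehler g J) :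
    IsLocalKaehler (dom E x₀) (metRep x₀ g) (chris x₀ g) (endRep x₀ J) where
  isOpen := isOpen_dom x₀
  smooth_metric := contDiffOn_metRep x₀ g
  smooth_chris := contDiffOn_chris x₀ g
  smooth_complex := contDiffOn_endRep x₀ hJ.smooth
  symm _ _ _ := g.symm _ _ _
  pos hq _ hv := metRep_pos x₀ g hq hv
  chris_symm hq := chris_symm x₀ g hq
  fderiv_metric hq := fderiv_metRep x₀ g hq
  sq hq v := by
    rw [endRep_apply, frame_endRep x₀ J hq, hJ.sq, map_neg, coframe_frame x₀ (par_mem x₀ hq)]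
  orthogonal hq u v := by
    rw [metRep_apply, frame_endRep x₀ J hq, frame_endRep x₀ J hq, hJ.orthogonal]
    rfl
  parallel hq u v := by
    rw [← coframe_covEnd x₀ g hJ.smooth hq, hJ.parallel, map_zero]

lemma inner_grad (f : M → ℝ) (x : M) (v : Tan E x) : g.inner x (grad g f x) v = diff f x v :=
  inner_sharp g x _ v

lemma grad_eq_zero_iff (f : M → ℝ) (x : M) : grad g f x = 0 ↔ diff (E := E) f x = 0 := by
  constructor
  · intro h0
    ext v
    rw [← inner_grad (g := g), h0, map_zero]
  · intro h0
    apply ext_inner g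
    intro w
    rw [inner_grad, h0, map_zero]

lemma vecRep_grad_eq_zero_iff (f : M → ℝ) {q : E} (hq : q ∈ dom E x₀) :
    vecRep x₀ (grad g f) q = 0 ↔ diff (E := E) f (par x₀ q) = 0 := by
  rw [← grad_eq_zero_iff (g := g)]
  constructor
  · intro h0
    rw [← frame_vecRep x₀ (grad g f) hq, h0, map_zero]
  · intro h0
    rw [vecRep, h0, map_zero]

omit [FiniteDimensional ℝ E] in
lemma contDiffOn_comp_par {f : M → ℝ} (hf : ContMDiff 𝓘(ℝ, E) 𝓘(ℝ) ∞ f) :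
    ContDiffOn ℝ ∞ (fun p => f (par x₀ p)) (dom E x₀) := fun q hq =>
  (contMDiffAt_iff_contDiffAt.1 ((hf _).comp q (contMDiffAt_par x₀ hq))).contDiffWithinAt

/-- The gradient of a smooth function, read in a chart. -/
lemma isLocalGrad {f : M → ℝ} (hf : ContMDiff 𝓘(ℝ, E) 𝓘(ℝ) ∞ f) :
    IsLocalGrad (dom E x₀) (metRep x₀ g) (fun p => f (par x₀ p)) (vecRep x₀ (grad g f)) := by
  have hg : ∀ q ∈ dom E x₀, ∀ v, metRep x₀ g q (vecRep x₀ (grad g f) q) v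
      = fderiv ℝ (fun p => f (par x₀ p)) q v := by
    intro q hq v
    rw [metRep_apply, frame_vecRep x₀ _ hq, inner_grad,
      diff_frame x₀ hq (hf.mdifferentiable (by simp) _)]
  refine ⟨contDiffOn_comp_par x₀ hf, ?_, fun hq v => hg _ hq v⟩
  refine contDiffOn_of_metric (contDiffOn_metRep x₀ g)
    (fun p hp w hw => metRep_pos x₀ g hp hw) fun w => ?_
  exact (((contDiffOn_comp_par x₀ hf).fderiv_of_isOpen (m := ∞) (isOpen_dom x₀) (by simp)).clm_apply
    contDiffOn_const).congr fun q hq => hg q hq w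

omit [FiniteDimensional ℝ E] [IsManifold 𝓘(ℝ, E) ∞ M] in
/-- Every point lies in the domain of the chart centred at it. -/
lemma exists_par (x : M) : ∃ q ∈ dom E x, par x q = x :=
  ⟨coo E x x, coo_mem x (mem_chart_source E x), par_coo x (mem_chart_source E x)⟩

omit [FiniteDimensional ℝ E] [IsManifold 𝓘(ℝ, E) ∞ M] in
variable (E) in
/-- Properties of the points of `M` may be checked in charts. -/
lemma forall_of_chart {P : M → Prop} (h : ∀ x₀ : M, ∀ q ∈ dom E x₀, P (par x₀ q)) (x : M) :
    P x := by
  obtain ⟨q, hq, hx⟩ := exists_par (E := E) x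
  exact hx ▸ h x q hq

omit [FiniteDimensional ℝ E] in
lemma eventually_par_iff {P : M → Prop} (x₀ : M) {q : E} (hq : q ∈ dom E x₀) :
    (∀ᶠ y in nhds (par x₀ q), P y) ↔ ∀ᶠ p in nhds q, P (par x₀ p) := by
  constructor
  · exact (contMDiffAt_par x₀ hq).continuousAt.eventually
  · intro hP
    have hc := (contMDiffAt_coo (E := E) x₀ (par_mem x₀ hq)).continuousAt
    rw [ContinuousAt, coo_par x₀ hq] at hc
    filter_upwards [hc.eventually hP,
      (chartAt E x₀).open_source.mem_nhds (par_mem x₀ hq)] with y hy hy2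
    rwa [par_coo x₀ hy2] at hy

lemma smoothField_grad {f : M → ℝ} (hf : ContMDiff 𝓘(ℝ, E) 𝓘(ℝ) ∞ f) :
    SmoothField (grad g f) := by
  refine forall_of_chart E fun x₀ q hq => ?_
  exact (contMDiffAt_field_iff x₀ _ hq).2
    ((isLocalGrad x₀ hf).smooth_field.contDiffAt ((isOpen_dom x₀).mem_nhds hq))

lemma hess_frame {f : M → ℝ} (hf : ContMDiff 𝓘(ℝ, E) 𝓘(ℝ) ∞ f) {q : E} (hq : q ∈ dom E x₀)
    (u : E) : hess g f (par x₀ q) (frame x₀ (par x₀ q) u) =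
      frame x₀ (par x₀ q) (covVec (chris x₀ g) (vecRep x₀ (grad g f)) q u) :=
  leviCivita_frame x₀ g hq ((smoothField_grad hf).mdifferentiable (by simp) _) u

/-- The symmetry of the Hessian. -/
lemma inner_hess_symm (hJ : IsKaehler g J) {f : M → ℝ} (hf : ContMDiff 𝓘(ℝ, E) 𝓘(ℝ) ∞ f) (x : M)
    (u v : Tan E x) : g.inner x (hess g f x u) v = g.inner x u (hess g f x v) := by
  revert u v
  refine forall_of_chart (P := fun x => ∀ u v : Tan E x,
    g.inner x (hess g f x u) v = g.inner x u (hess g f x v)) E (fun x₀ q hq => ?_) x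
  intro u v
  rw [← frame_coframe x₀ (par_mem x₀ hq) u, ← frame_coframe x₀ (par_mem x₀ hq) v,
    hess_frame x₀ hf hq, hess_frame x₀ hf hq]
  exact (hJ.isLocalKaehler x₀).hess_symm (isLocalGrad x₀ hf) hq _ _

/-- The trace of a `(1,1)`-tensor may be computed in a chart. -/
lemma opTrace_endRep (A : EndField E M) {q : E} (hq : q ∈ dom E x₀) :
    opTrace E (endRep x₀ A q) = LinearMap.trace ℝ (Tan E (par x₀ q)) (A (par x₀ q)).toLinearMap := by
  have hmem := par_mem x₀ hq
  set e : E ≃ₗ[ℝ] Tan E (par x₀ q) := LinearEquiv.ofLinearMap (frame x₀ (par x₀ q)).toLinearMap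
    (coframe x₀ (par x₀ q)).toLinearMap (by ext v; exact frame_coframe x₀ hmem v)
    (by ext v; exact coframe_frame x₀ hmem v) with he
  rw [opTrace_eq, ← LinearMap.trace_conj' _ e]
  congr 1
  ext v
  rw [LinearEquiv.conj_apply_apply]
  change frame x₀ (par x₀ q) (endRep x₀ A q (coframe x₀ (par x₀ q) v)) = _
  rw [frame_endRep x₀ A hq, frame_coframe x₀ hmem]
  rfl

end KaehlerChart

/-! ### The curvature and Ricci tensors in a chart -/

section RicciChart

variable {E : Type*} [NormedAddCommGroup E] [NormedSpace ℝ E] [FiniteDimensional ℝ E]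
  {M : Type*} [TopologicalSpace M] [ChartedSpace E M] [IsManifold 𝓘(ℝ, E) ∞ M] (x : M)
  (g : RMetric E M)

lemma leviCivita_center {Y : VField E M} (hY : DifferentiableAt ℝ (vecRep x Y) (coo E x x))
    (u : Tan E x) :
    coframe x x (leviCivita g Y x u) = covVec (chris x g) (vecRep x Y) (coo E x x) (coframe x x u)
    := by
  have hx := mem_chart_source E x
  have hq := coo_mem x hx
  have h1 := fun u => vecRep_leviCivita x g hq ((diffAt_iff x Y hq).2 hY) u
  have h2 : ∀ z, z = x → (∀ u : E, coframe x z (leviCivita g Y z (frame x z u))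
      = covVec (chris x g) (vecRep x Y) (coo E x x) u) →
      ∀ u : E, coframe x x (leviCivita g Y x (frame x x u))
      = covVec (chris x g) (vecRep x Y) (coo E x x) u := by
    rintro _ rfl h
    exact h
  rw [← h2 _ (par_coo x hx) h1, frame_coframe x hx]

omit [FiniteDimensional ℝ E] in
lemma vecRep_extend (v : Tan E x) {q : E} (hq : q ∈ dom E x) :
    vecRep x (extend E v) q = coframe x x v := by
  rw [vecRep, extend_eq_coordField x v (par_mem x hq)]
  exact coframe_frame x (par_mem x hq) _

lemma vecRep_leviCivita_extend (v w : Tan E x) {q : E} (hq : q ∈ dom E x) :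
    vecRep x (fun y => leviCivita g (extend E w) y (extend E v y)) q =
      chris x g q (coframe x x v) (coframe x x w) := by
  have e : vecRep x (extend E w) =ᶠ[nhds q] fun _ => coframe x x w := by
    filter_upwards [(isOpen_dom x).mem_nhds hq] with p hp using vecRep_extend x w hp
  have hd : DiffAt (extend E w) (par x q) :=
    (diffAt_iff x _ hq).2 ((differentiableAt_const _).congr_of_eventuallyEq e)
  rw [vecRep, extend_eq_coordField x v (par_mem x hq)]
  refine (vecRep_leviCivita x g hq hd _).trans ?_
  rw [e.fderiv_eq, vecRep_extend x w hq]
  simp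

/-- The curvature tensor in a chart centred at the point considered. -/
lemma coframe_curv (u v w : Tan E x) : coframe x x (curv g x u v w) =
    curvOp (chris x g) (coo E x x) (coframe x x v) (coframe x x w) (coframe x x u) := by
  have hx := mem_chart_source E x
  have hq := coo_mem x hx
  have hU := (isOpen_dom (E := E) x).mem_nhds hq
  have hΓ : DifferentiableAt ℝ (chris x g) (coo E x x) :=
    ((contDiffOn_chris x g).contDiffAt hU).differentiableAt (by simp)
  have e : ∀ v w : Tan E x, vecRep x (fun y => leviCivita g (extend E w) y (extend E v y))
      =ᶠ[nhds (coo E x x)] fun p => chris x g p (coframe x x v) (coframe x x w) := by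
    intro v w
    filter_upwards [hU] with p hp using vecRep_leviCivita_extend x g v w hp
  have hd : ∀ v w : Tan E x, DifferentiableAt ℝ
      (vecRep x (fun y => leviCivita g (extend E w) y (extend E v y))) (coo E x x) :=
    fun v w => (hasFDerivAt_clm_const₂ hΓ _ _).differentiableAt.congr_of_eventuallyEq (e v w)
  have hb : bracket (extend E u) (extend E v) x = 0 := by
    have h1 := leviCivita_torsion g (diffAt_extend u) (diffAt_extend v)
    have h2 : ∀ v w : Tan E x, coframe x x (leviCivita g (extend E w) x (extend E v x)) =
        chris x g (coo E x x) (coframe x x v) (coframe x x w) := by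
      intro v w
      rw [← vecRep_leviCivita_extend x g v w hq, vecRep_coo x _ hx]
    rw [← h1, ← frame_coframe x hx (_ - _), map_sub, h2, h2, chris_symm x g hq, sub_self, map_zero]
  have hc : ∀ v w, covVec (chris x g)
      (vecRep x (fun y => leviCivita g (extend E w) y (extend E v y))) (coo E x x)
      = covVec (chris x g) (fun p => chris x g p (coframe x x v) (coframe x x w)) (coo E x x) := by
    intro v w
    rw [covVec, covVec, (e v w).fderiv_eq, (e v w).self_of_nhds]
  rw [curv, hb, map_zero, sub_zero, map_sub, leviCivita_center x g (hd v w),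
    leviCivita_center x g (hd u w), hc, hc, curvOp_apply hΓ]

/-- The Ricci tensor in a chart centred at the point considered. -/
lemma ricci_eq_opTrace (v w : Tan E x) : ricci g x v w =
    opTrace E (curvOp (chris x g) (coo E x x) (coframe x x v) (coframe x x w)) := by
  have hx := mem_chart_source E x
  set R := curvOp (chris x g) (coo E x x) (coframe x x v) (coframe x x w) with hR
  set e : E ≃ₗ[ℝ] Tan E x := LinearEquiv.ofLinearMap (frame x x).toLinearMap
    (coframe x x).toLinearMap (by ext v; exact frame_coframe x hx v)
    (by ext v; exact coframe_frame x hx v) with he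
  have h1 : ∀ u, curv g x u v w = e.conj R.toLinearMap u := by
    intro u
    rw [LinearEquiv.conj_apply_apply, ← frame_coframe x hx (curv g x u v w), coframe_curv]
    rfl
  rw [opTrace_eq, ← LinearMap.trace_conj' _ e,
    LinearMap.trace_eq_matrix_trace ℝ (Module.finBasis ℝ (Tan E x)), ricci]
  simp only [h1, Matrix.trace, Matrix.diag, LinearMap.toMatrix_apply]
  rfl

end RicciChart

/-! ### Symmetric endomorphisms with at most one nonzero eigenvalue -/

section Spectral

variable {V : Type*} [AddCommGroup V] [Module ℝ V] [FiniteDimensional ℝ V]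
  {B : V →ₗ[ℝ] V →ₗ[ℝ] ℝ} {T : V →ₗ[ℝ] V} {c : ℝ}

/-- A symmetric endomorphism with eigenvalues in `{0, c}` satisfies `T² = c T`, being
diagonalizable. -/
lemma apply_apply_of_eigenvalues (hsymm : ∀ u v, B u v = B v u) (hpos : ∀ v, v ≠ 0 → 0 < B v v)
    (hT : ∀ u v, B (T u) v = B u (T v))
    (hspec : ∀ d, Module.End.HasEigenvalue T d → d = 0 ∨ d = c) (v : V) :
    T (T v) = c • T v := by
  let core : InnerProductSpace.Core ℝ V :=
    { inner := fun u v => B u v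
      conj_inner_symm := fun u v => by simp [hsymm v u]
      re_inner_nonneg := fun v => by
        rcases eq_or_ne v 0 with rfl | hv
        · simp
        · simpa using (hpos v hv).le
      add_left := fun u v w => by simp
      smul_left := fun u v r => by simp
      definite := fun v hv => by
        by_contra hne
        exact (hpos v hne).ne' hv }
  let _ : NormedAddCommGroup V := core.toNormedAddCommGroup
  let _ : InnerProductSpace ℝ V := InnerProductSpace.ofCore core.toCore
  have hs : T.IsSymmetric := fun u v => hT u v
  have htop : (⨆ d : ℝ, Module.End.eigenspace T d) = ⊤ :=
    Submodule.orthogonal_eq_bot_iff.1 hs.orthogonalComplement_iSup_eigenspaces_eq_bot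
  have hle : (⨆ d : ℝ, Module.End.eigenspace T d) ≤ LinearMap.ker (T.comp T - c • T) := by
    refine iSup_le fun d w hw => ?_
    have hTw : T w = d • w := Module.End.mem_eigenspace_iff.1 hw
    rw [LinearMap.mem_ker]
    rcases eq_or_ne w 0 with rfl | hw0
    · simp
    · rcases hspec d (Module.End.hasEigenvalue_of_hasEigenvector ⟨hw, hw0⟩) with rfl | rfl
      · simp [hTw]
      · simp [hTw]
  have hv : v ∈ LinearMap.ker (T.comp T - c • T) := hle (htop ▸ Submodule.mem_top)
  exact sub_eq_zero.1 (LinearMap.mem_ker.1 hv)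

omit [FiniteDimensional ℝ V] in
lemma eq_zero_of_sq_eq_zero (hpos : ∀ v, v ≠ 0 → 0 < B v v)
    (hT : ∀ u v, B (T u) v = B u (T v)) (hsq : ∀ v, T (T v) = 0) (v : V) : T v = 0 := by
  by_contra hne
  have h1 := hpos _ hne
  rw [hT, hsq, map_zero] at h1
  exact lt_irrefl _ h1

lemma trace_of_sq_eq_smul (hsq : ∀ v, T (T v) = c • T v) (hc : c ≠ 0) :
    LinearMap.trace ℝ V T = Module.finrank ℝ (Module.End.eigenspace T c) * c := by
  have hP : LinearMap.IsProj (Module.End.eigenspace T c) (c⁻¹ • T) := by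
    constructor
    · intro v
      rw [Module.End.mem_eigenspace_iff, LinearMap.smul_apply, map_smul, hsq, smul_comm]
    · intro v hv
      rw [LinearMap.smul_apply, Module.End.mem_eigenspace_iff.1 hv, smul_smul, inv_mul_cancel₀ hc,
        one_smul]
  have h1 := hP.trace
  rw [map_smul, smul_eq_mul, inv_mul_eq_iff_eq_mul₀ hc] at h1
  rw [h1, mul_comm]

/-- A two-dimensional kernel invariant under a complex structure is spanned by `a`, `J a`. -/
lemma exists_eq_of_mem_ker {J : V →ₗ[ℝ] V} (hJ : ∀ v, J (J v) = -v)
    (hTJ : ∀ v, T (J v) = J (T v)) (hker : Module.finrank ℝ (LinearMap.ker T) = 2) {a v : V}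
    (ha : a ≠ 0) (hTa : T a = 0) (hTv : T v = 0) : ∃ s t : ℝ, v = s • a + t • J a := by
  have hli : LinearIndependent ℝ ![a, J a] := by
    rw [LinearIndependent.pair_iff]
    intro s t hst
    have h1 := congrArg J hst
    rw [map_add, map_smul, map_smul, hJ, map_zero] at h1
    have h2 : (s * s + t * t) • a = 0 := by
      have : (s * s + t * t) • a = s • (s • a + t • J a) - t • (s • J a + t • -a) := by
        module
      rw [this, hst, h1, smul_zero, smul_zero, sub_zero]
    have h3 := (smul_eq_zero.1 h2).resolve_right ha
    constructor <;> nlinarith [mul_self_nonneg s, mul_self_nonneg t]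
  have hle : Submodule.span ℝ (Set.range ![a, J a]) ≤ LinearMap.ker T := by
    rw [Submodule.span_le]
    rintro _ ⟨i, rfl⟩
    fin_cases i
    · exact hTa
    · change T (J a) = 0
      rw [hTJ, hTa, map_zero]
  have heq : Submodule.span ℝ (Set.range ![a, J a]) = LinearMap.ker T := by
    refine Submodule.eq_of_le_of_finrank_eq hle ?_
    rw [finrank_span_eq_card hli, hker]
    rfl
  have hv : v ∈ Submodule.span ℝ (Set.range ![a, J a]) := heq ▸ LinearMap.mem_ker.2 hTv
  rw [Matrix.range_cons, Matrix.range_cons, Matrix.range_empty, Set.union_empty,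
    Set.singleton_union, Submodule.mem_span_pair] at hv
  obtain ⟨s, t, h⟩ := hv
  exact ⟨s, t, h.symm⟩

end Spectral

/-! ### Killing tensors with eigenvalues `0` and `μ` -/

section KillingTensor

variable {E : Type*} [NormedAddCommGroup E] [NormedSpace ℝ E] [FiniteDimensional ℝ E]
  {M : Type*} [TopologicalSpace M] [ChartedSpace E M] [IsManifold 𝓘(ℝ, E) ∞ M]
  {g : RMetric E M} {J S : EndField E M} {μ : M → ℝ} {d : ℕ}

/-- A `J`-invariant Killing tensor with `S² = μ S`, whose kernel is two-dimensional where `μ ≠ 0`;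
`d` is the rank of `S` there. -/
structure IsRankKilling (g : RMetric E M) (J S : EndField E M) (μ : M → ℝ) (d : ℕ) : Prop where
  kaehler : IsKaehler g J
  killing : IsKillingTensor g S
  comm (x : M) (v : Tan E x) : S x (J x v) = J x (S x v)
  rank_pos : 0 < d
  sq (x : M) (v : Tan E x) : S x (S x v) = μ x • S x v
  ker (x : M) (hx : μ x ≠ 0) : Module.finrank ℝ (LinearMap.ker (S x).toLinearMap) = 2
  trace (x : M) : LinearMap.trace ℝ (Tan E x) (S x).toLinearMap = d * μ x

lemma isRankKilling (hJ : IsKaehler g J) (hS : IsKillingTensor g S)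
    (hSJ : ∀ x v, S x (J x v) = J x (S x v)) (hd : 0 < d)
    (hspec : ∀ x, ∀ c : ℝ, Module.End.HasEigenvalue (S x).toLinearMap c → c = 0 ∨ c = μ x)
    (hmult : ∀ x, μ x ≠ 0 →
      Module.finrank ℝ (Module.End.eigenspace (S x).toLinearMap 0) = 2 ∧
      Module.finrank ℝ (Module.End.eigenspace (S x).toLinearMap (μ x)) = d) :
    IsRankKilling g J S μ d := by
  have hsq : ∀ x v, S x (S x v) = μ x • S x v := fun x =>
    apply_apply_of_eigenvalues (T := (S x).toLinearMap)
      (B := (ContinuousLinearMap.coeLM ℝ).comp (g.inner x).toLinearMap) (g.symm x)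
      (g.pos x) (hS.symmetric x) (hspec x)
  refine ⟨hJ, hS, hSJ, hd, hsq, fun x hx => ?_, fun x => ?_⟩
  · rw [← Module.End.eigenspace_zero]
    exact (hmult x hx).1
  · by_cases hx : μ x = 0
    · have : (S x).toLinearMap = 0 := LinearMap.ext fun v =>
        eq_zero_of_sq_eq_zero (T := (S x).toLinearMap)
          (B := (ContinuousLinearMap.coeLM ℝ).comp (g.inner x).toLinearMap) (g.pos x)
          (hS.symmetric x) (fun v => by
            change S x (S x v) = 0
            rw [hsq, hx, zero_smul]) v
      rw [this, hx, map_zero, mul_zero]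
    · rw [trace_of_sq_eq_smul (T := (S x).toLinearMap) (hsq x) hx, (hmult x hx).2]

namespace IsRankKilling

variable (h : IsRankKilling g J S μ d)
include h

lemma opTrace_endRep (x₀ : M) {q : E} (hq : q ∈ dom E x₀) :
    opTrace E (endRep x₀ S q) = d * μ (par x₀ q) := by
  rw [KaehlerKilling.opTrace_endRep x₀ S hq, h.trace]

/-- The eigenvalue function is smooth, being a multiple of the trace. -/
lemma contMDiff_eigenvalue : ContMDiff 𝓘(ℝ, E) 𝓘(ℝ) ∞ μ := by
  have hd : (d : ℝ) ≠ 0 := by exact_mod_cast h.rank_pos.ne'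
  intro x
  have hx := mem_chart_source E x
  have h1 : ContDiffOn ℝ ∞ (fun p => (d : ℝ)⁻¹ * opTrace E (endRep x S p)) (dom E x) :=
    contDiffOn_const.mul ((opTrace E).contDiff.comp_contDiffOn (contDiffOn_endRep x h.killing.smooth))
  have h2 : ContMDiffAt 𝓘(ℝ, E) 𝓘(ℝ) ∞ (fun p => (d : ℝ)⁻¹ * opTrace E (endRep x S p))
      (coo E x x) :=
    (h1.contDiffAt ((isOpen_dom x).mem_nhds (coo_mem x hx))).contMDiffAt
  refine (h2.comp x (contMDiffAt_coo x hx)).congr_of_eventuallyEq ?_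
  filter_upwards [(chartAt E x).open_source.mem_nhds hx] with y hy
  rw [Function.comp_apply, h.opTrace_endRep x (coo_mem x hy), par_coo x hy, ← mul_assoc,
    inv_mul_cancel₀ hd, one_mul]

/-- The Killing tensor, read in a chart. -/
lemma isLocalKilling (x₀ : M) : IsLocalKilling (dom E x₀) (metRep x₀ g) (chris x₀ g)
    (endRep x₀ J) (endRep x₀ S) (fun p => μ (par x₀ p)) (vecRep x₀ (grad g μ)) where
  kaehler := h.kaehler.isLocalKaehler x₀
  isGrad := isLocalGrad x₀ h.contMDiff_eigenvalue
  smooth_S := contDiffOn_endRep x₀ h.killing.smooth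
  S_symm hq u v := by
    rw [metRep_apply, metRep_apply, frame_endRep x₀ S hq, frame_endRep x₀ S hq,
      h.killing.symmetric]
  S_comm hq v := by
    rw [endRep_apply, frame_endRep x₀ J hq, h.comm, ← frame_endRep x₀ S hq]
    rfl
  S_sq hq v := by
    rw [endRep_apply, frame_endRep x₀ S hq, h.sq, map_smul]
    rfl
  S_ne_zero {q} hq hm := by
    by_contra! hS
    have h0 : endRep x₀ S q = 0 := by ext v; exact hS v
    have h1 := h.opTrace_endRep x₀ hq
    rw [h0, map_zero, eq_comm, mul_eq_zero] at h1
    exact h1.elim (by exact_mod_cast h.rank_pos.ne') hm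
  ker_span {q} hq hm a ha hSa v hv := by
    have hz : ∀ w, endRep x₀ S q w = 0 → S (par x₀ q) (frame x₀ (par x₀ q) w) = 0 := by
      intro w hw
      rw [← frame_endRep x₀ S hq, hw, map_zero]
    obtain ⟨s, t, hst⟩ := exists_eq_of_mem_ker (T := (S (par x₀ q)).toLinearMap)
      (J := (J (par x₀ q)).toLinearMap) (h.kaehler.sq _) (h.comm _) (h.ker _ hm)
      (a := frame x₀ (par x₀ q) a) (v := frame x₀ (par x₀ q) v)
      (fun h0 => ha (frame_injective x₀ hq (h0.trans (map_zero _).symm))) (hz a hSa) (hz v hv)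
    refine ⟨s, t, frame_injective x₀ hq ?_⟩
    rw [hst, map_add, map_smul, map_smul, frame_endRep x₀ J hq]
    rfl
  cyclic {q} hq u v w := by
    have e : ∀ u v, covOp (chris x₀ g) (endRep x₀ S) q u v = coframe x₀ (par x₀ q)
        (covEnd g S (par x₀ q) (frame x₀ (par x₀ q) u) (frame x₀ (par x₀ q) v)) := by
      intro u v
      rw [coframe_covEnd x₀ g h.killing.smooth hq]
      rfl
    rw [e, e, e, metRep_apply, metRep_apply, metRep_apply]
    simp only [frame_coframe x₀ (par_mem x₀ hq)]
    exact h.killing.cyclic _ _ _ _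

lemma hess_comm (x : M) (u : Tan E x) : hess g μ x (J x u) = J x (hess g μ x u) := by
  revert u
  refine forall_of_chart (P := fun x => ∀ u : Tan E x,
    hess g μ x (J x u) = J x (hess g μ x u)) E (fun x₀ q hq => ?_) x
  intro u
  have hμ := h.contMDiff_eigenvalue
  rw [← frame_coframe x₀ (par_mem x₀ hq) u, ← frame_endRep x₀ J hq, hess_frame x₀ hμ hq,
    hess_frame x₀ hμ hq, (h.isLocalKilling x₀).hess_comm hq, frame_endRep x₀ J hq]

lemma smoothField_complex_grad : SmoothField (fun x => J x (grad g μ x)) := fun x =>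
  contMDiffAt_end_apply h.kaehler.smooth (smoothField_grad h.contMDiff_eigenvalue x)

lemma diffAt_grad (x : M) : DiffAt (grad g μ) x :=
  (smoothField_grad h.contMDiff_eigenvalue).mdifferentiable (by simp) x

lemma diffAt_complex_grad (x : M) : DiffAt (fun x => J x (grad g μ x)) x :=
  h.smoothField_complex_grad.mdifferentiable (by simp) x

end IsRankKilling

lemma IsKaehler.leviCivita_complex (hJ : IsKaehler g J) {Y : VField E M} {x : M} (hY : DiffAt Y x)
    (u : Tan E x) : leviCivita g (fun y => J y (Y y)) x u = J x (leviCivita g Y x u) := by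
  have h1 := covEnd_apply g hJ.smooth hY u
  rw [hJ.parallel] at h1
  exact sub_eq_zero.1 h1.symm

lemma IsKaehler.inner_complex (hJ : IsKaehler g J) (x : M) (u v : Tan E x) :
    g.inner x (J x u) v = -g.inner x u (J x v) := by
  rw [← hJ.orthogonal x (J x u) v, hJ.sq, map_neg]
  rfl

namespace IsRankKilling

variable (h : IsRankKilling g J S μ d)
include h

/-- The covariant derivative of `J∇μ` is `J` composed with the Hessian, which is skew. -/
lemma isKillingField : IsKillingField g (fun x => J x (grad g μ x)) where
  smooth := h.smoothField_complex_grad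
  lie x Y Z hY hZ := by
    have hK := h.diffAt_complex_grad x
    have e : ∀ u : Tan E x, leviCivita g (fun y => J y (grad g μ y)) x u = J x (hess g μ x u) :=
      h.kaehler.leviCivita_complex (h.diffAt_grad x)
    have h1 := leviCivita_metric g hK hY hZ
    have h2 := leviCivita_torsion g hK hY
    have h3 := leviCivita_torsion g hK hZ
    rw [e] at h2 h3
    rw [← h2, ← h3, h1, map_sub, map_sub, sub_apply, h.kaehler.inner_complex,
      inner_hess_symm h.kaehler h.contMDiff_eigenvalue, h.hess_comm]
    ring

lemma isHolomorphicField : IsHolomorphicField J (fun x => J x (grad g μ x)) where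
  smooth := h.smoothField_complex_grad
  lie x Y hY := by
    have hK := h.diffAt_complex_grad x
    have e : ∀ u : Tan E x, leviCivita g (fun y => J y (grad g μ y)) x u = J x (hess g μ x u) :=
      h.kaehler.leviCivita_complex (h.diffAt_grad x)
    have h2 := leviCivita_torsion g hK hY
    have h3 := leviCivita_torsion g hK (diffAt_end_apply h.kaehler.smooth hY)
    rw [e] at h2 h3
    rw [← h2, ← h3, h.kaehler.leviCivita_complex hY, map_sub, h.hess_comm]

/-- By unique continuation for the Killing field `J∇μ`, if `dμ` vanished on a nonempty open set it
would vanish identically. -/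
lemma dense_regular [ConnectedSpace M] (hμ : ∃ x y, μ x ≠ μ y) :
    Dense {x : M | μ x ≠ 0 ∧ diff (E := E) μ x ≠ 0} := by
  by_contra hnd
  obtain ⟨x, hx⟩ := not_forall.1 hnd
  set Z : Set M := {y | ∀ᶠ z in nhds y, diff (E := E) μ z = 0} with hZ
  have hne : Z.Nonempty := by
    obtain ⟨q, hq, hxq⟩ := exists_par (E := E) x
    refine ⟨x, ?_⟩
    have h1 : ∀ᶠ z in nhds x, ¬ (μ z ≠ 0 ∧ diff (E := E) μ z ≠ 0) := by
      rwa [mem_closure_iff_frequently, Filter.not_frequently] at hx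
    rw [hZ, Set.mem_ofPred_eq, ← hxq, eventually_par_iff x hq]
    rw [← hxq, eventually_par_iff x hq] at h1
    have h2 := (h.isLocalKilling x).eventually_grad_eq_zero hq (by
      filter_upwards [h1, (isOpen_dom x).mem_nhds hq] with p hp hpd
      rw [vecRep_grad_eq_zero_iff x μ hpd]
      tauto)
    filter_upwards [h2, (isOpen_dom x).mem_nhds hq] with p hp hpd
    exact (vecRep_grad_eq_zero_iff x μ hpd).1 hp
  have hopen : IsOpen Z := isOpen_iff_mem_nhds.2 fun y hy => eventually_eventually_nhds.2 hy
  have hclosed : IsClosed Z := by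
    refine isClosed_of_closure_subset fun y hy => ?_
    obtain ⟨q, hq, hyq⟩ := exists_par (E := E) y
    obtain ⟨r, hr, hball⟩ := Metric.isOpen_iff.1 (isOpen_dom (E := E) y) q hq
    rw [mem_closure_iff_frequently, ← hyq] at hy
    obtain ⟨a, haZ, ha⟩ : ∃ a, par y a ∈ Z ∧ a ∈ Metric.ball q r := by
      have h1 : ∃ᶠ p in nhds q, par y p ∈ Z := by
        intro hn
        exact hy ((eventually_par_iff y hq).2 hn)
      exact (h1.and_eventually (Metric.ball_mem_nhds q hr)).exists
    have h0 : ∀ᶠ p in nhds a, vecRep y (grad g μ) p = 0 := by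
      have h1 := (eventually_par_iff y (hball ha)).1 haZ
      filter_upwards [h1, (isOpen_dom y).mem_nhds (hball ha)] with p hp hpd
      exact (vecRep_grad_eq_zero_iff y μ hpd).2 hp
    rw [hZ, Set.mem_ofPred_eq, ← hyq, eventually_par_iff y hq]
    filter_upwards [Metric.ball_mem_nhds q hr] with p hp
    exact (vecRep_grad_eq_zero_iff y μ (hball hp)).1
      ((h.isLocalKilling y).grad_eq_zero_of_ball hball ha hp h0)
  have huniv : Z = Set.univ := IsClopen.eq_univ ⟨hclosed, hopen⟩ hne
  have hconst : IsLocallyConstant μ := by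
    rw [IsLocallyConstant.iff_eventually_eq]
    intro y
    obtain ⟨q, hq, hyq⟩ := exists_par (E := E) y
    obtain ⟨r, hr, hball⟩ := Metric.isOpen_iff.1 (isOpen_dom (E := E) y) q hq
    suffices hs : ∀ᶠ z in nhds (par y q), μ z = μ (par y q) by rwa [hyq] at hs
    rw [eventually_par_iff y hq]
    filter_upwards [Metric.ball_mem_nhds q hr] with p hp
    have hg := (h.isLocalKilling y).isGrad
    refine Metric.isOpen_ball.is_const_of_fderiv_eq_zero (𝕜 := ℝ) (f := fun p => μ (par y p))
      (convex_ball q r).isPreconnected ?_ ?_ hp (Metric.mem_ball_self hr)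
    · exact (hg.smooth_fun.mono hball).differentiableOn (by simp)
    · intro z hz
      have hN : vecRep y (grad g μ) z = 0 := (vecRep_grad_eq_zero_iff y μ (hball hz)).2 (by
        have hmem : par y z ∈ Z := huniv ▸ Set.mem_univ _
        have hev : ∀ᶠ x in nhds (par y z), diff (E := E) μ x = 0 := hmem
        exact hev.self_of_nhds)
      ext v
      rw [← hg.grad (hball hz), hN, map_zero]
      rfl
  obtain ⟨a, b, hab⟩ := hμ
  exact hab (hconst.apply_eq_of_isPreconnected isPreconnected_univ (Set.mem_univ a)
    (Set.mem_univ b))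

/-- Where `dμ ≠ 0`, the vectors orthogonal to `∇μ` and `J∇μ` are eigenvectors of the Hessian, with
eigenvalue `|∇μ|² / (2μ)`. -/
lemma hess_of_orthogonal (hE : 2 < Module.finrank ℝ E) {x : M} (hx : diff (E := E) μ x ≠ 0)
    {v : Tan E x} (h1 : g.inner x v (grad g μ x) = 0) (h2 : g.inner x v (J x (grad g μ x)) = 0) :
    hess g μ x v = (g.inner x (grad g μ x) (grad g μ x) / (2 * μ x)) • v := by
  revert hx v
  refine forall_of_chart (P := fun x => diff (E := E) μ x ≠ 0 → ∀ {v : Tan E x},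
    g.inner x v (grad g μ x) = 0 → g.inner x v (J x (grad g μ x)) = 0 →
    hess g μ x v = (g.inner x (grad g μ x) (grad g μ x) / (2 * μ x)) • v) E (fun x₀ q hq => ?_) x
  intro hx v h1 h2
  have hL := h.isLocalKilling x₀
  have hN : vecRep x₀ (grad g μ) q ≠ 0 := fun h0 => hx ((vecRep_grad_eq_zero_iff x₀ μ hq).1 h0)
  have hm : μ (par x₀ q) ≠ 0 := hL.potential_ne_zero hE hq hN
  have hmem := par_mem x₀ hq
  have key := hL.hess_of_orthogonal hq hm hN (v := coframe x₀ (par x₀ q) v)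
    (by rw [metRep_apply, frame_coframe x₀ hmem, frame_vecRep x₀ _ hq, h1])
    (by rw [metRep_apply, frame_coframe x₀ hmem, frame_endRep x₀ J hq, frame_vecRep x₀ _ hq, h2])
  have key2 := congrArg (frame x₀ (par x₀ q)) key
  rw [map_smul, map_smul, ← hess_frame x₀ h.contMDiff_eigenvalue hq, frame_coframe x₀ hmem,
    metRep_vecRep x₀ g _ _ hq] at key2
  rw [div_eq_inv_mul, mul_smul, ← key2, smul_smul, inv_mul_cancel₀ (by simpa using hm), one_smul]

/-- The gradient of the eigenvalue function is an eigenfield of the Ricci tensor. -/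
lemma ricci_grad (hE : 2 < Module.finrank ℝ E) (x : M) :
    ∃ c : ℝ, ∀ w, ricci g x (grad g μ x) w = c * g.inner x (grad g μ x) w := by
  have hx := mem_chart_source E x
  have hq := coo_mem x hx
  have hL := h.isLocalKilling x
  have hpx := par_coo (E := E) x hx
  set q := coo E x x with hqdef
  have hN : vecRep x (grad g μ) q = coframe x x (grad g μ x) := vecRep_coo x _ hx
  have hG : ∀ u v : Tan E x, metRep x g q (coframe x x u) (coframe x x v) = g.inner x u v := by
    have h1 : ∀ z, z = x → ∀ u v : Tan E x, g.inner z (frame x z (coframe x x u))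
        (frame x z (coframe x x v)) = g.inner x u v := by
      rintro _ rfl u v
      rw [frame_coframe _ hx, frame_coframe _ hx]
    exact h1 _ hpx
  set Ric : Tan E x → ℝ := fun w => ricci g x (grad g μ x) w with hRic
  have hR : ∀ w, Ric w = opTrace E (curvOp (chris x g) q (vecRep x (grad g μ) q) (coframe x x w)) :=
    fun w => by rw [hN]; exact ricci_eq_opTrace x g _ w
  by_cases h0 : vecRep x (grad g μ) q = 0
  · refine ⟨0, fun w => ?_⟩
    change Ric w = _
    have hz : curvOp (chris x g) q 0 (coframe x x w) = 0 := by
      ext u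
      rw [hL.kaehler.curvOp_swap hq, map_zero, neg_zero]
      rfl
    rw [hR, h0, hz, map_zero, zero_mul]
  · have hm : μ (par x q) ≠ 0 := hL.potential_ne_zero hE hq h0
    have hpos : 0 < g.inner x (grad g μ x) (grad g μ x) := by
      rw [← hG, ← hN]
      exact hL.kaehler.pos hq h0
    have hadd : ∀ a b, Ric (a + b) = Ric a + Ric b := by
      intro a b
      rw [hR, hR, hR, map_add, hL.kaehler.curvOp_add hq, map_add]
    have hsmul : ∀ (t : ℝ) a, Ric (t • a) = t * Ric a := by
      intro t a
      rw [hR, hR, map_smul, hL.kaehler.curvOp_smul hq, map_smul, smul_eq_mul]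
    have hperp : ∀ w, g.inner x (grad g μ x) w = 0 → Ric w = 0 := by
      intro w hw
      rw [hR]
      refine hL.opTrace_curvOp_eq_zero (k := d) (fun p hp => h.opTrace_endRep x hp) hq hm h0 ?_
      rw [hN, hG, hw]
    refine ⟨Ric (grad g μ x) / g.inner x (grad g μ x) (grad g μ x), fun w => ?_⟩
    set t := g.inner x (grad g μ x) w / g.inner x (grad g μ x) (grad g μ x) with ht
    have h1 := hperp (w - t • grad g μ x) (by
      rw [map_sub, map_smul, smul_eq_mul, ht, div_mul_cancel₀ _ hpos.ne', sub_self])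
    have h2 := hadd (w - t • grad g μ x) (t • grad g μ x)
    rw [sub_add_cancel, h1, hsmul, zero_add] at h2
    change Ric w = _
    rw [h2, ht]
    ring

end IsRankKilling

end KillingTensor

end KaehlerKilling

end

open KaehlerKilling in
theorem proposition4p2 {E : Type*} [NormedAddCommGroup E] [NormedSpace ℝ E]
    [FiniteDimensional ℝ E]
    {M : Type*} [TopologicalSpace M] [ChartedSpace E M] [IsManifold 𝓘(ℝ, E) ∞ M]
    [T2Space M] [CompactSpace M] [ConnectedSpace M]
    (n : ℕ) (hn : 2 ≤ n) (hdim : Module.finrank ℝ E = 2 * n)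
    (g : RMetric E M) (J : EndField E M) (hJ : IsKaehler g J)
    (S : EndField E M) (hS : IsKillingTensor g S)
    (hSJ : ∀ x v, S x (J x v) = J x (S x v))
    (μ : M → ℝ) (hμ : ∃ x y, μ x ≠ μ y)
    (hspec : ∀ x, ∀ c : ℝ, Module.End.HasEigenvalue (S x).toLinearMap c → c = 0 ∨ c = μ x)
    (hmult : ∀ x, μ x ≠ 0 →
      Module.finrank ℝ (Module.End.eigenspace (S x).toLinearMap 0) = 2 ∧
      Module.finrank ℝ (Module.End.eigenspace (S x).toLinearMap (μ x)) = 2 * n - 2) :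
    IsKillingField g (fun x => J x (grad g μ x)) ∧
    IsHolomorphicField J (fun x => J x (grad g μ x)) ∧
    IsSpecialKaehlerPotential g J μ ∧
    Dense {x : M | μ x ≠ 0 ∧ diff (E := E) μ x ≠ 0} := by
  have h : IsRankKilling g J S μ (2 * n - 2) :=
    isRankKilling hJ hS hSJ (by omega) hspec hmult
  have hE : 2 < Module.finrank ℝ E := by omega
  refine ⟨h.isKillingField, h.isHolomorphicField, ?_, h.dense_regular hμ⟩
  refine ⟨h.contMDiff_eigenvalue, hμ, h.isKillingField, ?_, fun _ x => h.ricci_grad hE x⟩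
  intro x hx v hv h1 h2
  refine ⟨_, Module.End.mem_eigenspace_iff.2 (h.hess_of_orthogonal hE hx ?_ h1), hv⟩
  rwa [hJ.sq, map_neg, neg_eq_zero] at h2
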